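/- **Setting.** Let $v:\mathbb R^3\to\mathbb R$, $\hat v(p)=\int v(x)e^{-ip\cdot x}\,dx$, and fix $V\in(0,\infty)$. Assume that $v\in L^1(\mathbb R^3)$; $\hat v\in L^2(\mathbb R^3)$; $\hat v(0)>0$ and $\hat v(k)>-\hat v(0)\frac{|k|^2}{4\nu}$ for all $k\in\mathbb R^3$ and all $\nu\in(0,V]$; $v(-x)=v(x)$; $v$ is rotationally invariant; $\hat v$ is $C^5$ in a neighbourhood of $0$; and $\frac{\nu}{\hat v(0)}\frac{d^2\hat v}{dk^2}(0)>-\frac12$ for all $\nu\in(0,V]$, where in the last condition $\hat v$ is regarded as a function of $k=|k|$. For $\nu\in(0,V]$ let $$\omega(k)=\sqrt{\tfrac14|k|^4+\tfrac{\nu\hat v(k)}{\hat v(0)}|k|^2},\qquad s_k,\,c_k=\frac{\sqrt{\sqrt{\omega(k)^2+\nu^2\hat v(k)^2/\hat v(0)^2}\mp\omega(k)}}{\sqrt{2\omega(k)}}$$ (upper sign for $s_k$), $$j(k;p,q)=\sqrt{\tfrac{\nu}{\hat v(0)}}\Big[\hat v(k)(s_k-c_k)(c_ps_q+c_qs_p)+\hat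 v(p)(c_p-s_p)(c_kc_q+s_ks_q)+\hat v(q)(c_q-s_q)(c_pc_k+s_ps_k)\Big],$$ and for $\beta>0$, $k\neq0$ let the Beliaev damping rate be $$\gamma_B(k;\beta,\nu)=\frac\pi2\int\frac{dp}{(2\pi)^3}\,j(k;p,p-k)^2\,\frac{\big(1-e^{\frac\beta2(\omega(k)+\omega(p)+\omega(k-p))}\big)^2}{(e^{\beta\omega(k)}-1)(e^{\beta\omega(p)}-1)(e^{\beta\omega(k-p)}-1)}\;\delta\big(\omega(k)-\omega(p)-\omega(k-p)\big),$$ where $\int g(p)\,\delta(\Phi(p))\,dp:=\lim_{\varepsilon\downarrow0}\int g(p)\,\frac1\pi\frac{\varepsilon}{\Phi(p)^2+\varepsilon^2}\,dp$. For $\theta>0$ let $$\mathcal I(\theta)=\theta(1-e^{-\theta})\int_{-1}^1\frac{(1-t^2)^2}{(1-e^{-\theta\frac{1+t}2})(1-e^{-\theta\frac{1-t}2})}\,dt,\qquad \mathcal I(0)=\tfrac{16}3 .$$ **Theorem.** All $O$-terms below have constants depending only on $v$ and $V$; they are uniform in $\nu\in(0,V]$, $\beta>0$ and $k\ne0$ such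 that the quantities said to tend to $0$ are smaller than some $\delta=\delta(v,V)>0$. (a) For $|k|/\sqrt\nu$ small, the integrals and the limit defining $\gamma_B(k;\beta,\nu)$ exist and are finite, and $$\gamma_B(k;\beta,\nu)=\frac{9\hat v(0)\nu^{3/2}}{2048\pi}\frac{|k|^4}{\nu^2}\frac1{\beta\nu}\,\mathcal I(\beta\omega(k))\Big(1+O\Big(\frac{|k|^2}\nu\Big)\Big)\qquad\text{as }\frac{|k|}{\sqrt\nu}\to0 .$$ The function $\mathcal I$ is continuous on $[0,\infty)$; it satisfies $\mathcal I(\theta)=\frac{16}3+O(\theta)$ as $\theta\to0$ and $\mathcal I(\theta)=\frac{16}{15}\theta+O(\theta^{-2})$ as $\theta\to+\infty$; and for every $\theta>0$ $$\mathcal I(\theta)=32\,\theta\Big[\frac1{30}+4\Big(\frac{\zeta(3)}{\theta^3}-\frac{6\zeta(4)}{\theta^4}+\frac{12\zeta(5)}{\theta^5}-\frac{\mathrm{Li}_3(e^{-\theta})}{\theta^3}-\frac{6\,\mathrm{Li}_4(e^{-\theta})}{\theta^4}-\frac{12\,\mathrm{Li}_5(e^{-\theta})}{\theta^5}\Big)\Big],\qquad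 \mathrm{Li}_n(z)=\sum_{m\ge1}\frac{z^m}{m^n}.$$ (b) As $\frac{|k|}{\sqrt\nu}\to0$ and $\frac1{\beta\sqrt\nu|k|}\to0$, $$\gamma_B(k;\beta,\nu)=\frac{3\hat v(0)\nu^{3/2}}{640\pi}\frac{|k|^5}{\nu^{5/2}}\Big(1+O\Big(\frac1{(\beta\sqrt\nu|k|)^3}+\frac{|k|^2}\nu\Big)\Big).$$ (c) As $\frac{|k|}{\sqrt\nu}\to0$ and $\beta\sqrt\nu|k|\to0$, $$\gamma_B(k;\beta,\nu)=\frac{3\hat v(0)\nu^{3/2}}{128\pi}\frac{|k|^4}{\nu^2}\frac1{\beta\nu}\Big(1+O\Big(\beta\sqrt\nu|k|+\frac{|k|^2}\nu\Big)\Big).$$ -/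

import Mathlib

open Filter Topology MeasureTheory

noncomputable section

/-- Three-dimensional position / momentum space with its Euclidean norm. -/
abbrev R3 : Type := EuclideanSpace ℝ (Fin 3)

/-- Fourier transform `∫ v(x) exp(-i p·x) dx`, without `2π` in the phase and without prefactor. -/
def fourierC (v : R3 → ℝ) (p : R3) : ℂ :=
  ∫ x : R3, (v x : ℂ) * Complex.exp (-Complex.I * ((inner ℝ p x : ℝ) : ℂ))

/-- The Fourier transform as a real number. For even `v` nothing is lost by taking the real part,
see `fourierC_eq_vhat`. -/
def vhat (v : R3 → ℝ) (p : R3) : ℝ := (fourierC v p).re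

theorem fourierC_eq_vhat (v : R3 → ℝ) (hv : ∀ᵐ x : R3, v (-x) = v x) (p : R3) :
    fourierC v p = (vhat v p : ℂ) := by
  have key : (starRingEnd ℂ) (fourierC v p) = fourierC v p := by
    unfold fourierC
    rw [← integral_conj]
    rw [← integral_neg_eq_self
      (fun x : R3 => (v x : ℂ) * Complex.exp (-Complex.I * ((inner ℝ p x : ℝ) : ℂ)))]
    refine integral_congr_ae ?_
    filter_upwards [hv] with x hx
    simp [← Complex.exp_conj, hx, inner_neg_right]
  exact (Complex.conj_eq_iff_re.mp key).symm

/-- The Fourier transform of a rotationally invariant `v` as a function of the scalar momentum,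
read off along the first coordinate axis (and extended evenly to negative arguments). -/
def vhatRadial (v : R3 → ℝ) (t : ℝ) : ℝ := vhat v (EuclideanSpace.single 0 t)

/-- Bogoliubov dispersion relation. -/
def omegaBg (v : R3 → ℝ) (ν : ℝ) (k : R3) : ℝ :=
  Real.sqrt (‖k‖ ^ 4 / 4 + ν * vhat v k / vhat v 0 * ‖k‖ ^ 2)

/-- Bogoliubov coefficient `s_k`. -/
def sBg (v : R3 → ℝ) (ν : ℝ) (k : R3) : ℝ :=
  Real.sqrt (Real.sqrt (omegaBg v ν k ^ 2 + ν ^ 2 * (vhat v k ^ 2 / vhat v 0 ^ 2))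
      - omegaBg v ν k) / Real.sqrt (2 * omegaBg v ν k)

/-- Bogoliubov coefficient `c_k`. -/
def cBg (v : R3 → ℝ) (ν : ℝ) (k : R3) : ℝ :=
  Real.sqrt (Real.sqrt (omegaBg v ν k ^ 2 + ν ^ 2 * (vhat v k ^ 2 / vhat v 0 ^ 2))
      + omegaBg v ν k) / Real.sqrt (2 * omegaBg v ν k)

/-- Three-quasiparticle vertex `j(k; p, q)`. -/
def vertexJ (v : R3 → ℝ) (ν : ℝ) (k p q : R3) : ℝ :=
  Real.sqrt (ν / vhat v 0) *
    (vhat v k * (sBg v ν k - cBg v ν k) * (cBg v ν p * sBg v ν q + cBg v ν q * sBg v ν p)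
      + vhat v p * (cBg v ν p - sBg v ν p) * (cBg v ν k * cBg v ν q + sBg v ν k * sBg v ν q)
      + vhat v q * (cBg v ν q - sBg v ν q) * (cBg v ν p * cBg v ν k + sBg v ν p * sBg v ν k))

/-- `g(p) δ_ε(Φ(p))` with the nascent delta function `δ_ε(x) = π⁻¹ ε / (x² + ε²)`. -/
def deltaIntegrand (g Φ : R3 → ℝ) (ε : ℝ) (p : R3) : ℝ :=
  g p * (1 / Real.pi * (ε / (Φ p ^ 2 + ε ^ 2)))

/-- `∫ g(p) δ(Φ(p)) dp := lim_{ε ↓ 0} ∫ g(p) δ_ε(Φ(p)) dp`. -/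
def deltaIntegral (g Φ : R3 → ℝ) : ℝ :=
  limUnder (𝓝[>] (0 : ℝ)) (fun ε => ∫ p : R3, deltaIntegrand g Φ ε p)

/-- `∫ g(p) δ(Φ(p)) dp` is well defined: the regularized integrals converge absolutely and have a
finite limit (which is then `deltaIntegral g Φ`). -/
def DeltaIntegrable (g Φ : R3 → ℝ) : Prop :=
  (∀ ε : ℝ, 0 < ε → Integrable (deltaIntegrand g Φ ε)) ∧
    ∃ L : ℝ, Tendsto (fun ε => ∫ p : R3, deltaIntegrand g Φ ε p) (𝓝[>] (0 : ℝ)) (𝓝 L)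

/-- Density multiplying the delta function in the Beliaev rate. -/
def beliaevDensity (v : R3 → ℝ) (ν β : ℝ) (k p : R3) : ℝ :=
  1 / (2 * Real.pi) ^ 3 * vertexJ v ν k p (p - k) ^ 2 *
    ((1 - Real.exp (β / 2 * (omegaBg v ν k + omegaBg v ν p + omegaBg v ν (k - p)))) ^ 2 /
      ((Real.exp (β * omegaBg v ν k) - 1) * (Real.exp (β * omegaBg v ν p) - 1) *
        (Real.exp (β * omegaBg v ν (k - p)) - 1)))

/-- Energy defect `ω(k) - ω(p) - ω(k - p)`, the argument of the delta function. -/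
def beliaevPhase (v : R3 → ℝ) (ν : ℝ) (k p : R3) : ℝ :=
  omegaBg v ν k - omegaBg v ν p - omegaBg v ν (k - p)

/-- The Beliaev damping rate. -/
def gammaB (v : R3 → ℝ) (ν β : ℝ) (k : R3) : ℝ :=
  Real.pi / 2 * deltaIntegral (beliaevDensity v ν β k) (beliaevPhase v ν k)

/-- The function `𝓘(θ)`, with its value by continuity at `θ = 0`. -/
def beliaevI (θ : ℝ) : ℝ :=
  if θ = 0 then 16 / 3 else
    θ * (1 - Real.exp (-θ)) *
      ∫ t in (-1 : ℝ)..1, (1 - t ^ 2) ^ 2 /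
        ((1 - Real.exp (-θ * ((1 + t) / 2))) * (1 - Real.exp (-θ * ((1 - t) / 2))))

/-- Polylogarithm of order `n` at a real argument `|z| < 1`, by its power series. -/
def polyLi (n : ℕ) (z : ℝ) : ℝ := ∑' m : ℕ, z ^ (m + 1) / ((m : ℝ) + 1) ^ n

/-- Values of the Riemann zeta function at natural numbers, as real numbers. -/
def zetaR (n : ℕ) : ℝ := (riemannZeta (n : ℂ)).re

end

/-!
After evenness and rotation invariance of `v` are used to pass to the radial profile
`f(x) = v̂(x) / v̂(0)`, the rate is an integral over `p` of a function of `‖p‖` and `‖p - k‖` only.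

*Existence of the limit.* In bipolar coordinates (`lintegral_bipolar`) the integral over small `p`
becomes an integral over `|r - ‖k‖| < s < r + ‖k‖`. Write `ω(x) = √ν x √m(x)` with
`m(x) = f(x) + x² / (4ν)`. The convexity hypothesis on `v̂` makes `m` strictly increasing near `0`,
so `ω` is strictly increasing and strictly superadditive there. Hence every solution of
`ω(r) + ω(s) = ω(‖k‖)` lies strictly inside the region of integration, and the nascent delta
functions converge to an integral over the energy shell, parametrized by the energy `u` of one
outgoing excitation (`IsDispersion.tendsto_shell`). Dominated convergence needs the density to be
bounded although the thermal factor has poles at zero energy; it is, because the vertex vanishes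
when one outgoing momentum does (`IsProfile.exists_bogDensity_le`). Large `p` are far from the energy
shell and contribute nothing in the limit.

*Leading behaviour.* The vertex is a difference of terms that nearly cancel at small momenta. On the
energy shell the cancellation is exact up to increments of `x² / m(x)`
(`vertex_bracket_on_shell`), which agree with those of `ω² / ν` up to a relative error
`O(k² / ν)`; and with `E = u + w` one has `u (E² - u²) + w (E² - w²) = 3 E u w`. This yields the
density on the shell as an explicit constant times `(u w)²` times the thermal factor, with relative
error `O(k² / ν)` uniform along the shell (`IsProfile.shell_density_estimate`). The thermal factor on
the shell is exactly the one in the definition of `𝓘`, so integration over `u` gives `𝓘(β ω(k))`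
(`integral_leading`).

*The function `𝓘`.* Partial fractions turn the integrand into a polynomial plus polynomial multiples
of the Bose function `x / (eˣ - 1)` (`beliaevI_eq_bose`). Continuity and the behaviour at `0` can be
read off, and expanding the Bose function in a geometric series gives the polylogarithms
(`beliaevI_eq_polyLi`), hence the behaviour at infinity. The two limiting regimes of the rate follow,
since `ω(k) = √ν ‖k‖ (1 + O(k² / ν))`.
-/

noncomputable section

/-! ### The radial profile of the interaction -/

theorem continuous_vhat {v : R3 → ℝ} (hv : Integrable v) : Continuous (vhat v) := by
  have h : Continuous (fourierC v) := by
    refine continuous_of_dominated (bound := fun x => ‖v x‖) ?_ ?_ hv.norm ?_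
    · intro p
      refine (Complex.continuous_ofReal.comp_aestronglyMeasurable hv.1).mul ?_
      exact Continuous.aestronglyMeasurable (by fun_prop)
    · intro p
      refine Eventually.of_forall fun x => ?_
      have : ‖Complex.exp (-Complex.I * ((inner ℝ p x : ℝ) : ℂ))‖ = 1 := by
        rw [Complex.norm_exp]; simp
      rw [norm_mul, this]; simp
    · exact Eventually.of_forall fun x => by fun_prop
  exact Complex.continuous_re.comp h

theorem abs_vhat_le {v : R3 → ℝ} (p : R3) : |vhat v p| ≤ ∫ x, |v x| := by
  refine (Complex.abs_re_le_norm _).trans ?_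
  refine (norm_integral_le_integral_norm _).trans (le_of_eq ?_)
  refine integral_congr_ae (Eventually.of_forall fun x => ?_)
  have : ‖Complex.exp (-Complex.I * ((inner ℝ p x : ℝ) : ℂ))‖ = 1 := by
    rw [Complex.norm_exp]; simp
  simp only [norm_mul, this]; simp

theorem vhat_isometry {v : R3 → ℝ} (R : R3 ≃ₗᵢ[ℝ] R3) (hR : ∀ᵐ x : R3, v (R x) = v x) (p : R3) :
    vhat v (R p) = vhat v p := by
  unfold vhat fourierC
  rw [← R.measurePreserving.integral_comp R.toMeasurableEquiv.measurableEmbedding]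
  congr 1
  refine integral_congr_ae ?_
  filter_upwards [hR] with x hx
  simp [hx]

/-- In odd dimension the reflection exchanging two vectors of equal norm is, up to the sign that
evenness absorbs, a rotation. -/
theorem vhat_eq_of_norm_eq {v : R3 → ℝ} (hsymm : ∀ᵐ x : R3, v (-x) = v x)
    (hrot : ∀ R : R3 ≃ₗᵢ[ℝ] R3, LinearMap.det (R.toLinearEquiv : R3 →ₗ[ℝ] R3) = 1 →
      ∀ᵐ x : R3, v (R x) = v x) {p q : R3} (h : ‖p‖ = ‖q‖) : vhat v p = vhat v q := by
  by_cases hpq : p = q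
  · rw [hpq]
  let K : Submodule ℝ R3 := (Submodule.span ℝ {p - q})ᗮ
  have hKp : K.reflection p = q := Submodule.reflection_sub h
  have hne : p - q ≠ 0 := sub_ne_zero.2 hpq
  have hK : Module.finrank ℝ ((Submodule.span ℝ {p - q})ᗮᗮ : Submodule ℝ R3) = 1 := by
    rw [Submodule.orthogonal_orthogonal]
    exact finrank_span_singleton hne
  let N : R3 ≃ₗᵢ[ℝ] R3 := LinearIsometryEquiv.neg ℝ
  have hdet : LinearMap.det ((K.reflection.trans N).toLinearEquiv : R3 →ₗ[ℝ] R3) = 1 := by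
    have e : ((K.reflection.trans N).toLinearEquiv : R3 →ₗ[ℝ] R3)
        = (-1 : ℝ) • K.reflection.toLinearMap := by
      ext1 x
      simp [N]
    rw [e, LinearMap.det_smul, Submodule.det_reflection, hK]
    simp
    norm_num
  have h1 := vhat_isometry (v := v) (K.reflection.trans N) (hrot _ hdet) p
  have h2 : vhat v (N q) = vhat v q := vhat_isometry N (by simpa [N] using hsymm) q
  rw [← h1, ← h2]
  simp [hKp]

theorem vhat_eq_radial {v : R3 → ℝ} (hsymm : ∀ᵐ x : R3, v (-x) = v x)
    (hrot : ∀ R : R3 ≃ₗᵢ[ℝ] R3, LinearMap.det (R.toLinearEquiv : R3 →ₗ[ℝ] R3) = 1 →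
      ∀ᵐ x : R3, v (R x) = v x) (p : R3) : vhat v p = vhatRadial v ‖p‖ := by
  apply vhat_eq_of_norm_eq hsymm hrot
  simp

/-- The quantitative information about the interaction that the asymptotics depend on, for the
normalized radial profile `f(x) = v̂(x) / v̂(0)`. The constants are uniform in `ν ∈ (0, V]`: the
conditions with `ν` in the denominator are weakest for small `ν`, so they are recorded for `ν = V`.
Smoothness is only required on `[0, R)`, where `f` is an even function, hence `f'(x) = O(x)`. -/
structure IsProfile (f : ℝ → ℝ) (V R L B c : ℝ) : Prop where
  V_pos : 0 < V
  R_pos : 0 < R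
  L_pos : 0 < L
  B_pos : 0 < B
  c_pos : 0 < c
  cont : Continuous f
  zero : f 0 = 1
  bound : ∀ x, |f x| ≤ B
  lower : ∀ x, c * (1 + x ^ 2) ≤ f x + x ^ 2 / (4 * V)
  diff : ∀ x ∈ Set.Ico 0 R, DifferentiableAt ℝ f x
  contDeriv : ∀ x ∈ Set.Ico 0 R, ContinuousAt (deriv f) x
  deriv_le : ∀ x ∈ Set.Ico 0 R, |deriv f x| ≤ L * x
  deriv_gt : ∀ x ∈ Set.Ioo 0 R, 0 < deriv f x + x / (2 * V)
  half_lt : ∀ x ∈ Set.Ico 0 R, 1 / 2 < f x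

/-- A continuous positive function growing like `x²` dominates a multiple of `1 + x²`. -/
theorem exists_quadratic_lower_bound {f : ℝ → ℝ} {V B : ℝ} (hV : 0 < V) (hf : Continuous f)
    (hB : ∀ x, |f x| ≤ B) (hpos : ∀ x, 0 < f x + x ^ 2 / (4 * V)) :
    ∃ c > 0, ∀ x, c * (1 + x ^ 2) ≤ f x + x ^ 2 / (4 * V) := by
  have hB0 : 0 ≤ B := (abs_nonneg _).trans (hB 0)
  -- beyond `X` the quadratic term dominates `B` and `1`; on `[-X, X]` compactness applies
  let X : ℝ := 8 * V * B + 2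
  have hX1 : 2 ≤ X := by simp only [X]; nlinarith [mul_nonneg hV.le hB0]
  obtain ⟨x0, -, hx0⟩ := (isCompact_Icc (a := -X) (b := X)).exists_isMinOn
    ⟨0, by constructor <;> linarith⟩
    (f := fun x => (f x + x ^ 2 / (4 * V)) / (1 + x ^ 2))
    (Continuous.continuousOn (by
      refine Continuous.div (by fun_prop) (by fun_prop) fun x => by positivity))
  let m := (f x0 + x0 ^ 2 / (4 * V)) / (1 + x0 ^ 2)
  have hm : 0 < m := div_pos (hpos x0) (by positivity)
  refine ⟨min m (1 / (16 * V)), lt_min hm (by positivity), fun x => ?_⟩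
  by_cases hx : x ∈ Set.Icc (-X) X
  · have h1 : m ≤ (f x + x ^ 2 / (4 * V)) / (1 + x ^ 2) := hx0 hx
    rw [le_div_iff₀ (by positivity)] at h1
    refine le_trans ?_ h1
    gcongr
    exact min_le_left _ _
  · have hx' : X ≤ |x| := by
      by_contra hc
      exact hx (abs_le.1 (not_le.1 hc).le)
    have hsq : 8 * V * B + 2 ≤ x ^ 2 := by
      rw [← sq_abs]
      have : X ≤ X ^ 2 := by nlinarith
      calc 8 * V * B + 2 = X := rfl
        _ ≤ X ^ 2 := this
        _ ≤ |x| ^ 2 := by gcongr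
    have h1 : min m (1 / (16 * V)) * (1 + x ^ 2) ≤ 1 / (16 * V) * (1 + x ^ 2) := by
      gcongr
      exact min_le_right _ _
    have h2 := (abs_le.1 (hB x)).1
    refine h1.trans ?_
    have h3 : 1 / (16 * V) * (1 + x ^ 2) + B ≤ x ^ 2 / (4 * V) := by
      rw [← sub_nonneg]
      have : x ^ 2 / (4 * V) - (1 / (16 * V) * (1 + x ^ 2) + B)
        = (3 * x ^ 2 - 1 - 16 * V * B) / (16 * V) := by field_simp; ring
      rw [this]
      apply div_nonneg _ (by positivity)
      nlinarith [mul_nonneg hV.le hB0]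
    linarith

/-- Two derivatives of `v̂` at `0` suffice: `f'(0) = 0` by evenness, and the bounds on `f'` near `0`
are bounds on the difference quotient `f'(x) / x`, whose limit is `f''(0)`. -/
theorem exists_isProfile {v : R3 → ℝ} {V : ℝ} (hV : 0 < V)
    (hL1 : Integrable v) (hpos0 : 0 < vhat v 0)
    (hpos : ∀ ν ∈ Set.Ioc 0 V, ∀ k : R3, -(vhat v 0) * (‖k‖ ^ 2 / (4 * ν)) < vhat v k)
    (hsymm : ∀ᵐ x : R3, v (-x) = v x)
    (hrot : ∀ R : R3 ≃ₗᵢ[ℝ] R3, LinearMap.det (R.toLinearEquiv : R3 →ₗ[ℝ] R3) = 1 →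
      ∀ᵐ x : R3, v (R x) = v x)
    (hC5 : ContDiffAt ℝ 5 (vhat v) 0)
    (hconv : ∀ ν ∈ Set.Ioc 0 V, -(1 / 2) < ν / vhat v 0 * iteratedDeriv 2 (vhatRadial v) 0) :
    ∃ R L B c, IsProfile (fun x => vhatRadial v x / vhat v 0) V R L B c := by
  have hsingle : (EuclideanSpace.single 0 : ℝ → R3)
      = fun t => t • EuclideanSpace.single 0 1 := by
    funext t; ext i; by_cases h : i = 0 <;> simp [h]
  have hcont : Continuous (vhatRadial v) := by
    refine (continuous_vhat hL1).comp ?_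
    rw [hsingle]; fun_prop
  have hs0 : (EuclideanSpace.single 0 0 : R3) = 0 := by
    ext i; by_cases h : i = 0 <;> simp [h]
  have h0 : vhatRadial v 0 = vhat v 0 := by rw [vhatRadial, hs0]
  have heven : ∀ x, vhatRadial v (-x) = vhatRadial v x := fun x =>
    vhat_eq_of_norm_eq hsymm hrot (by simp)
  have hCr : ContDiffAt ℝ 2 (vhatRadial v) 0 := by
    have h1 : ContDiffAt ℝ 2 (vhat v) ((fun t : ℝ => (EuclideanSpace.single 0 t : R3)) 0) := by
      simp only [hs0]
      exact hC5.of_le (by norm_num)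
    refine h1.comp 0 ?_
    rw [hsingle]; fun_prop
  set f : ℝ → ℝ := fun x => vhatRadial v x / vhat v 0 with hf
  have hfC : ContDiffAt ℝ 2 f 0 := hCr.div_const _
  have hfe : ∀ x, f (-x) = f x := fun x => by simp [hf, heven]
  have hfcont : Continuous f := hcont.div_const _
  have hf0 : f 0 = 1 := by simp [hf, h0, hpos0.ne']
  have hd0 : deriv f 0 = 0 := by
    have h := deriv_comp_neg f (0 : ℝ)
    have h2 : (fun x => f (-x)) = f := funext hfe
    rw [h2] at h
    simp at h
    linarith
  obtain ⟨B, hB⟩ : ∃ B, ∀ x, |f x| ≤ B := by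
    refine ⟨(∫ x, |v x|) / vhat v 0, fun x => ?_⟩
    rw [hf, abs_div, abs_of_pos hpos0]
    gcongr
    exact abs_vhat_le _
  obtain ⟨c, hc, hlow⟩ := exists_quadratic_lower_bound hV hfcont hB (by
    intro x
    have h := hpos V ⟨hV, le_rfl⟩ (EuclideanSpace.single 0 x)
    have e : f x + x ^ 2 / (4 * V) = (vhatRadial v x + vhat v 0 * (x ^ 2 / (4 * V))) / vhat v 0 := by
      rw [hf]; field_simp
    rw [e]
    refine div_pos ?_ hpos0
    simp only [PiLp.norm_single, Real.norm_eq_abs, sq_abs] at h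
    have : vhat v (EuclideanSpace.single 0 x) = vhatRadial v x := rfl
    rw [this] at h
    linarith)
  have hev : ∀ᶠ x in 𝓝 (0 : ℝ), ContDiffAt ℝ 2 f x := hfC.eventually (by simp)
  have hderC : ∀ x, ContDiffAt ℝ 2 f x → ContDiffAt ℝ 1 (deriv f) x := fun x hx =>
    (hx.fderiv_right (m := 1) (by norm_num)).clm_apply contDiffAt_const
  have hder : DifferentiableAt ℝ (deriv f) 0 := by
    exact (hderC 0 hfC).differentiableAt (by norm_num)
  have hHD := hder.hasDerivAt
  have hf'' : -(1 / (2 * V)) < deriv (deriv f) 0 := by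
    have h := hconv V ⟨hV, le_rfl⟩
    have e : deriv (deriv f) 0 = iteratedDeriv 2 (vhatRadial v) 0 / vhat v 0 := by
      have e1 : deriv f = fun x => deriv (vhatRadial v) x / vhat v 0 := by
        funext x; simp only [hf]; exact deriv_div_const _
      rw [e1, deriv_div_const, iteratedDeriv_succ, iteratedDeriv_one]
    rw [e]
    have e2 : V / vhat v 0 * iteratedDeriv 2 (vhatRadial v) 0
      = V * (iteratedDeriv 2 (vhatRadial v) 0 / vhat v 0) := by ring
    rw [e2] at h
    have : -(1 / (2 * V)) = (-(1 / 2)) / V := by field_simp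
    rw [this, div_lt_iff₀ hV]
    linarith
  have hslope := hasDerivAt_iff_tendsto_slope.1 hHD
  have hs1 : ∀ᶠ x in 𝓝[≠] (0 : ℝ), -(1 / (2 * V)) < slope (deriv f) 0 x :=
    hslope.eventually (lt_mem_nhds hf'')
  have hs2 : ∀ᶠ x in 𝓝[≠] (0 : ℝ), |slope (deriv f) 0 x| < |deriv (deriv f) 0| + 1 :=
    hslope.abs.eventually (gt_mem_nhds (by linarith))
  have hhalf : ∀ᶠ x in 𝓝 (0 : ℝ), 1 / 2 < f x :=
    hfcont.continuousAt.eventually (lt_mem_nhds (by rw [hf0]; norm_num))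
  have hall := (hev.and hhalf).and
    (((eventually_nhdsWithin_iff.1 hs1).and (eventually_nhdsWithin_iff.1 hs2)))
  obtain ⟨R, hR, hball⟩ := Metric.eventually_nhds_iff.1 hall
  have hmem : ∀ x ∈ Set.Ico 0 R, dist x 0 < R := fun x hx => by
    rw [Real.dist_eq, sub_zero, abs_of_nonneg hx.1]; exact hx.2
  have hsl : ∀ x, x ≠ 0 → slope (deriv f) 0 x = deriv f x / x := fun x hx => by
    rw [slope_def_field, hd0]; simp
  have hB1 : 1 ≤ B := by simpa [hf0] using hB 0
  refine ⟨R, |deriv (deriv f) 0| + 1, B, c, hV, hR, by positivity, by linarith, hc, hfcont, hf0,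
    hB, hlow, ?_, ?_, ?_, ?_, fun x hx => (hball (hmem x hx)).1.2⟩
  · intro x hx
    exact (hball (hmem x hx)).1.1.differentiableAt (by norm_num)
  · intro x hx
    exact (hderC x (hball (hmem x hx)).1.1).continuousAt
  · intro x hx
    rcases hx.1.eq_or_lt with h | h
    · simp [← h, hd0]
    have h1 := (hball (hmem x hx)).2.2 h.ne'
    rw [hsl x h.ne', abs_div, abs_of_pos h, div_lt_iff₀ h] at h1
    exact h1.le
  · intro x hx
    have h1 := (hball (hmem x ⟨hx.1.le, hx.2⟩)).2.1 hx.1.ne'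
    rw [hsl x hx.1.ne', lt_div_iff₀ hx.1] at h1
    have : x / (2 * V) = -(-(1 / (2 * V)) * x) := by ring
    rw [this]
    linarith

/-! ### The temperature profile `𝓘` -/

/-- The Bose function `x / (eˣ - 1)`, extended by continuity with value `1` at `x = 0`. -/
def bose (x : ℝ) : ℝ := (dslope Real.exp 0 x)⁻¹

theorem bose_of_ne {x : ℝ} (hx : x ≠ 0) : bose x = x / (Real.exp x - 1) := by
  rw [bose, dslope_of_ne _ hx, slope_def_field]; simp

theorem bose_zero : bose 0 = 1 := by
  rw [bose, dslope_same]; simp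

theorem continuous_bose : Continuous bose := by
  unfold bose
  refine Continuous.inv₀ ?_ fun x => ?_
  · rw [continuous_iff_continuousAt]
    intro x
    by_cases hx : x = 0
    · subst hx
      exact continuousAt_dslope_same.2 Real.differentiableAt_exp
    · exact (continuousAt_dslope_of_ne hx).2 Real.continuous_exp.continuousAt
  · by_cases hx : x = 0
    · subst hx; rw [dslope_same]; simp
    · rw [dslope_of_ne _ hx, slope_def_field]
      have : Real.exp x ≠ 1 := fun h => hx (by simpa using h)
      simp [sub_eq_zero, this, hx]

theorem bose_bounds {x : ℝ} (hx : 0 ≤ x) : |bose x - 1| ≤ x := by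
  rcases hx.eq_or_lt with h | h
  · rw [← h, bose_zero]; simp
  rw [bose_of_ne h.ne']
  have h1 := Real.add_one_le_exp x
  have h2 := Real.one_sub_le_exp_neg x
  have hpos : 0 < Real.exp x - 1 := by linarith
  rw [abs_sub_comm, abs_of_nonneg]
  · have h3 : Real.exp (-x) * Real.exp x = 1 := by rw [← Real.exp_add]; simp
    have : 1 - x ≤ x / (Real.exp x - 1) := by
      rw [le_div_iff₀ hpos]
      nlinarith [Real.exp_pos x]
    linarith
  · rw [sub_nonneg, div_le_one hpos]; linarith

theorem integral_sq_mul_one_sub_sq :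
    (∫ s in (0 : ℝ)..1, s ^ 2 * (1 - s) ^ 2) = 1 / 30 := by
  have : ∀ s : ℝ, s ^ 2 * (1 - s) ^ 2 = s ^ 2 - 2 * s ^ 3 + s ^ 4 := fun s => by ring
  simp_rw [this]
  rw [intervalIntegral.integral_add (by apply Continuous.intervalIntegrable; fun_prop)
    (by apply Continuous.intervalIntegrable; fun_prop),
    intervalIntegral.integral_sub (by apply Continuous.intervalIntegrable; fun_prop)
    (by apply Continuous.intervalIntegrable; fun_prop), intervalIntegral.integral_const_mul]
  simp only [integral_pow]
  norm_num

theorem integral_mul_one_sub_sq :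
    (∫ s in (0 : ℝ)..1, s * (1 - s) ^ 2) = 1 / 12 := by
  have : ∀ s : ℝ, s * (1 - s) ^ 2 = s ^ 1 - 2 * s ^ 2 + s ^ 3 := fun s => by ring
  simp_rw [this]
  rw [intervalIntegral.integral_add (by apply Continuous.intervalIntegrable; fun_prop)
    (by apply Continuous.intervalIntegrable; fun_prop),
    intervalIntegral.integral_sub (by apply Continuous.intervalIntegrable; fun_prop)
    (by apply Continuous.intervalIntegrable; fun_prop), intervalIntegral.integral_const_mul]
  simp only [integral_pow]
  norm_num

/-- Partial fractions for the product of two emission factors, multiplied by the polynomial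
weight. At the end points `s = 0` and `s = 1`, where the left side contains a division by zero, both
sides vanish. -/
theorem thermal_split {θ s : ℝ} (hθ : 0 < θ) (h0 : 0 ≤ s) (h1 : s ≤ 1) :
    θ * (1 - Real.exp (-θ)) * ((4 * (s * (1 - s))) ^ 2 /
        ((1 - Real.exp (-θ * s)) * (1 - Real.exp (-θ * (1 - s))))) =
      16 * θ * (s ^ 2 * (1 - s) ^ 2) + (16 * (s * (1 - s) ^ 2 * bose (θ * s))
        + 16 * ((1 - s) * s ^ 2 * bose (θ * (1 - s)))) := by
  rcases h0.eq_or_lt with h | h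
  · simp [← h]
  rcases h1.eq_or_lt with h' | h'
  · simp [h']
  have hs1 : 0 < 1 - s := by linarith
  have e1 : 0 < θ * s := by positivity
  have e2 : 0 < θ * (1 - s) := by positivity
  rw [bose_of_ne e1.ne', bose_of_ne e2.ne']
  have hx : 1 < Real.exp (θ * s) := Real.one_lt_exp_iff.2 e1
  have hy : 1 < Real.exp (θ * (1 - s)) := Real.one_lt_exp_iff.2 e2
  have q1 : Real.exp (-θ * s) = (Real.exp (θ * s))⁻¹ := by rw [← Real.exp_neg]; ring_nf
  have q2 : Real.exp (-θ * (1 - s)) = (Real.exp (θ * (1 - s)))⁻¹ := by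
    rw [← Real.exp_neg]; ring_nf
  have q3 : Real.exp (-θ) = (Real.exp (θ * s))⁻¹ * (Real.exp (θ * (1 - s)))⁻¹ := by
    rw [← Real.exp_neg, ← Real.exp_neg, ← Real.exp_add]; ring_nf
  rw [q1, q2, q3]
  generalize Real.exp (θ * s) = x at *
  generalize Real.exp (θ * (1 - s)) = y at *
  have hx' : x - 1 ≠ 0 := by linarith
  have hy' : y - 1 ≠ 0 := by linarith
  have hx0 : x ≠ 0 := by linarith
  have hy0 : y ≠ 0 := by linarith
  have d1 : 1 - x⁻¹ = (x - 1) / x := by field_simp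
  have d2 : 1 - y⁻¹ = (y - 1) / y := by field_simp
  rw [d1, d2]
  field_simp
  ring

/-- The two Bose terms of the partial fraction expansion are exchanged by `s ↦ 1 - s`. -/
theorem beliaevI_eq_bose {θ : ℝ} (hθ : 0 ≤ θ) :
    beliaevI θ = 16 / 15 * θ + 64 * ∫ s in (0 : ℝ)..1, s * (1 - s) ^ 2 * bose (θ * s) := by
  rcases hθ.eq_or_lt with h | h
  · simp [← h, beliaevI, bose_zero, integral_mul_one_sub_sq]; norm_num
  rw [beliaevI, if_neg h.ne']
  have hsub : (∫ t in (-1 : ℝ)..1, (1 - t ^ 2) ^ 2 /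
        ((1 - Real.exp (-θ * ((1 + t) / 2))) * (1 - Real.exp (-θ * ((1 - t) / 2)))))
      = 2 * ∫ s in (0 : ℝ)..1, (4 * (s * (1 - s))) ^ 2 /
        ((1 - Real.exp (-θ * s)) * (1 - Real.exp (-θ * (1 - s)))) := by
    have := intervalIntegral.integral_comp_mul_add (a := 0) (b := 1) (c := 2)
      (fun t : ℝ => (1 - t ^ 2) ^ 2 /
        ((1 - Real.exp (-θ * ((1 + t) / 2))) * (1 - Real.exp (-θ * ((1 - t) / 2)))))
      two_ne_zero (-1)
    norm_num at this
    rw [← mul_right_inj' (two_ne_zero (α := ℝ))] at this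
    rw [← mul_assoc] at this
    norm_num at this
    simp only [neg_mul]
    rw [← this]
    congr 1
    refine intervalIntegral.integral_congr fun s _ => ?_
    have r2 : (1 - (2 * s + -1)) / 2 = 1 - s := by ring
    have r3 : (1 - (2 * s + -1) ^ 2) = 4 * (s * (1 - s)) := by ring
    rw [r2, r3]
  rw [hsub]
  have c1 : Continuous fun s : ℝ => s * (1 - s) ^ 2 * bose (θ * s) := by
    have := continuous_bose; fun_prop
  have c2 : Continuous fun s : ℝ => (1 - s) * s ^ 2 * bose (θ * (1 - s)) := by
    have := continuous_bose; fun_prop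
  have key : θ * (1 - Real.exp (-θ)) * ∫ s in (0 : ℝ)..1, (4 * (s * (1 - s))) ^ 2 /
        ((1 - Real.exp (-θ * s)) * (1 - Real.exp (-θ * (1 - s))))
      = 16 * θ * (1 / 30) + 32 * ∫ s in (0 : ℝ)..1, s * (1 - s) ^ 2 * bose (θ * s) := by
    rw [← intervalIntegral.integral_const_mul]
    have : (∫ s in (0 : ℝ)..1, θ * (1 - Real.exp (-θ)) * ((4 * (s * (1 - s))) ^ 2 /
        ((1 - Real.exp (-θ * s)) * (1 - Real.exp (-θ * (1 - s))))))
        = ∫ s in (0 : ℝ)..1, 16 * θ * (s ^ 2 * (1 - s) ^ 2)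
          + (16 * (s * (1 - s) ^ 2 * bose (θ * s))
            + 16 * ((1 - s) * s ^ 2 * bose (θ * (1 - s)))) := by
      refine intervalIntegral.integral_congr fun s hs => ?_
      rw [Set.uIcc_of_le zero_le_one] at hs
      exact thermal_split h hs.1 hs.2
    rw [this, intervalIntegral.integral_add (by apply Continuous.intervalIntegrable; fun_prop)
      (by apply Continuous.intervalIntegrable; fun_prop),
      intervalIntegral.integral_add (by apply Continuous.intervalIntegrable; fun_prop)
      (by apply Continuous.intervalIntegrable; fun_prop),
      intervalIntegral.integral_const_mul, intervalIntegral.integral_const_mul,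
      intervalIntegral.integral_const_mul, integral_sq_mul_one_sub_sq]
    have hrefl : (∫ s in (0 : ℝ)..1, (1 - s) * s ^ 2 * bose (θ * (1 - s)))
        = ∫ s in (0 : ℝ)..1, s * (1 - s) ^ 2 * bose (θ * s) := by
      have := intervalIntegral.integral_comp_sub_left (a := 0) (b := 1)
        (fun s : ℝ => s * (1 - s) ^ 2 * bose (θ * s)) 1
      simpa using this
    rw [hrefl]
    ring
  linear_combination 2 * key

theorem continuousOn_beliaevI : ContinuousOn beliaevI (Set.Ici 0) := by
  have : Continuous fun θ : ℝ =>
      16 / 15 * θ + 64 * ∫ s in (0 : ℝ)..1, s * (1 - s) ^ 2 * bose (θ * s) := by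
    have hb := continuous_bose
    have : Continuous fun θ : ℝ => ∫ s in (0 : ℝ)..1, s * (1 - s) ^ 2 * bose (θ * s) := by
      apply intervalIntegral.continuous_parametric_intervalIntegral_of_continuous'
      fun_prop
    fun_prop
  exact this.continuousOn.congr fun θ hθ => beliaevI_eq_bose hθ

theorem abs_beliaevI_sub_le {θ : ℝ} (hθ : 0 ≤ θ) : |beliaevI θ - 16 / 3| ≤ 66 * θ := by
  rw [beliaevI_eq_bose hθ]
  have hb := continuous_bose
  have e : (∫ s in (0 : ℝ)..1, s * (1 - s) ^ 2 * bose (θ * s)) - 1 / 12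
      = ∫ s in (0 : ℝ)..1, s * (1 - s) ^ 2 * (bose (θ * s) - 1) := by
    rw [← integral_mul_one_sub_sq, ← intervalIntegral.integral_sub
      (by apply Continuous.intervalIntegrable; fun_prop)
      (by apply Continuous.intervalIntegrable; fun_prop)]
    refine intervalIntegral.integral_congr fun s _ => ?_
    ring
  have hle : |∫ s in (0 : ℝ)..1, s * (1 - s) ^ 2 * (bose (θ * s) - 1)| ≤ θ * |1 - 0| := by
    rw [← Real.norm_eq_abs]
    refine intervalIntegral.norm_integral_le_of_norm_le_const fun s hs => ?_
    rw [Set.uIoc_of_le zero_le_one] at hs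
    have h1 : |bose (θ * s) - 1| ≤ θ * s := bose_bounds (mul_nonneg hθ hs.1.le)
    have h2 : 0 ≤ s * (1 - s) ^ 2 := mul_nonneg hs.1.le (sq_nonneg _)
    have h3 : s * (1 - s) ^ 2 ≤ 1 := by
      have : (1 - s) ^ 2 ≤ 1 := by nlinarith [hs.1, hs.2]
      exact mul_le_one₀ hs.2 (sq_nonneg _) this
    rw [Real.norm_eq_abs, abs_mul, abs_of_nonneg h2]
    calc s * (1 - s) ^ 2 * |bose (θ * s) - 1| ≤ 1 * (θ * s) := by gcongr
      _ ≤ θ := by nlinarith [hs.2]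
  rw [← e] at hle
  norm_num at hle
  rw [abs_le] at *
  constructor <;> linarith [hle.1, hle.2]

theorem beliaevI_pos {θ : ℝ} (hθ : 0 < θ) : 0 < beliaevI θ := by
  rw [beliaevI_eq_bose hθ.le]
  have : 0 ≤ ∫ s in (0 : ℝ)..1, s * (1 - s) ^ 2 * bose (θ * s) := by
    refine intervalIntegral.integral_nonneg zero_le_one fun s hs => ?_
    refine mul_nonneg (mul_nonneg hs.1 (sq_nonneg _)) ?_
    by_cases h : θ * s = 0
    · rw [h, bose_zero]; norm_num
    · rw [bose_of_ne h]
      have h0 : 0 ≤ θ * s := mul_nonneg hθ.le hs.1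
      exact div_nonneg h0 (by linarith [Real.add_one_le_exp (θ * s)])
  positivity

/-! ### Polylogarithm expansion of `𝓘` -/

/-- The antiderivative is found by repeated integration by parts. -/
theorem integral_sq_mul_sq_mul_exp {a : ℝ} (ha : 0 < a) :
    (∫ s in (0 : ℝ)..1, s ^ 2 * (1 - s) ^ 2 * Real.exp (-(a * s))) =
      2 / a ^ 3 - 12 / a ^ 4 + 24 / a ^ 5
        - Real.exp (-a) * (2 / a ^ 3 + 12 / a ^ 4 + 24 / a ^ 5) := by
  have hd : ∀ s : ℝ, HasDerivAt (fun s : ℝ => -Real.exp (-(a * s)) *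
      ((s ^ 2 - 2 * s ^ 3 + s ^ 4) / a + (2 * s - 6 * s ^ 2 + 4 * s ^ 3) / a ^ 2
        + (2 - 12 * s + 12 * s ^ 2) / a ^ 3 + (-12 + 24 * s) / a ^ 4 + 24 / a ^ 5))
      (s ^ 2 * (1 - s) ^ 2 * Real.exp (-(a * s))) s := by
    intro s
    have h1 : HasDerivAt (fun s : ℝ => -Real.exp (-(a * s))) (a * Real.exp (-(a * s))) s := by
      have := (((hasDerivAt_id s).const_mul a).neg.exp).neg
      refine this.congr_deriv ?_
      simp
      ring
    have h2 : HasDerivAt (fun s : ℝ =>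
      ((s ^ 2 - 2 * s ^ 3 + s ^ 4) / a + (2 * s - 6 * s ^ 2 + 4 * s ^ 3) / a ^ 2
        + (2 - 12 * s + 12 * s ^ 2) / a ^ 3 + (-12 + 24 * s) / a ^ 4 + 24 / a ^ 5))
      ((2 * s - 6 * s ^ 2 + 4 * s ^ 3) / a + (2 - 12 * s + 12 * s ^ 2) / a ^ 2
        + (-12 + 24 * s) / a ^ 3 + 24 / a ^ 4) s := by
      have p2 := hasDerivAt_pow 2 s
      have p3 := hasDerivAt_pow 3 s
      have p4 := hasDerivAt_pow 4 s
      have p1 := hasDerivAt_id s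
      have := ((((((p2.sub (p3.const_mul 2)).add p4).div_const a).add
        ((((p1.const_mul 2).sub (p2.const_mul 6)).add (p3.const_mul 4)).div_const (a ^ 2))).add
        ((((p1.const_mul 12).const_sub 2).add (p2.const_mul 12)).div_const (a ^ 3))).add
        (((p1.const_mul 24).const_add (-12)).div_const (a ^ 4))).add_const (24 / a ^ 5)
      refine this.congr_deriv ?_
      norm_num
      ring
    refine (h1.mul h2).congr_deriv ?_
    field_simp
    ring
  rw [intervalIntegral.integral_eq_sub_of_hasDerivAt (fun s _ => hd s)
    (by apply Continuous.intervalIntegrable; fun_prop)]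
  norm_num
  ring

theorem summable_one_div_succ_pow {n : ℕ} (hn : 1 < n) :
    Summable fun m : ℕ => 1 / ((m : ℝ) + 1) ^ n := by
  have := (summable_nat_add_iff 1).2 (Real.summable_one_div_nat_pow.2 hn)
  simpa using this

theorem zetaR_eq_tsum {n : ℕ} (hn : 1 < n) : zetaR n = ∑' m : ℕ, 1 / ((m : ℝ) + 1) ^ n := by
  have h : riemannZeta n = ((∑' m : ℕ, 1 / ((m : ℝ) + 1) ^ n : ℝ) : ℂ) := by
    rw [zeta_nat_eq_tsum_of_gt_one hn, Complex.ofReal_tsum]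
    have hs : Summable fun m : ℕ => 1 / (m : ℂ) ^ n := by
      have := Complex.summable_ofReal.2 (Real.summable_one_div_nat_pow.2 hn)
      simpa using this
    rw [hs.tsum_eq_zero_add]
    simp [show n ≠ 0 by omega]
  rw [zetaR, h, Complex.ofReal_re]

theorem summable_polyLi {n : ℕ} (hn : 1 < n) {z : ℝ} (h0 : 0 ≤ z) (h1 : z ≤ 1) :
    Summable fun m : ℕ => z ^ (m + 1) / ((m : ℝ) + 1) ^ n := by
  refine (summable_one_div_succ_pow hn).of_nonneg_of_le (fun m => by positivity) fun m => ?_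
  gcongr
  exact pow_le_one₀ h0 h1

theorem polyLi_bounds {n : ℕ} (hn : 1 < n) {z : ℝ} (h0 : 0 ≤ z) (h1 : z ≤ 1) :
    |polyLi n z| ≤ zetaR n := by
  have : 0 ≤ polyLi n z := tsum_nonneg fun m => by positivity
  rw [abs_of_nonneg this, zetaR_eq_tsum hn]
  refine (summable_polyLi hn h0 h1).tsum_le_tsum (fun m => ?_) (summable_one_div_succ_pow hn)
  gcongr
  exact pow_le_one₀ h0 h1

/-- For `s > 0` the Bose function is the geometric series `θ s ∑ e^{-(m + 1) θ s}`, which is integrated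
term by term; all terms are nonnegative. -/
theorem beliaevI_eq_polyLi {θ : ℝ} (hθ : 0 < θ) :
    beliaevI θ = 32 * θ * (1 / 30 + 4 * (zetaR 3 / θ ^ 3 - 6 * (zetaR 4 / θ ^ 4)
        + 12 * (zetaR 5 / θ ^ 5) - polyLi 3 (Real.exp (-θ)) / θ ^ 3
        - 6 * (polyLi 4 (Real.exp (-θ)) / θ ^ 4)
        - 12 * (polyLi 5 (Real.exp (-θ)) / θ ^ 5))) := by
  have hz0 : 0 ≤ Real.exp (-θ) := (Real.exp_pos _).le
  have hz1 : Real.exp (-θ) ≤ 1 := Real.exp_le_one_iff.2 (by linarith)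
  -- the series of the integrals of the single exponentials
  set F : ℕ → ℝ → ℝ := fun m s => s ^ 2 * (1 - s) ^ 2 * Real.exp (-((m + 1) * θ * s)) with hF
  have hJ : ∀ m : ℕ, (∫ s in (0 : ℝ)..1, F m s) =
      2 / θ ^ 3 * (1 / ((m : ℝ) + 1) ^ 3) - 12 / θ ^ 4 * (1 / ((m : ℝ) + 1) ^ 4)
        + 24 / θ ^ 5 * (1 / ((m : ℝ) + 1) ^ 5)
        - 2 / θ ^ 3 * (Real.exp (-θ) ^ (m + 1) / ((m : ℝ) + 1) ^ 3)
        - 12 / θ ^ 4 * (Real.exp (-θ) ^ (m + 1) / ((m : ℝ) + 1) ^ 4)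
        - 24 / θ ^ 5 * (Real.exp (-θ) ^ (m + 1) / ((m : ℝ) + 1) ^ 5) := by
    intro m
    rw [hF]
    simp only
    rw [integral_sq_mul_sq_mul_exp (by positivity : (0 : ℝ) < (m + 1) * θ), ← Real.exp_nat_mul]
    push_cast
    have : ((m : ℝ) + 1) * -θ = -((m + 1) * θ) := by ring
    rw [this]
    field_simp
    ring
  have hsum : HasSum (fun m : ℕ => ∫ s in (0 : ℝ)..1, F m s)
      (2 / θ ^ 3 * zetaR 3 - 12 / θ ^ 4 * zetaR 4 + 24 / θ ^ 5 * zetaR 5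
        - 2 / θ ^ 3 * polyLi 3 (Real.exp (-θ)) - 12 / θ ^ 4 * polyLi 4 (Real.exp (-θ))
        - 24 / θ ^ 5 * polyLi 5 (Real.exp (-θ))) := by
    simp_rw [hJ]
    have hz : ∀ n, 1 < n → HasSum (fun m : ℕ => 1 / ((m : ℝ) + 1) ^ n) (zetaR n) := fun n hn => by
      rw [zetaR_eq_tsum hn]; exact (summable_one_div_succ_pow hn).hasSum
    have hl : ∀ n, 1 < n → HasSum (fun m : ℕ => Real.exp (-θ) ^ (m + 1) / ((m : ℝ) + 1) ^ n)
        (polyLi n (Real.exp (-θ))) := fun n hn => (summable_polyLi hn hz0 hz1).hasSum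
    exact ((((((hz 3 (by norm_num)).mul_left _).sub ((hz 4 (by norm_num)).mul_left _)).add
      ((hz 5 (by norm_num)).mul_left _)).sub ((hl 3 (by norm_num)).mul_left _)).sub
      ((hl 4 (by norm_num)).mul_left _)).sub ((hl 5 (by norm_num)).mul_left _)
  have hnn : ∀ m s, 0 ≤ F m s := fun m s => by simp only [hF]; positivity
  have hint : ∀ m, Integrable (F m) (volume.restrict (Set.Ioc 0 1)) := fun m => by
    have hc : Continuous (F m) := by simp only [hF]; fun_prop
    exact (hc.integrableOn_Icc).mono_set Set.Ioc_subset_Icc_self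
  have hswap := hasSum_integral_of_summable_integral_norm hint (by
    have : (fun m => ∫ s, ‖F m s‖ ∂(volume.restrict (Set.Ioc 0 1)))
        = fun m => ∫ s in (0 : ℝ)..1, F m s := by
      funext m
      rw [intervalIntegral.integral_of_le zero_le_one]
      exact integral_congr_ae (Eventually.of_forall fun s => by simp [abs_of_nonneg (hnn m s)])
    rw [this]
    exact hsum.summable)
  simp_rw [← intervalIntegral.integral_of_le (zero_le_one' ℝ)] at hswap
  have hval := hswap.unique hsum
  have hgeo : (∫ s in (0 : ℝ)..1, s * (1 - s) ^ 2 * bose (θ * s))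
      = θ * ∫ s in (0 : ℝ)..1, ∑' m, F m s := by
    rw [← intervalIntegral.integral_const_mul]
    refine intervalIntegral.integral_congr fun s hs => ?_
    rw [Set.uIcc_of_le zero_le_one] at hs
    rcases hs.1.eq_or_lt with h | h
    · simp [← h, hF]
    have hθs : 0 < θ * s := by positivity
    have hlt : Real.exp (-(θ * s)) < 1 := by
      rw [← Real.exp_zero]; exact Real.exp_lt_exp.2 (by linarith)
    have e : ∀ m : ℕ, F m s =
        s ^ 2 * (1 - s) ^ 2 * Real.exp (-(θ * s)) * Real.exp (-(θ * s)) ^ m := fun m => by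
      simp only [hF]
      rw [← Real.exp_nat_mul, mul_assoc _ (Real.exp _) (Real.exp _), ← Real.exp_add]
      congr 2
      ring
    simp_rw [e]
    rw [tsum_mul_left, tsum_geometric_of_lt_one (Real.exp_pos _).le hlt, bose_of_ne hθs.ne',
      Real.exp_neg]
    have hx : 1 < Real.exp (θ * s) := Real.one_lt_exp_iff.2 hθs
    generalize Real.exp (θ * s) = x at *
    have hx' : x - 1 ≠ 0 := by linarith
    have hx0 : x ≠ 0 := by linarith
    have d1 : 1 - x⁻¹ = (x - 1) / x := by field_simp
    rw [d1]
    field_simp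
  rw [beliaevI_eq_bose hθ.le, hgeo, hval]
  field_simp
  ring

theorem exists_abs_beliaevI_sub_le :
    ∃ C > 0, ∀ θ, 1 ≤ θ → |beliaevI θ - 16 / 15 * θ| ≤ C / θ ^ 2 := by
  have hz : ∀ n, 1 < n → 0 ≤ zetaR n := fun n hn => by
    rw [zetaR_eq_tsum hn]; exact tsum_nonneg fun m => by positivity
  have z3 := hz 3 (by norm_num)
  have z4 := hz 4 (by norm_num)
  have z5 := hz 5 (by norm_num)
  refine ⟨256 * (zetaR 3 + 6 * zetaR 4 + 12 * zetaR 5) + 1, by positivity, fun θ hθ => ?_⟩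
  have hθ0 : 0 < θ := by linarith
  have hz0 : 0 ≤ Real.exp (-θ) := (Real.exp_pos _).le
  have hz1 : Real.exp (-θ) ≤ 1 := Real.exp_le_one_iff.2 (by linarith)
  have l3 := abs_le.1 (polyLi_bounds (n := 3) (by norm_num) hz0 hz1)
  have l4 := abs_le.1 (polyLi_bounds (n := 4) (by norm_num) hz0 hz1)
  have l5 := abs_le.1 (polyLi_bounds (n := 5) (by norm_num) hz0 hz1)
  rw [beliaevI_eq_polyLi hθ0, le_div_iff₀ (by positivity), ← abs_of_pos (pow_pos hθ0 2), ← abs_mul]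
  generalize polyLi 3 (Real.exp (-θ)) = a3 at *
  generalize polyLi 4 (Real.exp (-θ)) = a4 at *
  generalize polyLi 5 (Real.exp (-θ)) = a5 at *
  have e : (32 * θ * (1 / 30 + 4 * (zetaR 3 / θ ^ 3 - 6 * (zetaR 4 / θ ^ 4)
        + 12 * (zetaR 5 / θ ^ 5) - a3 / θ ^ 3 - 6 * (a4 / θ ^ 4) - 12 * (a5 / θ ^ 5)))
        - 16 / 15 * θ) * θ ^ 2
      = 128 * ((zetaR 3 - a3) - 6 * (zetaR 4 + a4) * (1 / θ)
        + 12 * (zetaR 5 - a5) * (1 / θ ^ 2)) := by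
    field_simp; ring
  rw [e]
  have i1 : 1 / θ ≤ 1 := by rw [div_le_one hθ0]; exact hθ
  have i2 : 1 / θ ^ 2 ≤ 1 := by rw [div_le_one (by positivity)]; nlinarith
  have j1 : 0 ≤ 1 / θ := by positivity
  have j2 : 0 ≤ 1 / θ ^ 2 := by positivity
  have t4 : (zetaR 4 + a4) * (1 / θ) ≤ 2 * zetaR 4 := by nlinarith [l4.1, l4.2]
  have t4' : 0 ≤ (zetaR 4 + a4) * (1 / θ) := mul_nonneg (by linarith) j1
  have t5 : (zetaR 5 - a5) * (1 / θ ^ 2) ≤ 2 * zetaR 5 := by nlinarith [l5.1, l5.2]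
  have t5' : 0 ≤ (zetaR 5 - a5) * (1 / θ ^ 2) := mul_nonneg (by linarith) j2
  rw [abs_le]
  constructor <;> nlinarith [l3.1, l3.2]

/-! ### Bipolar coordinates in three dimensions -/

/-- Cartesian coordinates, with the first one split off. -/
theorem lintegral_R3_eq (F : ℝ → ℝ → ℝ → ENNReal)
    (hF : Measurable fun x : ℝ × ℝ × ℝ => F x.1 x.2.1 x.2.2) :
    ∫⁻ p : R3, F (p 0) (p 1) (p 2) = ∫⁻ z, ∫⁻ x : ℝ × ℝ, F z x.1 x.2 := by
  have h1 := EuclideanSpace.volume_preserving_symm_measurableEquiv_toLp (Fin 3)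
  have h2 := volume_preserving_piFinSuccAbove (fun _ : Fin 3 => ℝ) 0
  have h3 := (MeasurePreserving.id (volume : Measure ℝ)).prod
    (volume_preserving_piFinTwo (fun _ : Fin 2 => ℝ))
  have h := (h3.comp h2).comp h1
  rw [← lintegral_prod _ hF.aemeasurable]
  have := h.lintegral_comp hF
  rw [Measure.volume_eq_prod] at this
  exact this

/-- Radial functions in the plane, via polar coordinates. -/
theorem lintegral_plane_radial (H : ℝ → ENNReal) (hH : Measurable H) :
    ∫⁻ x : ℝ × ℝ, H (x.1 ^ 2 + x.2 ^ 2)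
      = ENNReal.ofReal (2 * Real.pi) * ∫⁻ ρ in Set.Ioi (0 : ℝ), ENNReal.ofReal ρ * H (ρ ^ 2) := by
  rw [← lintegral_comp_polarCoord_symm]
  have e : ∀ p : ℝ × ℝ, H ((polarCoord.symm p).1 ^ 2 + (polarCoord.symm p).2 ^ 2) = H (p.1 ^ 2) :=
    fun p => by
      congr 1
      simp only [polarCoord_symm_apply]
      linear_combination p.1 ^ 2 * Real.cos_sq_add_sin_sq p.2
  simp_rw [e, smul_eq_mul, polarCoord_target]
  rw [Measure.volume_eq_prod, ← Measure.prod_restrict, lintegral_prod _ (by fun_prop)]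
  simp only [lintegral_const, Measure.restrict_apply_univ, Real.volume_Ioo]
  rw [lintegral_mul_const _ (by fun_prop), mul_comm]
  congr 2
  ring

/-- At height `z` the distance `r` from the origin replaces the cylindrical radius:
`r² = z² + ρ²`. -/
theorem lintegral_sqrt_add_sq (z : ℝ) (G : ℝ → ENNReal) :
    ∫⁻ ρ in Set.Ioi (0 : ℝ), ENNReal.ofReal ρ * G (Real.sqrt (z ^ 2 + ρ ^ 2))
      = ∫⁻ r in Set.Ioi |z|, ENNReal.ofReal r * G r := by
  have himg : (fun ρ : ℝ => Real.sqrt (z ^ 2 + ρ ^ 2)) '' Set.Ioi 0 = Set.Ioi |z| := by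
    ext r
    constructor
    · rintro ⟨ρ, hρ, rfl⟩
      have : 0 < ρ := hρ
      exact Real.lt_sqrt_of_sq_lt (by rw [sq_abs]; nlinarith)
    · intro hr
      have hr' : |z| < r := hr
      have hz := abs_nonneg z
      have h0 : 0 < r ^ 2 - z ^ 2 := by rw [← sq_abs z]; nlinarith
      refine ⟨Real.sqrt (r ^ 2 - z ^ 2), Real.sqrt_pos.2 h0, ?_⟩
      simp only
      rw [Real.sq_sqrt h0.le, add_sub_cancel, Real.sqrt_sq (by linarith)]
  rw [← himg, lintegral_image_eq_lintegral_abs_deriv_mul measurableSet_Ioi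
    (f' := fun ρ => ρ / Real.sqrt (z ^ 2 + ρ ^ 2))]
  · refine setLIntegral_congr_fun measurableSet_Ioi fun ρ hρ => ?_
    have hρ' : 0 < ρ := hρ
    have hs : 0 < Real.sqrt (z ^ 2 + ρ ^ 2) := Real.sqrt_pos.2 (by positivity)
    rw [← mul_assoc, ← ENNReal.ofReal_mul (abs_nonneg _), abs_of_pos (by positivity),
      div_mul_cancel₀ _ hs.ne']
  · intro ρ hρ
    have hρ' : 0 < ρ := hρ
    have h1 : HasDerivAt (fun ρ : ℝ => z ^ 2 + ρ ^ 2) (2 * ρ) ρ := by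
      simpa using (hasDerivAt_pow 2 ρ).const_add (z ^ 2)
    have := (h1.sqrt (by positivity)).hasDerivWithinAt (s := Set.Ioi 0)
    refine this.congr_deriv ?_
    have hs : 0 < Real.sqrt (z ^ 2 + ρ ^ 2) := Real.sqrt_pos.2 (by positivity)
    field_simp
  · intro a ha b hb hab
    have ha' : 0 < a := ha
    have hb' : 0 < b := hb
    simp only at hab
    rw [Real.sqrt_inj (by positivity) (by positivity)] at hab
    nlinarith

/-- On the sphere of radius `r`, the distance `s` to the point at height `K` replaces the height:
`s² = r² + K² - 2 K z`. -/
theorem lintegral_height_eq_distance {r K : ℝ} (hr : 0 < r) (hK : 0 < K) (G : ℝ → ENNReal) :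
    ∫⁻ z in Set.Ioo (-r) r, G (Real.sqrt (r ^ 2 + K ^ 2 - 2 * K * z))
      = ∫⁻ s in Set.Ioo |r - K| (r + K), ENNReal.ofReal (s / K) * G s := by
  have himg : (fun s : ℝ => (r ^ 2 + K ^ 2 - s ^ 2) / (2 * K)) '' Set.Ioo |r - K| (r + K)
      = Set.Ioo (-r) r := by
    ext z
    constructor
    · rintro ⟨s, hs, rfl⟩
      have h0 := (abs_nonneg (r - K)).trans_lt hs.1
      have h1 : (r - K) ^ 2 < s ^ 2 := by
        rw [← sq_abs (r - K)]; exact pow_lt_pow_left₀ hs.1 (abs_nonneg _) two_ne_zero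
      have h2 : s ^ 2 < (r + K) ^ 2 := pow_lt_pow_left₀ hs.2 h0.le two_ne_zero
      constructor
      · rw [lt_div_iff₀ (by positivity)]; nlinarith
      · rw [div_lt_iff₀ (by positivity)]; nlinarith
    · intro hz
      have h1 : (r - K) ^ 2 < r ^ 2 + K ^ 2 - 2 * K * z := by nlinarith [hz.2]
      have h2 : r ^ 2 + K ^ 2 - 2 * K * z < (r + K) ^ 2 := by nlinarith [hz.1]
      have h0 : 0 ≤ r ^ 2 + K ^ 2 - 2 * K * z := (sq_nonneg _).trans h1.le
      refine ⟨Real.sqrt (r ^ 2 + K ^ 2 - 2 * K * z), ⟨?_, ?_⟩, ?_⟩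
      · exact Real.lt_sqrt_of_sq_lt (by rwa [sq_abs])
      · rw [Real.sqrt_lt' (by positivity)]; exact h2
      · simp only
        rw [Real.sq_sqrt h0]; field_simp; ring
  rw [← himg, lintegral_image_eq_lintegral_abs_deriv_mul measurableSet_Ioo
    (f' := fun s => -(s / K))]
  · refine setLIntegral_congr_fun measurableSet_Ioo fun s hs => ?_
    have h0 := (abs_nonneg (r - K)).trans_lt hs.1
    have e : r ^ 2 + K ^ 2 - 2 * K * ((r ^ 2 + K ^ 2 - s ^ 2) / (2 * K)) = s ^ 2 := by
      field_simp; ring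
    rw [e, Real.sqrt_sq h0.le, abs_neg, abs_of_pos (by positivity)]
  · intro s _
    have h1 := (((hasDerivAt_pow 2 s).const_sub (r ^ 2 + K ^ 2)).div_const (2 * K))
    refine (h1.congr_deriv ?_).hasDerivWithinAt
    field_simp
    norm_num
  · intro a ha b hb hab
    have ha0 := (abs_nonneg (r - K)).trans_lt ha.1
    have hb0 := (abs_nonneg (r - K)).trans_lt hb.1
    simp only at hab
    rw [div_left_inj' (by positivity)] at hab
    nlinarith

/-- Integration of a function of the two distances `‖p‖` and `‖p - k‖`. -/
theorem lintegral_bipolar {k : R3} (hk : k ≠ 0) (F : ℝ → ℝ → ENNReal)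
    (hF : Measurable (Function.uncurry F)) :
    ∫⁻ p : R3, F ‖p‖ ‖p - k‖
      = ∫⁻ r in Set.Ioi (0 : ℝ), ∫⁻ s in Set.Ioo |r - ‖k‖| (r + ‖k‖),
          ENNReal.ofReal (2 * Real.pi * r * s / ‖k‖) * F r s := by
  have hK : 0 < ‖k‖ := norm_pos_iff.2 hk
  set K := ‖k‖ with hKdef
  -- rotate `k` onto the first coordinate axis
  have hrot : ∫⁻ p : R3, F ‖p‖ ‖p - k‖
      = ∫⁻ p : R3, F ‖p‖ ‖p - EuclideanSpace.single 0 K‖ := by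
    let U : R3 ≃ₗᵢ[ℝ] R3 :=
      (Submodule.span ℝ {(EuclideanSpace.single 0 K : R3) - k})ᗮ.reflection
    have hU : U (EuclideanSpace.single 0 K) = k :=
      Submodule.reflection_sub (by simp [hKdef])
    rw [← (U.measurePreserving).lintegral_comp_emb U.toMeasurableEquiv.measurableEmbedding]
    refine lintegral_congr fun p => ?_
    have : ‖U p - k‖ = ‖p - EuclideanSpace.single 0 K‖ := by
      rw [← hU, ← map_sub, U.norm_map]
    rw [this, U.norm_map]
  have hFm : ∀ {a b : ℝ × ℝ → ℝ}, Measurable a → Measurable b →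
      Measurable fun x => F (a x) (b x) := fun ha hb => hF.comp (ha.prodMk hb)
  let H : ℝ → ℝ → ENNReal := fun z η =>
    F (Real.sqrt (z ^ 2 + η)) (Real.sqrt ((z - K) ^ 2 + η))
  have hH : Measurable (Function.uncurry H) := hF.comp
    (f := fun x : ℝ × ℝ => (Real.sqrt (x.1 ^ 2 + x.2), Real.sqrt ((x.1 - K) ^ 2 + x.2)))
    (by fun_prop)
  have hcart : ∫⁻ p : R3, F ‖p‖ ‖p - EuclideanSpace.single 0 K‖
      = ∫⁻ z, ∫⁻ x : ℝ × ℝ, H z (x.1 ^ 2 + x.2 ^ 2) := by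
    rw [← lintegral_R3_eq (fun z x y => H z (x ^ 2 + y ^ 2))
      (hH.comp (f := fun x : ℝ × ℝ × ℝ => (x.1, x.2.1 ^ 2 + x.2.2 ^ 2)) (by fun_prop))]
    refine lintegral_congr fun p => ?_
    simp only [H]
    rw [EuclideanSpace.norm_eq, EuclideanSpace.norm_eq]
    simp [Fin.sum_univ_three, add_assoc]
  have hz : ∀ z, ∫⁻ x : ℝ × ℝ, H z (x.1 ^ 2 + x.2 ^ 2)
      = ENNReal.ofReal (2 * Real.pi) * ∫⁻ r in Set.Ioi |z|, ENNReal.ofReal r *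
          F r (Real.sqrt (r ^ 2 + K ^ 2 - 2 * K * z)) := by
    intro z
    rw [lintegral_plane_radial (H z) (hH.comp measurable_prodMk_left),
      ← lintegral_sqrt_add_sq z (fun r => F r (Real.sqrt (r ^ 2 + K ^ 2 - 2 * K * z)))]
    congr 1
    refine lintegral_congr fun ρ => ?_
    simp only [H]
    have e : z ^ 2 + ρ ^ 2 + K ^ 2 - 2 * K * z = (z - K) ^ 2 + ρ ^ 2 := by ring
    rw [Real.sq_sqrt (by positivity), e]
  rw [hrot, hcart]
  simp_rw [hz]
  -- exchange the order of integration over `{(z, r) | |z| < r}`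
  let Q : ℝ → ℝ → ENNReal := fun z r => Set.indicator {x : ℝ × ℝ | |x.1| < x.2}
    (fun x => ENNReal.ofReal (2 * Real.pi) * (ENNReal.ofReal x.2 *
      F x.2 (Real.sqrt (x.2 ^ 2 + K ^ 2 - 2 * K * x.1)))) (z, r)
  have hmeas : Measurable fun x : ℝ × ℝ => ENNReal.ofReal (2 * Real.pi) * (ENNReal.ofReal x.2 *
      F x.2 (Real.sqrt (x.2 ^ 2 + K ^ 2 - 2 * K * x.1))) := by
    have := hFm (a := fun x : ℝ × ℝ => x.2)
      (b := fun x => Real.sqrt (x.2 ^ 2 + K ^ 2 - 2 * K * x.1)) (by fun_prop) (by fun_prop)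
    fun_prop
  have hQ : Measurable (Function.uncurry Q) :=
    hmeas.indicator (measurableSet_lt (by fun_prop) (by fun_prop))
  have hL : ∀ z, ENNReal.ofReal (2 * Real.pi) * ∫⁻ r in Set.Ioi |z|, ENNReal.ofReal r *
      F r (Real.sqrt (r ^ 2 + K ^ 2 - 2 * K * z)) = ∫⁻ r, Q z r := by
    intro z
    rw [← lintegral_const_mul' _ _ ENNReal.ofReal_ne_top, ← lintegral_indicator measurableSet_Ioi]
    rfl
  have hRr : ∀ r, ∫⁻ z, Q z r = Set.indicator (Set.Ioi 0) (fun r =>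
      ∫⁻ s in Set.Ioo |r - K| (r + K), ENNReal.ofReal (2 * Real.pi * r * s / K) * F r s) r := by
    intro r
    have hset : ∀ z, Q z r = Set.indicator (Set.Ioo (-r) r) (fun z =>
        ENNReal.ofReal (2 * Real.pi) * (ENNReal.ofReal r *
          F r (Real.sqrt (r ^ 2 + K ^ 2 - 2 * K * z)))) z := by
      intro z
      simp only [Q, Set.indicator, Set.mem_ofPred_eq, Set.mem_Ioo, abs_lt]
    simp_rw [hset]
    rw [lintegral_indicator measurableSet_Ioo]
    by_cases hr : 0 < r
    · rw [Set.indicator_of_mem (show r ∈ Set.Ioi 0 from hr),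
        lintegral_const_mul' _ _ ENNReal.ofReal_ne_top,
        lintegral_const_mul' _ _ ENNReal.ofReal_ne_top, lintegral_height_eq_distance hr hK,
        ← lintegral_const_mul' _ _ ENNReal.ofReal_ne_top,
        ← lintegral_const_mul' _ _ ENNReal.ofReal_ne_top]
      refine setLIntegral_congr_fun measurableSet_Ioo fun s hs => ?_
      rw [← mul_assoc, ← mul_assoc, ← ENNReal.ofReal_mul (by positivity),
        ← ENNReal.ofReal_mul (by positivity)]
      congr 2
      ring
    · rw [Set.indicator_of_notMem (show r ∉ Set.Ioi 0 from hr), Set.Ioo_eq_empty (by linarith)]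
      simp
  simp_rw [hL]
  rw [lintegral_lintegral_swap hQ.aemeasurable]
  simp_rw [hRr]
  rw [lintegral_indicator measurableSet_Ioi]

theorem stronglyMeasurable_integral_bipolar {g : ℝ → ℝ → ℝ}
    (hg : Measurable (Function.uncurry g)) (K : ℝ) :
    StronglyMeasurable fun r => ∫ s in Set.Ioo |r - K| (r + K), g r s := by
  have e : (fun r => ∫ s in Set.Ioo |r - K| (r + K), g r s)
      = fun r => ∫ s, Set.indicator {x : ℝ × ℝ | |x.1 - K| < x.2 ∧ x.2 < x.1 + K}
        (fun x => g x.1 x.2) (r, s) := by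
    funext r
    rw [← integral_indicator measurableSet_Ioo]
    rfl
  rw [e]
  have hm : Measurable (Set.indicator {x : ℝ × ℝ | |x.1 - K| < x.2 ∧ x.2 < x.1 + K}
      (fun x => g x.1 x.2)) :=
    Measurable.indicator hg <|
      (measurableSet_lt (f := fun x : ℝ × ℝ => |x.1 - K|) (g := fun x => x.2)
        (by fun_prop) (by fun_prop)).inter (measurableSet_lt (f := fun x : ℝ × ℝ => x.2)
        (g := fun x => x.1 + K) (by fun_prop) (by fun_prop))
  exact hm.stronglyMeasurable.integral_prod_right'

/-- Bipolar coordinates for the Bochner integral of a nonnegative function over a ball. -/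
theorem integral_ball_bipolar {k : R3} (hk : k ≠ 0) {R : ℝ} {g : ℝ → ℝ → ℝ}
    (hg : Measurable (Function.uncurry g)) (hg0 : ∀ r s, 0 ≤ g r s)
    (hint : ∀ r ∈ Set.Ioo 0 R, IntegrableOn (fun s => 2 * Real.pi * r * s / ‖k‖ * g r s)
      (Set.Ioo |r - ‖k‖| (r + ‖k‖))) :
    ∫ p in {p : R3 | ‖p‖ < R}, g ‖p‖ ‖p - k‖
      = ∫ r in Set.Ioo 0 R, ∫ s in Set.Ioo |r - ‖k‖| (r + ‖k‖),
          2 * Real.pi * r * s / ‖k‖ * g r s := by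
  have hset : MeasurableSet {p : R3 | ‖p‖ < R} := measurableSet_lt (by fun_prop) (by fun_prop)
  have hpos : ∀ r s, 0 < r → s ∈ Set.Ioo |r - ‖k‖| (r + ‖k‖) →
      0 ≤ 2 * Real.pi * r * s / ‖k‖ := fun r s hr hs => by
    have := (abs_nonneg _).trans hs.1.le
    have := Real.pi_pos
    positivity
  rw [integral_eq_lintegral_of_nonneg_ae (Eventually.of_forall fun p => hg0 _ _)
    (by
      refine (Measurable.aestronglyMeasurable ?_)
      exact hg.comp (f := fun p : R3 => (‖p‖, ‖p - k‖)) (by fun_prop))]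
  rw [integral_eq_lintegral_of_nonneg_ae]
  · congr 1
    let F : ℝ → ℝ → ENNReal := fun r s => Set.indicator (Set.Iio R)
      (fun r => ENNReal.ofReal (g r s)) r
    have hF : Measurable (Function.uncurry F) := by
      have : Function.uncurry F = Set.indicator {x : ℝ × ℝ | x.1 < R}
          (fun x => ENNReal.ofReal (Function.uncurry g x)) := by
        funext x; rfl
      rw [this]
      exact hg.ennreal_ofReal.indicator (measurableSet_lt (by fun_prop) (by fun_prop))
    have h := lintegral_bipolar hk F hF
    rw [← lintegral_indicator hset]
    have e1 : (fun p : R3 => Set.indicator {p : R3 | ‖p‖ < R}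
        (fun p => ENNReal.ofReal (g ‖p‖ ‖p - k‖)) p) = fun p => F ‖p‖ ‖p - k‖ := by
      funext p
      simp only [F, Set.indicator, Set.mem_ofPred_eq, Set.mem_Iio]
    rw [e1, h]
    have e2 : Set.Ioo 0 R = Set.Ioi 0 ∩ Set.Iio R := rfl
    rw [e2, Set.inter_comm, ← Measure.restrict_restrict measurableSet_Iio,
      ← lintegral_indicator measurableSet_Iio]
    refine setLIntegral_congr_fun measurableSet_Ioi fun r hr => ?_
    by_cases hrR : r < R
    · simp only [F, Set.indicator, Set.mem_Iio, hrR, if_true]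
      rw [ofReal_integral_eq_lintegral_ofReal (hint r ⟨hr, hrR⟩)]
      · refine setLIntegral_congr_fun measurableSet_Ioo fun s hs => ?_
        rw [ENNReal.ofReal_mul (hpos r s hr hs)]
      · refine (ae_restrict_iff' measurableSet_Ioo).2 (Eventually.of_forall fun s hs => ?_)
        exact mul_nonneg (hpos r s hr hs) (hg0 _ _)
    · simp [F, Set.indicator, hrR]
  · refine (ae_restrict_iff' measurableSet_Ioo).2 (Eventually.of_forall fun r hr => ?_)
    exact setIntegral_nonneg measurableSet_Ioo fun s hs => mul_nonneg (hpos r s hr.1 hs) (hg0 _ _)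
  · refine StronglyMeasurable.aestronglyMeasurable ?_
    refine stronglyMeasurable_integral_bipolar (g := fun r s => 2 * Real.pi * r * s / ‖k‖ * g r s)
      ?_ ‖k‖
    have : Measurable fun x : ℝ × ℝ => g x.1 x.2 := hg
    simp only [Function.uncurry_def]
    fun_prop

/-! ### The regularized delta function on the energy shell -/

/-- The nascent delta function `δ_ε(x) = π⁻¹ ε / (x² + ε²)`. -/
def lorentzian (ε x : ℝ) : ℝ := 1 / Real.pi * (ε / (x ^ 2 + ε ^ 2))

theorem lorentzian_nonneg {ε : ℝ} (hε : 0 < ε) (x : ℝ) : 0 ≤ lorentzian ε x := by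
  unfold lorentzian; have := Real.pi_pos; positivity

theorem lorentzian_eq_cauchy {ε : ℝ} (hε : 0 < ε) (e w : ℝ) :
    lorentzian ε (e - w) = ProbabilityTheory.cauchyPDFReal e ε.toNNReal w := by
  rw [ProbabilityTheory.cauchyPDFReal_def, Real.coe_toNNReal _ hε.le, lorentzian]
  rw [show (e - w) ^ 2 = (w - e) ^ 2 by ring]
  field_simp

theorem integral_lorentzian {ε : ℝ} (hε : 0 < ε) (e : ℝ) : ∫ w, lorentzian ε (e - w) = 1 := by
  simp_rw [lorentzian_eq_cauchy hε]
  exact ProbabilityTheory.integral_cauchyPDFReal_eq_one e (Real.toNNReal_pos.2 hε).ne'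

theorem integrable_lorentzian {ε : ℝ} (hε : 0 < ε) (e : ℝ) :
    Integrable fun w => lorentzian ε (e - w) := by
  simp_rw [lorentzian_eq_cauchy hε]
  exact ProbabilityTheory.integrable_cauchyPDFReal e

theorem measurable_lorentzian (ε : ℝ) : Measurable (lorentzian ε) := by
  unfold lorentzian; fun_prop

theorem lorentzian_le {ε : ℝ} (hε : 0 < ε) (x : ℝ) : lorentzian ε x ≤ 1 / Real.pi * (1 / ε) := by
  unfold lorentzian
  have := Real.pi_pos
  refine mul_le_mul_of_nonneg_left ?_ (by positivity)
  rw [div_le_div_iff₀ (by positivity) hε]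
  nlinarith [sq_nonneg x]

/-- The nascent delta functions concentrate: they are the dilations of the Cauchy density, which
decays faster than `1 / |x|`. -/
theorem tendsto_integral_lorentzian {φ : ℝ → ℝ} {e : ℝ} (hφ : Integrable φ)
    (hc : ContinuousAt φ e) :
    Tendsto (fun ε => ∫ w, φ w * lorentzian ε (e - w)) (𝓝[>] 0) (𝓝 (φ e)) := by
  have hpi := Real.pi_pos
  have h := tendsto_integral_comp_smul_smul_of_integrable' (μ := (volume : Measure ℝ))
    (φ := fun x : ℝ => 1 / Real.pi * (1 + x ^ 2)⁻¹) (fun x => by positivity)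
    (by rw [integral_const_mul, integral_univ_inv_one_add_sq]; field_simp)
    (by
      simp only [Module.finrank_self, pow_one, Real.norm_eq_abs]
      have h0 : Tendsto (fun x : ℝ => 1 / Real.pi * ‖x‖⁻¹) (Bornology.cobounded ℝ) (𝓝 0) := by
        simpa using (tendsto_inv_atTop_zero.comp (tendsto_norm_cobounded_atTop (E := ℝ))).const_mul
          (1 / Real.pi)
      refine squeeze_zero (fun x => by positivity) (fun x => ?_) h0
      rw [Real.norm_eq_abs, mul_left_comm]
      refine mul_le_mul_of_nonneg_left ?_ (by positivity)
      rcases eq_or_ne x 0 with rfl | hx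
      · simp
      have hx' : 0 < |x| := abs_pos.2 hx
      rw [← div_eq_mul_inv, div_le_iff₀ (by positivity), ← sq_abs]
      field_simp
      nlinarith)
    hφ hc
  have h2 := h.comp tendsto_inv_nhdsGT_zero
  refine h2.congr' ?_
  filter_upwards [self_mem_nhdsWithin] with ε hε
  have hε' : (0 : ℝ) < ε := hε
  simp only [Function.comp]
  refine integral_congr_ae (Eventually.of_forall fun w => ?_)
  simp only [Module.finrank_self, pow_one, smul_eq_mul, lorentzian]
  field_simp
  ring

/-- A strictly superadditive, differentiable dispersion law `W` on `[0, R]` with derivative `W'`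
bounded below by `d > 0`. -/
structure IsDispersion (W W' : ℝ → ℝ) (R d : ℝ) : Prop where
  R_pos : 0 < R
  d_pos : 0 < d
  zero : W 0 = 0
  contOn : ContinuousOn W (Set.Icc 0 R)
  deriv : ∀ x ∈ Set.Ioo 0 R, HasDerivAt W (W' x) x
  deriv_ge : ∀ x ∈ Set.Ioo 0 R, d ≤ W' x
  contDeriv : ∀ x ∈ Set.Ioo 0 R, ContinuousAt W' x
  superadd : ∀ r s, 0 < r → 0 < s → r + s < R → W r + W s < W (r + s)

/-- The momentum as a function of the energy: the inverse of `W` on `[0, R]`. -/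
def momentumOf (W : ℝ → ℝ) (R : ℝ) : ℝ → ℝ := Function.invFunOn W (Set.Icc 0 R)

namespace IsDispersion

variable {W W' : ℝ → ℝ} {R d : ℝ} (hW : IsDispersion W W' R d)
include hW

theorem strictMonoOn : StrictMonoOn W (Set.Icc 0 R) := by
  refine strictMonoOn_of_deriv_pos (convex_Icc _ _) hW.contOn fun x hx => ?_
  rw [interior_Icc] at hx
  rw [(hW.deriv x hx).deriv]
  exact hW.d_pos.trans_le (hW.deriv_ge x hx)

theorem momentumOf_apply {x : ℝ} (hx : x ∈ Set.Icc 0 R) : momentumOf W R (W x) = x :=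
  hW.strictMonoOn.injOn.leftInvOn_invFunOn hx

theorem image_Ioo {a b : ℝ} (ha : 0 ≤ a) (hab : a ≤ b) (hb : b ≤ R) :
    W '' Set.Ioo a b = Set.Ioo (W a) (W b) := by
  have hsub : Set.Icc a b ⊆ Set.Icc 0 R := Set.Icc_subset_Icc ha hb
  apply Set.Subset.antisymm
  · rintro _ ⟨x, hx, rfl⟩
    exact ⟨hW.strictMonoOn (hsub ⟨le_rfl, hab⟩) (hsub ⟨hx.1.le, hx.2.le⟩) hx.1,
      hW.strictMonoOn (hsub ⟨hx.1.le, hx.2.le⟩) (hsub ⟨hab, le_rfl⟩) hx.2⟩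
  · exact intermediate_value_Ioo hab (hW.contOn.mono hsub)

theorem continuousAt_momentumOf {x : ℝ} (hx : x ∈ Set.Ioo 0 R) :
    ContinuousAt (momentumOf W R) (W x) := by
  have h0 := hW.R_pos.le
  have him := hW.image_Ioo le_rfl h0 le_rfl
  have hmem : ∀ {y}, y ∈ Set.Ioo 0 R → y ∈ Set.Icc 0 R := fun h => Set.Ioo_subset_Icc_self h
  refine StrictMonoOn.continuousAt_of_image_mem_nhds (s := W '' Set.Ioo 0 R) ?_ ?_ ?_
  · rintro _ ⟨a, ha, rfl⟩ _ ⟨b, hb, rfl⟩ hab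
    rw [hW.momentumOf_apply (hmem ha), hW.momentumOf_apply (hmem hb)]
    exact (hW.strictMonoOn.lt_iff_lt (hmem ha) (hmem hb)).1 hab
  · have hxm : W x ∈ W '' Set.Ioo 0 R := Set.mem_image_of_mem W hx
    rw [him] at hxm ⊢
    exact Ioo_mem_nhds hxm.1 hxm.2
  · rw [hW.momentumOf_apply (hmem hx)]
    refine mem_of_superset (Ioo_mem_nhds hx.1 hx.2) fun y hy => ?_
    exact ⟨W y, Set.mem_image_of_mem W hy, hW.momentumOf_apply (hmem hy)⟩

/-- Substitution of the energy `w = W s` for the momentum `s`. -/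
theorem integral_energy {a b : ℝ} (ha : 0 ≤ a) (hb : b ≤ R) (h : ℝ → ℝ) (D : ℝ → ℝ) :
    ∫ s in Set.Ioo a b, h s * D (W s)
      = ∫ w in W '' Set.Ioo a b, h (momentumOf W R w) / W' (momentumOf W R w) * D w := by
  have hsub : Set.Ioo a b ⊆ Set.Ioo 0 R := Set.Ioo_subset_Ioo ha hb
  rw [integral_image_eq_integral_abs_deriv_smul measurableSet_Ioo
    (fun x hx => (hW.deriv x (hsub hx)).hasDerivWithinAt)
    (hW.strictMonoOn.injOn.mono (hsub.trans Set.Ioo_subset_Icc_self))]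
  refine setIntegral_congr_fun measurableSet_Ioo fun s hs => ?_
  have hd := hW.d_pos.trans_le (hW.deriv_ge s (hsub hs))
  simp only [smul_eq_mul]
  rw [hW.momentumOf_apply (Set.Ioo_subset_Icc_self (hsub hs)), abs_of_pos hd]
  field_simp

theorem integrableOn_energy {a b : ℝ} (ha : 0 ≤ a) (hb : b ≤ R) {h : ℝ → ℝ}
    (hh : IntegrableOn h (Set.Ioo a b)) :
    IntegrableOn (fun w => h (momentumOf W R w) / W' (momentumOf W R w)) (W '' Set.Ioo a b) := by
  have hsub : Set.Ioo a b ⊆ Set.Ioo 0 R := Set.Ioo_subset_Ioo ha hb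
  rw [integrableOn_image_iff_integrableOn_abs_deriv_smul measurableSet_Ioo
    (fun x hx => (hW.deriv x (hsub hx)).hasDerivWithinAt)
    (hW.strictMonoOn.injOn.mono (hsub.trans Set.Ioo_subset_Icc_self))]
  refine hh.congr_fun (fun s hs => ?_) measurableSet_Ioo
  have hd := hW.d_pos.trans_le (hW.deriv_ge s (hsub hs))
  simp only [smul_eq_mul]
  rw [hW.momentumOf_apply (Set.Ioo_subset_Icc_self (hsub hs)), abs_of_pos hd]
  field_simp

/-- The limit of the regularized integral over one momentum, when the energy `E` is attained at an
interior point. -/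
theorem tendsto_inner {a b s : ℝ} (ha : 0 ≤ a) (hb : b ≤ R) (hs : s ∈ Set.Ioo a b) {h : ℝ → ℝ}
    (hh : IntegrableOn h (Set.Ioo a b)) (hc : ContinuousAt h s) :
    Tendsto (fun ε => ∫ x in Set.Ioo a b, h x * lorentzian ε (W s - W x)) (𝓝[>] 0)
      (𝓝 (h s / W' s)) := by
  have hsub : Set.Ioo a b ⊆ Set.Ioo 0 R := Set.Ioo_subset_Ioo ha hb
  have him := hW.image_Ioo ha (hs.1.trans hs.2).le hb
  have hms : MeasurableSet (W '' Set.Ioo a b) := by rw [him]; exact measurableSet_Ioo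
  have hnhds : W '' Set.Ioo a b ∈ 𝓝 (W s) := by
    have := Set.mem_image_of_mem W hs
    rw [him] at this ⊢
    exact Ioo_mem_nhds this.1 this.2
  set φ := Set.indicator (W '' Set.Ioo a b)
    (fun w => h (momentumOf W R w) / W' (momentumOf W R w)) with hφ
  have hφi : Integrable φ := (hW.integrableOn_energy ha hb hh).integrable_indicator hms
  have hinv := hW.momentumOf_apply (Set.Ioo_subset_Icc_self (hsub hs))
  have hφc : ContinuousAt φ (W s) := by
    have hρ := hW.continuousAt_momentumOf (hsub hs)
    have h1 : ContinuousAt (fun w => h (momentumOf W R w) / W' (momentumOf W R w)) (W s) := by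
      refine ContinuousAt.div ?_ ?_ ?_
      · refine ContinuousAt.comp (g := h) ?_ hρ
        rwa [hinv]
      · refine ContinuousAt.comp (g := W') ?_ hρ
        rw [hinv]; exact hW.contDeriv s (hsub hs)
      · rw [hinv]; exact (hW.d_pos.trans_le (hW.deriv_ge s (hsub hs))).ne'
    refine h1.congr ?_
    filter_upwards [hnhds] with w hw
    rw [hφ, Set.indicator_of_mem hw]
  have hlim := tendsto_integral_lorentzian hφi hφc
  have hval : φ (W s) = h s / W' s := by
    rw [hφ, Set.indicator_of_mem (Set.mem_image_of_mem W hs), hinv]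
  rw [hval] at hlim
  refine hlim.congr fun ε => ?_
  rw [hW.integral_energy ha hb h (fun w => lorentzian ε (W s - w)), ← integral_indicator hms]
  congr 1
  funext w
  by_cases hw : w ∈ W '' Set.Ioo a b
  · rw [hφ, Set.indicator_of_mem hw, Set.indicator_of_mem hw]
  · rw [hφ, Set.indicator_of_notMem hw, Set.indicator_of_notMem hw, zero_mul]

theorem pos {x : ℝ} (hx : x ∈ Set.Ioc 0 R) : 0 < W x := by
  have := hW.strictMonoOn ⟨le_rfl, hW.R_pos.le⟩ ⟨hx.1.le, hx.2⟩ hx.1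
  rwa [hW.zero] at this

/-- Below the range of `W` there is no contribution. -/
theorem tendsto_inner_of_neg {a b E : ℝ} (ha : 0 ≤ a) (hb : b ≤ R) (hE : E < 0) {h : ℝ → ℝ}
    (hh : IntegrableOn h (Set.Ioo a b)) :
    Tendsto (fun ε => ∫ x in Set.Ioo a b, h x * lorentzian ε (E - W x)) (𝓝[>] 0) (𝓝 0) := by
  have hsub : Set.Ioo a b ⊆ Set.Ioo 0 R := Set.Ioo_subset_Ioo ha hb
  have hms : MeasurableSet (W '' Set.Ioo a b) := by
    rcases le_or_gt a b with hab | hab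
    · rw [hW.image_Ioo ha hab hb]; exact measurableSet_Ioo
    · rw [Set.Ioo_eq_empty (by linarith), Set.image_empty]; exact MeasurableSet.empty
  set φ := Set.indicator (W '' Set.Ioo a b)
    (fun w => h (momentumOf W R w) / W' (momentumOf W R w)) with hφ
  have hφi : Integrable φ := (hW.integrableOn_energy ha hb hh).integrable_indicator hms
  have hzero : ∀ w < 0, φ w = 0 := by
    intro w hw
    rw [hφ, Set.indicator_of_notMem]
    rintro ⟨x, hx, rfl⟩
    have := hW.pos ⟨(hsub hx).1, (hsub hx).2.le⟩
    linarith
  have hφc : ContinuousAt φ E :=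
    (continuousAt_const (y := (0 : ℝ))).congr
      (by filter_upwards [gt_mem_nhds hE] with w hw using (hzero w hw).symm)
  have hlim := tendsto_integral_lorentzian hφi hφc
  rw [hzero E hE] at hlim
  refine hlim.congr fun ε => ?_
  rw [hW.integral_energy ha hb h (fun w => lorentzian ε (E - w)), ← integral_indicator hms]
  congr 1
  funext w
  by_cases hw : w ∈ W '' Set.Ioo a b
  · rw [hφ, Set.indicator_of_mem hw, Set.indicator_of_mem hw]
  · rw [hφ, Set.indicator_of_notMem hw, Set.indicator_of_notMem hw, zero_mul]

/-- A bound uniform in `ε` and in the energy, from the total mass of the nascent delta function. -/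
theorem abs_inner_le {a b E ε M : ℝ} (ha : 0 ≤ a) (hb : b ≤ R) (hε : 0 < ε) {h : ℝ → ℝ}
    (hM : ∀ x ∈ Set.Ioo a b, |h x| ≤ M) (hM0 : 0 ≤ M) :
    |∫ x in Set.Ioo a b, h x * lorentzian ε (E - W x)| ≤ M / d := by
  have hsub : Set.Ioo a b ⊆ Set.Ioo 0 R := Set.Ioo_subset_Ioo ha hb
  have hd := hW.d_pos
  have hms : MeasurableSet (W '' Set.Ioo a b) := by
    rcases le_or_gt a b with hab | hab
    · rw [hW.image_Ioo ha hab hb]; exact measurableSet_Ioo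
    · rw [Set.Ioo_eq_empty (by linarith), Set.image_empty]; exact MeasurableSet.empty
  rw [hW.integral_energy ha hb h (fun w => lorentzian ε (E - w)), ← integral_indicator hms,
    ← Real.norm_eq_abs]
  have := norm_integral_le_of_norm_le (f := fun w => (W '' Set.Ioo a b).indicator
    (fun w => h (momentumOf W R w) / W' (momentumOf W R w) * lorentzian ε (E - w)) w)
    ((integrable_lorentzian hε E).const_mul (M / d)) (Eventually.of_forall fun w => ?_)
  · rwa [integral_const_mul, integral_lorentzian hε, mul_one] at this
  · by_cases hw : w ∈ W '' Set.Ioo a b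
    · simp only [Set.indicator_of_mem hw]
      obtain ⟨x, hx, rfl⟩ := hw
      have hl := lorentzian_nonneg hε (E - W x)
      have hdx := hW.deriv_ge x (hsub hx)
      rw [hW.momentumOf_apply (Set.Ioo_subset_Icc_self (hsub hx)), norm_mul, norm_div,
        Real.norm_of_nonneg hl, Real.norm_eq_abs, Real.norm_of_nonneg (hd.trans_le hdx).le]
      gcongr
      exact hM x hx
    · simp only [Set.indicator_of_notMem hw, norm_zero]
      exact mul_nonneg (by positivity) (lorentzian_nonneg hε _)

/-- The two-body energy shell in bipolar coordinates. Strict superadditivity of `W` puts every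
solution of `W r + W s = W K` with `r, s > 0` strictly inside the region
`|r - K| < s < r + K`, so the regularized integral converges to the integral over the shell,
parametrized by the energy `u` of one of the two momenta. -/
theorem tendsto_shell {K R₀ M : ℝ} (hK : 0 < K) (hKR : K < R₀) (hR₀ : R₀ + K ≤ R)
    {h : ℝ → ℝ → ℝ} (hm : Measurable (Function.uncurry h)) (hWm : Measurable W) (hM0 : 0 ≤ M)
    (hM : ∀ r ∈ Set.Ioo 0 R₀, ∀ s ∈ Set.Ioo |r - K| (r + K), |h r s| ≤ M)
    (hc : ∀ r ∈ Set.Ioo 0 K, ∀ s ∈ Set.Ioo 0 K, ContinuousAt (h r) s) :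
    Tendsto (fun ε => ∫ r in Set.Ioo 0 R₀, ∫ s in Set.Ioo |r - K| (r + K),
        h r s * lorentzian ε (W K - W r - W s)) (𝓝[>] 0)
      (𝓝 (∫ u in Set.Ioo 0 (W K), h (momentumOf W R u) (momentumOf W R (W K - u)) /
        W' (momentumOf W R (W K - u)) / W' (momentumOf W R u))) ∧
    IntegrableOn (fun u => h (momentumOf W R u) (momentumOf W R (W K - u)) /
        W' (momentumOf W R (W K - u)) / W' (momentumOf W R u)) (Set.Ioo 0 (W K)) := by
  set ρ := momentumOf W R with hρ
  have hKmem : K ∈ Set.Icc 0 R := ⟨hK.le, by linarith⟩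
  -- the on-shell partner momentum
  have hpart : ∀ r ∈ Set.Ioo 0 K, ρ (W K - W r) ∈ Set.Ioo 0 K ∧
      W (ρ (W K - W r)) = W K - W r ∧ ρ (W K - W r) ∈ Set.Ioo |r - K| (r + K) := by
    intro r hr
    have hrm : r ∈ Set.Icc 0 R := ⟨hr.1.le, by linarith [hr.2]⟩
    have h1 : W K - W r ∈ Set.Ioo (W 0) (W K) := by
      rw [hW.zero]
      exact ⟨by linarith [hW.strictMonoOn hrm hKmem hr.2], by linarith [hW.pos ⟨hr.1, hrm.2⟩]⟩
    rw [← hW.image_Ioo le_rfl hK.le hKmem.2] at h1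
    obtain ⟨s, hs, hse⟩ := h1
    have hsm : s ∈ Set.Icc 0 R := ⟨hs.1.le, by linarith [hs.2]⟩
    have : ρ (W K - W r) = s := by rw [← hse]; exact hW.momentumOf_apply hsm
    rw [this]
    refine ⟨hs, hse, ?_, by linarith [hs.2, hr.1]⟩
    have hKrs : K < r + s := by
      by_contra hcon
      have h2 : W (r + s) ≤ W K := by
        refine hW.strictMonoOn.monotoneOn ⟨by linarith [hr.1, hs.1], ?_⟩ hKmem (not_lt.1 hcon)
        linarith [not_lt.1 hcon]
      have h3 := hW.superadd r s hr.1 hs.1 (by linarith [not_lt.1 hcon])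
      linarith
    rw [abs_lt]
    constructor <;> linarith [hr.2]
  set G : ℝ → ℝ := Set.indicator (Set.Ioo 0 K)
    (fun r => h r (ρ (W K - W r)) / W' (ρ (W K - W r))) with hG
  have hlow : ∀ r : ℝ, 0 ≤ |r - K| := fun r => abs_nonneg _
  have hih : ∀ r ∈ Set.Ioo 0 R₀, IntegrableOn (h r) (Set.Ioo |r - K| (r + K)) := by
    intro r hr
    refine IntegrableOn.of_bound (C := M) (by simp)
      (hm.comp measurable_prodMk_left).aestronglyMeasurable ?_
    exact (ae_restrict_iff' measurableSet_Ioo).2 (Eventually.of_forall fun s hs => hM r hr s hs)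
  -- for `r > K` the remaining energy is negative; at `r = K` alone the limit is left undetermined
  have hptw : ∀ r ∈ Set.Ioo 0 R₀, r ≠ K → Tendsto (fun ε => ∫ s in Set.Ioo |r - K| (r + K),
      h r s * lorentzian ε (W K - W r - W s)) (𝓝[>] 0) (𝓝 (G r)) := by
    intro r hr hrK
    have hbR : r + K ≤ R := by linarith [hr.2]
    rcases lt_or_gt_of_ne hrK with hlt | hgt
    · obtain ⟨hsK, hse, hsD⟩ := hpart r ⟨hr.1, hlt⟩
      have := hW.tendsto_inner (hlow r) hbR hsD (hih r hr) (hc r ⟨hr.1, hlt⟩ _ hsK)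
      rw [hse] at this
      rw [hG, Set.indicator_of_mem (show r ∈ Set.Ioo 0 K from ⟨hr.1, hlt⟩)]
      exact this
    · rw [hG, Set.indicator_of_notMem (fun hh : r ∈ Set.Ioo 0 K => by linarith [hh.2])]
      refine hW.tendsto_inner_of_neg (hlow r) hbR ?_ (hih r hr)
      have := hW.strictMonoOn hKmem ⟨hr.1.le, by linarith [hr.2]⟩ hgt
      linarith
  have hae : ∀ᵐ r ∂(volume.restrict (Set.Ioo 0 R₀)), Tendsto (fun ε =>
      ∫ s in Set.Ioo |r - K| (r + K), h r s * lorentzian ε (W K - W r - W s)) (𝓝[>] 0)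
      (𝓝 (G r)) := by
    have hne : ∀ᵐ r ∂(volume.restrict (Set.Ioo 0 R₀)), r ≠ K :=
      ae_restrict_of_ae (by simp [ae_iff])
    filter_upwards [hne, ae_restrict_mem measurableSet_Ioo] with r h1 h2 using hptw r h2 h1
  have hmeas : ∀ ε, AEStronglyMeasurable (fun r => ∫ s in Set.Ioo |r - K| (r + K),
      h r s * lorentzian ε (W K - W r - W s)) (volume.restrict (Set.Ioo 0 R₀)) := by
    intro ε
    refine (stronglyMeasurable_integral_bipolar
      (g := fun r s => h r s * lorentzian ε (W K - W r - W s)) ?_ K).aestronglyMeasurable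
    have h1 : Measurable fun x : ℝ × ℝ => h x.1 x.2 := hm
    have h2 := measurable_lorentzian ε
    simp only [Function.uncurry_def]
    fun_prop
  have hbound : ∀ ε > 0, ∀ᵐ r ∂(volume.restrict (Set.Ioo 0 R₀)),
      ‖∫ s in Set.Ioo |r - K| (r + K), h r s * lorentzian ε (W K - W r - W s)‖ ≤ M / d := by
    intro ε hε
    filter_upwards [ae_restrict_mem measurableSet_Ioo] with r hr
    exact hW.abs_inner_le (hlow r) (by linarith [hr.2]) hε (hM r hr) hM0
  have hfin : IsFiniteMeasure (volume.restrict (Set.Ioo 0 R₀)) := ⟨by simp⟩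
  have hDCT := tendsto_integral_filter_of_dominated_convergence (l := 𝓝[>] (0 : ℝ))
    (fun _ => M / d) (Eventually.of_forall hmeas)
    (by filter_upwards [self_mem_nhdsWithin] with ε hε using hbound ε hε)
    (integrable_const _) hae
  have hGm : AEStronglyMeasurable G (volume.restrict (Set.Ioo 0 R₀)) :=
    aestronglyMeasurable_of_tendsto_ae (𝓝[>] (0 : ℝ)) hmeas hae
  have hGb : ∀ᵐ r ∂(volume.restrict (Set.Ioo 0 R₀)), ‖G r‖ ≤ M / d := by
    filter_upwards [hae] with r hr
    by_cases hrK : r ∈ Set.Ioo 0 K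
    · obtain ⟨hsK, -, hsD⟩ := hpart r hrK
      have hdx := hW.deriv_ge (ρ (W K - W r)) ⟨hsK.1, by linarith [hsK.2]⟩
      have hd := hW.d_pos
      rw [hG, Set.indicator_of_mem hrK, norm_div, Real.norm_of_nonneg (hd.trans_le hdx).le]
      gcongr
      exact hM r ⟨hrK.1, by linarith [hrK.2]⟩ _ hsD
    · rw [hG, Set.indicator_of_notMem hrK, norm_zero]
      exact div_nonneg hM0 hW.d_pos.le
  have hGi : IntegrableOn G (Set.Ioo 0 R₀) :=
    Integrable.of_bound hGm (M / d) hGb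
  have hsubK : Set.Ioo 0 K ⊆ Set.Ioo 0 R₀ := Set.Ioo_subset_Ioo_right hKR.le
  set g : ℝ → ℝ := fun r => h r (ρ (W K - W r)) / W' (ρ (W K - W r)) with hg
  have hgi : IntegrableOn g (Set.Ioo 0 K) :=
    (hGi.mono_set hsubK).congr_fun (fun r hr => by rw [hG, Set.indicator_of_mem hr])
      measurableSet_Ioo
  have himK : W '' Set.Ioo 0 K = Set.Ioo 0 (W K) := by
    rw [hW.image_Ioo le_rfl hK.le hKmem.2, hW.zero]
  have hcongr : Set.EqOn (fun w => g (ρ w) / W' (ρ w)) (fun u => h (ρ u) (ρ (W K - u)) /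
        W' (ρ (W K - u)) / W' (ρ u)) (Set.Ioo 0 (W K)) := by
    intro u hu
    rw [← himK] at hu
    obtain ⟨r, hr, rfl⟩ := hu
    simp only [hg]
    rw [hρ, hW.momentumOf_apply ⟨hr.1.le, by linarith [hr.2]⟩]
  constructor
  · have hval : ∫ r in Set.Ioo 0 R₀, G r = ∫ u in Set.Ioo 0 (W K), h (ρ u) (ρ (W K - u)) /
        W' (ρ (W K - u)) / W' (ρ u) := by
      rw [hG, integral_indicator measurableSet_Ioo, Measure.restrict_restrict measurableSet_Ioo,
        Set.inter_eq_left.2 hsubK]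
      have := hW.integral_energy le_rfl hKmem.2 g (fun _ => 1)
      simp only [mul_one] at this
      rw [this, himK]
      exact setIntegral_congr_fun measurableSet_Ioo hcongr
    rw [← hval]
    exact hDCT
  · have := hW.integrableOn_energy le_rfl hKmem.2 hgi
    rw [himK] at this
    exact this.congr_fun hcongr measurableSet_Ioo

end IsDispersion

/-! ### Bogoliubov functions of a radial profile -/

/-- The dispersion relation as a function of the modulus of the momentum. -/
def bogW (f : ℝ → ℝ) (ν x : ℝ) : ℝ := Real.sqrt (x ^ 4 / 4 + ν * f x * x ^ 2)

/-- The coefficient `s` as a function of the modulus of the momentum. -/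
def bogS (f : ℝ → ℝ) (ν x : ℝ) : ℝ :=
  Real.sqrt (Real.sqrt (bogW f ν x ^ 2 + ν ^ 2 * f x ^ 2) - bogW f ν x) / Real.sqrt (2 * bogW f ν x)

/-- The coefficient `c` as a function of the modulus of the momentum. -/
def bogC (f : ℝ → ℝ) (ν x : ℝ) : ℝ :=
  Real.sqrt (Real.sqrt (bogW f ν x ^ 2 + ν ^ 2 * f x ^ 2) + bogW f ν x) / Real.sqrt (2 * bogW f ν x)

/-- The vertex `j` as a function of the three moduli, without the prefactor `√(ν v̂(0))`. -/
def bogJ (f : ℝ → ℝ) (ν k p q : ℝ) : ℝ :=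
  f k * (bogS f ν k - bogC f ν k) * (bogC f ν p * bogS f ν q + bogC f ν q * bogS f ν p)
    + f p * (bogC f ν p - bogS f ν p) * (bogC f ν k * bogC f ν q + bogS f ν k * bogS f ν q)
    + f q * (bogC f ν q - bogS f ν q) * (bogC f ν p * bogC f ν k + bogS f ν p * bogS f ν k)

/-- The thermal factor at the three energies `x`, `y`, `z`. -/
def thermal (β x y z : ℝ) : ℝ :=
  (1 - Real.exp (β / 2 * (x + y + z))) ^ 2 /
    ((Real.exp (β * x) - 1) * (Real.exp (β * y) - 1) * (Real.exp (β * z) - 1))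

/-- The density of the Beliaev rate as a function of the three moduli. -/
def bogDensity (f : ℝ → ℝ) (ν β v₀ k p q : ℝ) : ℝ :=
  1 / (2 * Real.pi) ^ 3 * (ν * v₀ * bogJ f ν k p q ^ 2) *
    thermal β (bogW f ν k) (bogW f ν p) (bogW f ν q)

/-- `(ω(x) / (√ν x))²`, the square of the phase velocity in units of the speed of sound `√ν`. -/
def velSq (f : ℝ → ℝ) (ν x : ℝ) : ℝ := f x + x ^ 2 / (4 * ν)

/-- The derivative of `bogW f ν` at `x > 0`. -/
def bogW' (f : ℝ → ℝ) (ν x : ℝ) : ℝ :=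
  Real.sqrt ν * (Real.sqrt (velSq f ν x)
    + x * (deriv f x + x / (2 * ν)) / (2 * Real.sqrt (velSq f ν x)))

theorem beliaevDensity_eq {v : R3 → ℝ} (h0 : 0 < vhat v 0)
    (hr : ∀ p, vhat v p = vhatRadial v ‖p‖) {ν : ℝ} (hν : 0 < ν) (β : ℝ) (k p : R3) :
    beliaevDensity v ν β k p
      = bogDensity (fun x => vhatRadial v x / vhat v 0) ν β (vhat v 0) ‖k‖ ‖p‖ ‖p - k‖ := by
  set f : ℝ → ℝ := fun x => vhatRadial v x / vhat v 0 with hf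
  have hv : ∀ p, vhat v p = vhat v 0 * f ‖p‖ := fun p => by rw [hr p, hf]; field_simp
  have hW : ∀ p, omegaBg v ν p = bogW f ν ‖p‖ := fun p => by
    rw [omegaBg, bogW, hf]; simp only [hr p, mul_div_assoc]
  have hS : ∀ p, sBg v ν p = bogS f ν ‖p‖ := fun p => by
    rw [sBg, bogS, hW, hf]; simp only [hr p, div_pow]
  have hC : ∀ p, cBg v ν p = bogC f ν ‖p‖ := fun p => by
    rw [cBg, bogC, hW, hf]; simp only [hr p, div_pow]
  have hJ : vertexJ v ν k p (p - k) ^ 2 = ν * vhat v 0 * bogJ f ν ‖k‖ ‖p‖ ‖p - k‖ ^ 2 := by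
    rw [vertexJ, hv k, hv p, hv (p - k), hS, hS, hS, hC, hC, hC]
    rw [mul_pow, Real.sq_sqrt (by positivity), bogJ]
    field_simp
  rw [beliaevDensity, hJ, hW, hW, hW, bogDensity, thermal, norm_sub_rev k p]

theorem beliaevPhase_eq {v : R3 → ℝ} (hr : ∀ p, vhat v p = vhatRadial v ‖p‖) {ν : ℝ} (k p : R3) :
    beliaevPhase v ν k p = bogW (fun x => vhatRadial v x / vhat v 0) ν ‖k‖
      - bogW (fun x => vhatRadial v x / vhat v 0) ν ‖p‖
      - bogW (fun x => vhatRadial v x / vhat v 0) ν ‖p - k‖ := by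
  have hW : ∀ p, omegaBg v ν p = bogW (fun x => vhatRadial v x / vhat v 0) ν ‖p‖ := fun p => by
    rw [omegaBg, bogW]; simp only [hr p, mul_div_assoc]
  rw [beliaevPhase, hW, hW, hW, norm_sub_rev k p]

theorem bogW_eq {f : ℝ → ℝ} {ν : ℝ} (hν0 : 0 < ν) {x : ℝ} (hx : 0 ≤ x) :
    bogW f ν x = Real.sqrt ν * (x * Real.sqrt (velSq f ν x)) := by
  have e : x ^ 4 / 4 + ν * f x * x ^ 2 = ν * (x ^ 2 * velSq f ν x) := by
    unfold velSq; field_simp; ring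
  rw [bogW, e, Real.sqrt_mul hν0.le, Real.sqrt_mul (sq_nonneg x), Real.sqrt_sq hx]

theorem continuous_bogW {f : ℝ → ℝ} (hf : Continuous f) (ν : ℝ) : Continuous (bogW f ν) := by
  unfold bogW
  fun_prop

theorem bogW_nonneg (f : ℝ → ℝ) (ν x : ℝ) : 0 ≤ bogW f ν x := Real.sqrt_nonneg _

theorem thermal_nonneg {β x y z : ℝ} (hβ : 0 < β) (hx : 0 ≤ x) (hy : 0 ≤ y) (hz : 0 ≤ z) :
    0 ≤ thermal β x y z := by
  have h : ∀ {w}, 0 ≤ w → 0 ≤ Real.exp (β * w) - 1 := fun hw =>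
    sub_nonneg.2 (Real.one_le_exp (mul_nonneg hβ.le hw))
  exact div_nonneg (sq_nonneg _) (mul_nonneg (mul_nonneg (h hx) (h hy)) (h hz))

theorem bogDensity_nonneg {f : ℝ → ℝ} {ν β v₀ : ℝ} (hν : 0 < ν) (hβ : 0 < β) (hv : 0 < v₀)
    (k p q : ℝ) : 0 ≤ bogDensity f ν β v₀ k p q := by
  have := thermal_nonneg hβ (bogW_nonneg f ν k) (bogW_nonneg f ν p) (bogW_nonneg f ν q)
  have := Real.pi_pos
  unfold bogDensity
  positivity

/-- Away from zero energies the thermal factor is bounded; near them it has simple poles. -/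
theorem thermal_le {β x y z : ℝ} (hβ : 0 < β) (hx : 0 < x) (hy : 0 < y) (hz : 0 < z) :
    thermal β x y z ≤ (1 + 1 / (β * x)) * (1 + 1 / (β * y)) * (1 + 1 / (β * z)) := by
  have key : ∀ {a : ℝ}, 0 < a → Real.exp a / (Real.exp a - 1) ≤ 1 + 1 / a := fun {a} ha => by
    have h1 : 0 < Real.exp a - 1 := by linarith [Real.add_one_lt_exp ha.ne']
    have h2 := Real.add_one_le_exp a
    have : Real.exp a / (Real.exp a - 1) = 1 + 1 / (Real.exp a - 1) := by field_simp; ring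
    rw [this]
    gcongr
    linarith
  have hp : ∀ {a : ℝ}, 0 < a → 0 < Real.exp a - 1 := fun {a} ha => by
    linarith [Real.add_one_lt_exp ha.ne']
  have e1 : (1 - Real.exp (β / 2 * (x + y + z))) ^ 2
      ≤ Real.exp (β * x) * Real.exp (β * y) * Real.exp (β * z) := by
    have h1 : 1 ≤ Real.exp (β / 2 * (x + y + z)) := Real.one_le_exp (by positivity)
    have h2 : Real.exp (β * x) * Real.exp (β * y) * Real.exp (β * z)
        = Real.exp (β / 2 * (x + y + z)) ^ 2 := by
      rw [← Real.exp_add, ← Real.exp_add, ← Real.exp_nat_mul]; congr 1; push_cast; ring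
    rw [h2]
    nlinarith
  have px := hp (mul_pos hβ hx)
  have py := hp (mul_pos hβ hy)
  have pz := hp (mul_pos hβ hz)
  calc thermal β x y z
      ≤ Real.exp (β * x) * Real.exp (β * y) * Real.exp (β * z) /
        ((Real.exp (β * x) - 1) * (Real.exp (β * y) - 1) * (Real.exp (β * z) - 1)) := by
        unfold thermal; gcongr
    _ = Real.exp (β * x) / (Real.exp (β * x) - 1) * (Real.exp (β * y) / (Real.exp (β * y) - 1))
        * (Real.exp (β * z) / (Real.exp (β * z) - 1)) := by field_simp
    _ ≤ _ := by
        have := key (mul_pos hβ hx)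
        have := key (mul_pos hβ hy)
        have := key (mul_pos hβ hz)
        gcongr

/-- On the energy shell the thermal factor is the product of two emission factors, relative to
detailed balance. -/
theorem thermal_on_shell {β y z : ℝ} (hβ : 0 < β) (hy : 0 < y) (hz : 0 < z) :
    thermal β (y + z) y z = (1 - Real.exp (-(β * (y + z)))) /
      ((1 - Real.exp (-(β * y))) * (1 - Real.exp (-(β * z)))) := by
  have hey : 1 < Real.exp (β * y) := Real.one_lt_exp_iff.2 (by positivity)
  have hez : 1 < Real.exp (β * z) := Real.one_lt_exp_iff.2 (by positivity)
  have e1 : β / 2 * (y + z + y + z) = β * y + β * z := by ring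
  unfold thermal
  rw [e1, mul_add, neg_add, Real.exp_add, Real.exp_add, Real.exp_neg, Real.exp_neg]
  generalize Real.exp (β * y) = a at *
  generalize Real.exp (β * z) = b at *
  have ha : a - 1 ≠ 0 := by linarith
  have hb : b - 1 ≠ 0 := by linarith
  have ha0 : a ≠ 0 := by linarith
  have hb0 : b ≠ 0 := by linarith
  have hab : a * b - 1 ≠ 0 := by nlinarith
  have d1 : 1 - a⁻¹ = (a - 1) / a := by field_simp
  have d2 : 1 - b⁻¹ = (b - 1) / b := by field_simp
  have d3 : 1 - a⁻¹ * b⁻¹ = (a * b - 1) / (a * b) := by field_simp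
  rw [d1, d2, d3]
  field_simp
  ring

/-- The numerator of the vertex, with `y = ω(x) / x` as a separate variable. -/
theorem vertex_numerator_identity (fk fp fq k p q yk yp yq a b d : ℝ) :
    fk * ((yk - k / 2) / a - (yk + k / 2) / a) *
        ((yp + p / 2) / b * ((yq - q / 2) / d) + (yq + q / 2) / d * ((yp - p / 2) / b))
      + fp * ((yp + p / 2) / b - (yp - p / 2) / b) *
        ((yk + k / 2) / a * ((yq + q / 2) / d) + (yk - k / 2) / a * ((yq - q / 2) / d))
      + fq * ((yq + q / 2) / d - (yq - q / 2) / d) *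
        ((yp + p / 2) / b * ((yk + k / 2) / a) + (yp - p / 2) / b * ((yk - k / 2) / a))
    = (k * p * q / 2 * (fk + fp + fq)
        + 2 * (fp * p * (yk * yq) + fq * q * (yp * yk) - fk * k * (yp * yq))) / (a * b * d) := by
  ring

namespace IsProfile

variable {f : ℝ → ℝ} {V R L B c ν : ℝ} (hP : IsProfile f V R L B c) (hν : ν ∈ Set.Ioc 0 V)
include hP hν

theorem velSq_ge (x : ℝ) : c * (1 + x ^ 2) ≤ velSq f ν x := by
  refine (hP.lower x).trans ?_
  unfold velSq
  have := hν.1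
  gcongr
  exact hν.2

theorem velSq_pos (x : ℝ) : 0 < velSq f ν x :=
  (mul_pos hP.c_pos (by positivity)).trans_le (hP.velSq_ge hν x)

theorem half_le_velSq {x : ℝ} (hx : x ∈ Set.Ico 0 R) : 1 / 2 ≤ velSq f ν x := by
  unfold velSq
  have h1 := hP.half_lt x hx
  have h2 := hν.1
  have h3 : 0 ≤ x ^ 2 / (4 * ν) := by positivity
  linarith

theorem bogW_sq (x : ℝ) : bogW f ν x ^ 2 = ν * (x ^ 2 * velSq f ν x) := by
  have hν0 := hν.1
  have e : x ^ 4 / 4 + ν * f x * x ^ 2 = ν * (x ^ 2 * velSq f ν x) := by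
    unfold velSq; field_simp; ring
  have := hP.velSq_pos hν x
  rw [bogW, e, Real.sq_sqrt (by positivity)]

theorem bogW_pos {x : ℝ} (hx : 0 < x) : 0 < bogW f ν x := by
  have := hP.velSq_pos hν x
  have := hν.1
  rw [bogW_eq hν.1 hx.le]
  positivity

theorem bogW_ge {x : ℝ} (hx : 0 ≤ x) : Real.sqrt (ν * c) * (x * Real.sqrt (1 + x ^ 2))
    ≤ bogW f ν x := by
  have := hP.c_pos
  rw [bogW_eq hν.1 hx, Real.sqrt_mul hν.1.le, mul_assoc]
  refine mul_le_mul_of_nonneg_left ?_ (Real.sqrt_nonneg _)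
  rw [mul_left_comm]
  refine mul_le_mul_of_nonneg_left ?_ hx
  rw [← Real.sqrt_mul hP.c_pos.le]
  exact Real.sqrt_le_sqrt (hP.velSq_ge hν x)

theorem hasDerivAt_velSq {x : ℝ} (hx : x ∈ Set.Ico 0 R) :
    HasDerivAt (velSq f ν) (deriv f x + x / (2 * ν)) x := by
  have h1 := (hP.diff x hx).hasDerivAt
  have h2 := (hasDerivAt_pow 2 x).div_const (4 * ν)
  refine (h1.add h2).congr_deriv ?_
  have := hν.1
  norm_num
  field_simp
  ring

theorem deriv_velSq_pos {x : ℝ} (hx : x ∈ Set.Ioo 0 R) : 0 < deriv f x + x / (2 * ν) := by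
  have h1 := hP.deriv_gt x hx
  have h2 : x / (2 * V) ≤ x / (2 * ν) := by
    have := hx.1
    have := hν.1
    have := hν.2
    gcongr
  linarith

theorem isDispersion : IsDispersion (bogW f ν) (bogW' f ν) R (Real.sqrt ν * Real.sqrt c) where
  R_pos := hP.R_pos
  d_pos := mul_pos (Real.sqrt_pos.2 hν.1) (Real.sqrt_pos.2 hP.c_pos)
  zero := by simp [bogW]
  contOn := (continuous_bogW hP.cont ν).continuousOn
  deriv := fun x hx => by
    have h0 := hP.velSq_pos hν x
    have h1 := (hP.hasDerivAt_velSq hν ⟨hx.1.le, hx.2⟩).sqrt h0.ne'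
    have h2 := ((hasDerivAt_id x).mul h1).const_mul (Real.sqrt ν)
    have h3 : bogW f ν =ᶠ[𝓝 x] fun y => Real.sqrt ν * (y * Real.sqrt (velSq f ν y)) := by
      filter_upwards [lt_mem_nhds hx.1] with y hy using bogW_eq hν.1 hy.le
    refine (h2.congr_of_eventuallyEq h3).congr_deriv ?_
    simp [bogW', mul_div_assoc]
  deriv_ge := fun x hx => by
    refine mul_le_mul_of_nonneg_left ?_ (Real.sqrt_nonneg _)
    have h1 : Real.sqrt c ≤ Real.sqrt (velSq f ν x) := by
      refine Real.sqrt_le_sqrt (le_trans ?_ (hP.velSq_ge hν x))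
      nlinarith [hP.c_pos, sq_nonneg x]
    have h2 := hP.deriv_velSq_pos hν hx
    have h3 : 0 ≤ x * (deriv f x + x / (2 * ν)) / (2 * Real.sqrt (velSq f ν x)) := by
      have := hx.1
      positivity
    linarith
  contDeriv := fun x hx => by
    have h0 : 2 * Real.sqrt (velSq f ν x) ≠ 0 :=
      (mul_pos two_pos (Real.sqrt_pos.2 (hP.velSq_pos hν x))).ne'
    have h1 : ContinuousAt (deriv f) x := hP.contDeriv x ⟨hx.1.le, hx.2⟩
    have h2 : ContinuousAt (velSq f ν) x := (hP.hasDerivAt_velSq hν ⟨hx.1.le, hx.2⟩).continuousAt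
    have h3 : ContinuousAt (fun y => Real.sqrt (velSq f ν y)) x := h2.sqrt
    unfold bogW'
    exact continuousAt_const.mul (h3.add ((continuousAt_id.mul (h1.add
      (continuousAt_id.div_const _))).div (continuousAt_const.mul h3) h0))
  superadd := fun r s hr hs hrs => by
    -- `ω(x) / x` is strictly increasing because `velSq` is
    have hmono : StrictMonoOn (velSq f ν) (Set.Icc 0 (r + s)) := by
      refine strictMonoOn_of_deriv_pos (convex_Icc _ _) (fun x hx => ?_) fun x hx => ?_
      · exact (hP.hasDerivAt_velSq hν
          ⟨hx.1, hx.2.trans_lt hrs⟩).continuousAt.continuousWithinAt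
      · rw [interior_Icc] at hx
        rw [(hP.hasDerivAt_velSq hν ⟨hx.1.le, hx.2.trans hrs⟩).deriv]
        exact hP.deriv_velSq_pos hν ⟨hx.1, hx.2.trans hrs⟩
    have hlt : ∀ x, 0 < x → x < r + s →
        x * Real.sqrt (velSq f ν x) < x * Real.sqrt (velSq f ν (r + s)) := fun x h0 h1 => by
      refine mul_lt_mul_of_pos_left (Real.sqrt_lt_sqrt (hP.velSq_pos hν x).le ?_) h0
      exact hmono ⟨h0.le, h1.le⟩ ⟨by linarith, le_rfl⟩ h1
    rw [bogW_eq hν.1 hr.le, bogW_eq hν.1 hs.le, bogW_eq hν.1 (by linarith), ← mul_add]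
    refine mul_lt_mul_of_pos_left ?_ (Real.sqrt_pos.2 hν.1)
    rw [add_mul]
    exact add_lt_add (hlt r hr (by linarith)) (hlt s hs (by linarith))

/-! ### The vertex in factorized form -/

theorem sqrt_sum_eq {x : ℝ} (hx : 0 < x) (hf : 0 ≤ f x) :
    Real.sqrt (bogW f ν x ^ 2 + ν ^ 2 * f x ^ 2) = x ^ 2 / 2 + ν * f x := by
  have hν0 := hν.1
  rw [hP.bogW_sq hν, ← Real.sqrt_sq (by positivity : 0 ≤ x ^ 2 / 2 + ν * f x)]
  congr 1
  unfold velSq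
  field_simp
  ring

theorem bogC_eq {x : ℝ} (hx : 0 < x) (hf : 0 ≤ f x) :
    bogC f ν x = (bogW f ν x / x + x / 2) / Real.sqrt (2 * bogW f ν x) := by
  have hν0 := hν.1
  have hW := bogW_nonneg f ν x
  rw [bogC, hP.sqrt_sum_eq hν hx hf]
  congr 1
  rw [← Real.sqrt_sq (by positivity : 0 ≤ bogW f ν x / x + x / 2)]
  congr 1
  have h := hP.bogW_sq hν x
  have e : (bogW f ν x / x + x / 2) ^ 2 = bogW f ν x ^ 2 / x ^ 2 + bogW f ν x + x ^ 2 / 4 := by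
    field_simp; ring
  rw [e, h]
  unfold velSq
  field_simp
  ring

theorem bogS_eq {x : ℝ} (hx : 0 < x) (hf : 0 ≤ f x) :
    bogS f ν x = (bogW f ν x / x - x / 2) / Real.sqrt (2 * bogW f ν x) := by
  have hν0 := hν.1
  have hW := bogW_nonneg f ν x
  have h := hP.bogW_sq hν x
  have hge : 0 ≤ bogW f ν x / x - x / 2 := by
    have : x ^ 2 / 2 ≤ bogW f ν x := by
      refine (pow_le_pow_iff_left₀ (by positivity) hW two_ne_zero).1 ?_
      rw [h]
      unfold velSq
      have h1 : ν * (x ^ 2 * (f x + x ^ 2 / (4 * ν))) = (x ^ 2 / 2) ^ 2 + ν * x ^ 2 * f x := by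
        field_simp; ring
      rw [h1]
      have : 0 ≤ ν * x ^ 2 * f x := by positivity
      linarith
    rw [sub_nonneg, le_div_iff₀ hx]
    linarith
  rw [bogS, hP.sqrt_sum_eq hν hx hf]
  congr 1
  rw [← Real.sqrt_sq hge]
  congr 1
  have e : (bogW f ν x / x - x / 2) ^ 2 = bogW f ν x ^ 2 / x ^ 2 - bogW f ν x + x ^ 2 / 4 := by
    field_simp; ring
  rw [e, h]
  unfold velSq
  field_simp
  ring

end IsProfile

/-- `√(8 ω(k) ω(p) ω(q))` times the vertex, at moduli where `f` is nonnegative: there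
`√(ω² + ν² f²) = x² / 2 + ν f` is rational, and `c`, `s` equal `(ω / x ± x / 2) / √(2ω)`. -/
def vertexNum (f : ℝ → ℝ) (ν k p q : ℝ) : ℝ :=
  k * p * q / 2 * (f k + f p + f q)
    + 2 * (f p * p * (bogW f ν k / k * (bogW f ν q / q))
      + f q * q * (bogW f ν p / p * (bogW f ν k / k))
      - f k * k * (bogW f ν p / p * (bogW f ν q / q)))

namespace IsProfile

variable {f : ℝ → ℝ} {V R L B c ν : ℝ} (hP : IsProfile f V R L B c) (hν : ν ∈ Set.Ioc 0 V)
include hP hν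

theorem bogJ_sq {k p q : ℝ} (hk : k ∈ Set.Ioo 0 R) (hp : p ∈ Set.Ioo 0 R) (hq : q ∈ Set.Ioo 0 R) :
    bogJ f ν k p q ^ 2
      = vertexNum f ν k p q ^ 2 / (8 * (bogW f ν k * bogW f ν p * bogW f ν q)) := by
  have hf : ∀ {x}, x ∈ Set.Ioo 0 R → 0 ≤ f x := fun hx => by
    linarith [hP.half_lt _ ⟨hx.1.le, hx.2⟩]
  have h := vertex_numerator_identity (f k) (f p) (f q) k p q (bogW f ν k / k) (bogW f ν p / p)
    (bogW f ν q / q) (Real.sqrt (2 * bogW f ν k)) (Real.sqrt (2 * bogW f ν p))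
    (Real.sqrt (2 * bogW f ν q))
  rw [← hP.bogC_eq hν hk.1 (hf hk), ← hP.bogC_eq hν hp.1 (hf hp), ← hP.bogC_eq hν hq.1 (hf hq),
    ← hP.bogS_eq hν hk.1 (hf hk), ← hP.bogS_eq hν hp.1 (hf hp), ← hP.bogS_eq hν hq.1 (hf hq)] at h
  rw [bogJ, h, div_pow, mul_pow, mul_pow, Real.sq_sqrt (by linarith [bogW_nonneg f ν k]),
    Real.sq_sqrt (by linarith [bogW_nonneg f ν p]), Real.sq_sqrt (by linarith [bogW_nonneg f ν q]),
    vertexNum]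
  congr 1
  ring

end IsProfile

/-! ### Boundedness of the density -/

theorem measurable_bogDensity {f : ℝ → ℝ} (hf : Continuous f) (ν β v₀ k : ℝ) :
    Measurable fun x : ℝ × ℝ => bogDensity f ν β v₀ k x.1 x.2 := by
  have hW : Measurable (bogW f ν) := (continuous_bogW hf ν).measurable
  have hfm := hf.measurable
  have hC : Measurable (bogC f ν) := by unfold bogC; fun_prop
  have hS : Measurable (bogS f ν) := by unfold bogS; fun_prop
  unfold bogDensity bogJ thermal
  fun_prop

theorem bogW_div {f : ℝ → ℝ} {ν : ℝ} (hν : 0 < ν) {x : ℝ} (hx : 0 < x) :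
    bogW f ν x / x = Real.sqrt ν * Real.sqrt (velSq f ν x) := by
  rw [bogW_eq hν hx.le]; field_simp

theorem abs_sqrt_sub_sqrt_le {a b : ℝ} (ha : 1 / 2 ≤ a) (hb : 1 / 2 ≤ b) :
    |Real.sqrt a - Real.sqrt b| ≤ |a - b| := by
  have h1 : 1 / 2 ≤ Real.sqrt a := Real.le_sqrt_of_sq_le (by linarith)
  have h2 : 1 / 2 ≤ Real.sqrt b := Real.le_sqrt_of_sq_le (by linarith)
  have e : a - b = (Real.sqrt a - Real.sqrt b) * (Real.sqrt a + Real.sqrt b) := by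
    have := Real.sq_sqrt (show 0 ≤ a by linarith)
    have := Real.sq_sqrt (show 0 ≤ b by linarith)
    nlinarith
  rw [e, abs_mul, abs_of_nonneg (show 0 ≤ Real.sqrt a + Real.sqrt b by linarith)]
  have := abs_nonneg (Real.sqrt a - Real.sqrt b)
  nlinarith

namespace IsProfile

variable {f : ℝ → ℝ} {V R L B c ν : ℝ} (hP : IsProfile f V R L B c)
include hP

theorem abs_sub_le {x y : ℝ} (hx : x ∈ Set.Ico 0 R) (hy : y ∈ Set.Ico 0 R) :
    |f x - f y| ≤ L * |x ^ 2 - y ^ 2| := by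
  wlog hxy : y ≤ x generalizing x y
  · rw [abs_sub_comm, abs_sub_comm (x ^ 2)]
    exact this hy hx (not_le.1 hxy).le
  have hsub : ∀ {z}, z ∈ Set.Icc y x → z ∈ Set.Ico 0 R := fun hz =>
    ⟨hy.1.trans hz.1, hz.2.trans_lt hx.2⟩
  have hL := hP.L_pos
  have h := (convex_Icc y x).norm_image_sub_le_of_norm_deriv_le (f := f) (C := L * x)
    (fun z hz => hP.diff z (hsub hz))
    (fun z hz => (hP.deriv_le z (hsub hz)).trans (by gcongr; exact hz.2))
    ⟨le_rfl, hxy⟩ ⟨hxy, le_rfl⟩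
  rw [Real.norm_eq_abs, Real.norm_eq_abs] at h
  refine h.trans ?_
  rw [mul_assoc]
  refine mul_le_mul_of_nonneg_left ?_ hL.le
  rw [abs_of_nonneg (by linarith), abs_of_nonneg (by nlinarith [hy.1])]
  nlinarith [hy.1]

variable (hν : ν ∈ Set.Ioc 0 V)
include hν

theorem abs_velSq_sub_le {x y : ℝ} (hx : x ∈ Set.Ico 0 R) (hy : y ∈ Set.Ico 0 R) :
    |velSq f ν x - velSq f ν y| ≤ (L + 1 / (4 * ν)) * |x ^ 2 - y ^ 2| := by
  have h := hP.abs_sub_le hx hy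
  have h0 := hν.1
  have e : velSq f ν x - velSq f ν y = (f x - f y) + 1 / (4 * ν) * (x ^ 2 - y ^ 2) := by
    unfold velSq; ring
  rw [e, add_mul]
  refine (abs_add_le _ _).trans (add_le_add h ?_)
  rw [abs_mul, abs_of_pos (by positivity)]

/-- The numerator of the vertex vanishes linearly as one of the outgoing momenta tends to zero,
because then the other one tends to `k`. -/
theorem exists_vertexNum_le {k : ℝ} (hk : k ∈ Set.Ioo 0 R) :
    ∃ C, ∀ p ∈ Set.Ioo 0 R, ∀ q ∈ Set.Ioo 0 R, |q - k| ≤ p → |vertexNum f ν k p q| ≤ C * p := by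
  have hν0 := hν.1
  have hL := hP.L_pos
  have hB := hP.B_pos
  have hR := hP.R_pos
  set Y : ℝ := Real.sqrt ν * Real.sqrt (B + R ^ 2 / (4 * ν)) with hY
  have hY0 : 0 ≤ Y := by positivity
  have hIco : ∀ {x}, x ∈ Set.Ioo 0 R → x ∈ Set.Ico 0 R := fun h => ⟨h.1.le, h.2⟩
  have hy : ∀ {x}, x ∈ Set.Ioo 0 R → |bogW f ν x / x| ≤ Y := fun {x} hx => by
    rw [abs_of_nonneg (div_nonneg (bogW_nonneg _ _ _) hx.1.le), bogW_div hν.1 hx.1]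
    refine mul_le_mul_of_nonneg_left (Real.sqrt_le_sqrt ?_) (Real.sqrt_nonneg _)
    unfold velSq
    have h1 := (abs_le.1 (hP.bound x)).2
    have h2 : x ^ 2 ≤ R ^ 2 := pow_le_pow_left₀ hx.1.le hx.2.le 2
    gcongr
  have hsq : ∀ {x y}, x ∈ Set.Ioo 0 R → y ∈ Set.Ioo 0 R → |x ^ 2 - y ^ 2| ≤ 2 * R * |x - y| := by
    intro x y hx hy
    rw [show x ^ 2 - y ^ 2 = (x + y) * (x - y) by ring, abs_mul,
      abs_of_pos (add_pos hx.1 hy.1)]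
    have := abs_nonneg (x - y)
    have := hx.2
    have := hy.2
    gcongr
    linarith
  set Lf : ℝ := L * (2 * R) with hLf
  set Ly : ℝ := Real.sqrt ν * ((L + 1 / (4 * ν)) * (2 * R)) with hLy
  have hlf : ∀ {x y}, x ∈ Set.Ioo 0 R → y ∈ Set.Ioo 0 R → |f x - f y| ≤ Lf * |x - y| := by
    intro x y hx hy
    refine (hP.abs_sub_le (hIco hx) (hIco hy)).trans ?_
    rw [hLf, mul_assoc]
    exact mul_le_mul_of_nonneg_left (hsq hx hy) hL.le
  have hly : ∀ {x y}, x ∈ Set.Ioo 0 R → y ∈ Set.Ioo 0 R →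
      |bogW f ν x / x - bogW f ν y / y| ≤ Ly * |x - y| := by
    intro x y hx hy
    rw [bogW_div hν.1 hx.1, bogW_div hν.1 hy.1, ← mul_sub, abs_mul,
      abs_of_nonneg (Real.sqrt_nonneg _), hLy, mul_assoc]
    refine mul_le_mul_of_nonneg_left ?_ (Real.sqrt_nonneg _)
    refine (abs_sqrt_sub_sqrt_le (hP.half_le_velSq hν (hIco hx))
      (hP.half_le_velSq hν (hIco hy))).trans ?_
    refine (hP.abs_velSq_sub_le hν (hIco hx) (hIco hy)).trans ?_
    rw [mul_assoc]
    exact mul_le_mul_of_nonneg_left (hsq hx hy) (by positivity)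
  have hLf0 : 0 ≤ Lf := by positivity
  have hLy0 : 0 ≤ Ly := by positivity
  refine ⟨R * R / 2 * (B + B + B) + 2 * (B * (Y * Y)
    + Y * (B * R * Ly + Y * (B + R * Lf))), fun p hp q hq hqk => ?_⟩
  have yk := hy hk
  have yp := hy hp
  have yq := hy hq
  have lf := hlf hq hk
  have ly := hly hk hq
  unfold vertexNum
  generalize bogW f ν k / k = a at *
  generalize bogW f ν p / p = b at *
  generalize bogW f ν q / q = d at *
  have hp0 := hp.1.le
  have hpa : |p| = p := abs_of_pos hp.1
  have hqa : |q| ≤ R := by rw [abs_of_pos hq.1]; exact hq.2.le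
  have hka : |k| ≤ R := by rw [abs_of_pos hk.1]; exact hk.2.le
  have bk := hP.bound k
  have bp := hP.bound p
  have bq := hP.bound q
  rw [abs_sub_comm k q] at ly
  have hdiff : |f q * q * (a - d) + d * (f q * (q - k) + k * (f q - f k))|
      ≤ (B * R * Ly + Y * (B + R * Lf)) * p := by
    calc |f q * q * (a - d) + d * (f q * (q - k) + k * (f q - f k))|
        ≤ |f q| * |q| * |a - d| + |d| * (|f q| * |q - k| + |k| * |f q - f k|) := by
          refine (abs_add_le _ _).trans ?_
          rw [abs_mul, abs_mul, abs_mul d]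
          gcongr
          refine (abs_add_le _ _).trans ?_
          rw [abs_mul, abs_mul]
      _ ≤ B * R * (Ly * p) + Y * (B * p + R * (Lf * p)) := by
          have l1 : |a - d| ≤ Ly * p := ly.trans (by gcongr)
          have l2 : |f q - f k| ≤ Lf * p := lf.trans (by gcongr)
          gcongr
      _ = _ := by ring
  have e : k * p * q / 2 * (f k + f p + f q)
      + 2 * (f p * p * (a * d) + f q * q * (b * a) - f k * k * (b * d))
      = k * q / 2 * (f k + f p + f q) * p + 2 * (f p * (a * d) * p
        + b * (f q * q * (a - d) + d * (f q * (q - k) + k * (f q - f k)))) := by ring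
  rw [e]
  calc |k * q / 2 * (f k + f p + f q) * p + 2 * (f p * (a * d) * p
        + b * (f q * q * (a - d) + d * (f q * (q - k) + k * (f q - f k))))|
      ≤ |k| * |q| / 2 * (|f k| + |f p| + |f q|) * |p| + 2 * (|f p| * (|a| * |d|) * |p|
        + |b| * |f q * q * (a - d) + d * (f q * (q - k) + k * (f q - f k))|) := by
        refine (abs_add_le _ _).trans (add_le_add ?_ ?_)
        · rw [abs_mul, abs_mul, abs_div, abs_mul, abs_two]
          gcongr
          exact abs_add_three _ _ _
        · rw [abs_mul, abs_two]
          gcongr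
          refine (abs_add_le _ _).trans ?_
          rw [abs_mul, abs_mul, abs_mul a, abs_mul b]
    _ ≤ R * R / 2 * (B + B + B) * p + 2 * (B * (Y * Y) * p
        + Y * ((B * R * Ly + Y * (B + R * Lf)) * p)) := by
        rw [hpa]; gcongr
    _ = _ := by ring

theorem bogW_ge_linear {x : ℝ} (hx : 0 ≤ x) : Real.sqrt (ν * c) * x ≤ bogW f ν x := by
  refine le_trans ?_ (hP.bogW_ge hν hx)
  refine mul_le_mul_of_nonneg_left ?_ (Real.sqrt_nonneg _)
  have : 1 ≤ Real.sqrt (1 + x ^ 2) := Real.one_le_sqrt.2 (by nlinarith [sq_nonneg x])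
  nlinarith

/-- At small momenta the smaller outgoing momentum `p` enters as `p²` through the vertex, as `1 / p`
through its normalization and as `1 / p` through the thermal factor, so the density stays bounded. -/
theorem exists_bogDensity_le_near {β v₀ k : ℝ} (hβ : 0 < β) (hv : 0 < v₀)
    (hk : k ∈ Set.Ioo 0 R) :
    ∃ M, ∀ p ∈ Set.Ioo 0 R, ∀ q ∈ Set.Ioo 0 R, |p - q| ≤ k → k ≤ p + q →
      bogDensity f ν β v₀ k p q ≤ M := by
  obtain ⟨C, hC⟩ := hP.exists_vertexNum_le hν hk
  have hν0 := hν.1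
  have hc := hP.c_pos
  have hR := hP.R_pos
  have hpi := Real.pi_pos
  set w := Real.sqrt (ν * c) with hw
  have hw0 : 0 < w := Real.sqrt_pos.2 (mul_pos hν0 hc)
  have hk0 := hk.1
  set T := R + 1 / (β * w) with hT
  have hT0 : 0 < T := by positivity
  have hthermal : ∀ p ∈ Set.Ioo 0 R, ∀ q ∈ Set.Ioo 0 R,
      thermal β (bogW f ν k) (bogW f ν p) (bogW f ν q) ≤ T / k * (T / p) * (T / q) := by
    intro p hp q hq
    have hx : ∀ {x}, x ∈ Set.Ioo 0 R → 1 + 1 / (β * bogW f ν x) ≤ T / x := fun {x} hx => by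
      have h0 := hx.1
      have h1 := hP.bogW_ge_linear hν hx.1.le
      have h2 : 1 / (β * bogW f ν x) ≤ 1 / (β * (w * x)) := by gcongr
      have h3 : T / x = R / x + 1 / (β * (w * x)) := by rw [hT]; field_simp
      have h4 : 1 ≤ R / x := by rw [le_div_iff₀ h0]; linarith [hx.2]
      linarith
    refine (thermal_le hβ (hP.bogW_pos hν hk.1) (hP.bogW_pos hν hp.1)
      (hP.bogW_pos hν hq.1)).trans ?_
    have a1 := hP.bogW_pos hν hk.1
    have a2 := hP.bogW_pos hν hp.1
    have a3 := hP.bogW_pos hν hq.1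
    have := hx hk
    have := hx hp
    have := hx hq
    have := hp.1
    have := hq.1
    gcongr
  -- it suffices to treat the case in which `p` is the smaller momentum
  have key : ∀ p ∈ Set.Ioo 0 R, ∀ q ∈ Set.Ioo 0 R, |p - q| ≤ k → k ≤ p + q → p ≤ q →
      bogDensity f ν β v₀ k p q
        ≤ 1 / (2 * Real.pi) ^ 3 * (ν * v₀ * (C ^ 2 / (8 * w ^ 3 * k))) * (T ^ 3 * 4 / k ^ 3) := by
    intro p hp q hq h1 h2 hpq
    have hp0 := hp.1
    have hq0 := hq.1
    have hqk : |q - k| ≤ p := by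
      rw [abs_le] at h1 ⊢
      constructor <;> linarith [h1.1]
    have hJ : bogJ f ν k p q ^ 2 ≤ C ^ 2 / (8 * w ^ 3 * k) * (p / q) := by
      rw [hP.bogJ_sq hν hk hp hq]
      have hn : vertexNum f ν k p q ^ 2 ≤ (C * p) ^ 2 := by
        rw [← sq_abs]; exact pow_le_pow_left₀ (abs_nonneg _) (hC p hp q hq hqk) 2
      have hd : (w * k) * (w * p) * (w * q) ≤ bogW f ν k * bogW f ν p * bogW f ν q := by
        have := hP.bogW_ge_linear hν hk0.le
        have := hP.bogW_ge_linear hν hp0.le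
        have := hP.bogW_ge_linear hν hq0.le
        have := bogW_nonneg f ν k
        have := bogW_nonneg f ν p
        gcongr
      calc vertexNum f ν k p q ^ 2 / (8 * (bogW f ν k * bogW f ν p * bogW f ν q))
          ≤ (C * p) ^ 2 / (8 * ((w * k) * (w * p) * (w * q))) := by gcongr
        _ = _ := by field_simp
    have hth := hthermal p hp q hq
    have hq2 : k / 2 ≤ q := by linarith
    have hth0 := thermal_nonneg hβ (bogW_nonneg f ν k) (bogW_nonneg f ν p) (bogW_nonneg f ν q)
    unfold bogDensity
    calc 1 / (2 * Real.pi) ^ 3 * (ν * v₀ * bogJ f ν k p q ^ 2) *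
          thermal β (bogW f ν k) (bogW f ν p) (bogW f ν q)
        ≤ 1 / (2 * Real.pi) ^ 3 * (ν * v₀ * (C ^ 2 / (8 * w ^ 3 * k) * (p / q))) *
          (T / k * (T / p) * (T / q)) := by gcongr
      _ = 1 / (2 * Real.pi) ^ 3 * (ν * v₀ * (C ^ 2 / (8 * w ^ 3 * k))) *
          (T ^ 3 / (k * q ^ 2)) := by field_simp
      _ ≤ 1 / (2 * Real.pi) ^ 3 * (ν * v₀ * (C ^ 2 / (8 * w ^ 3 * k))) *
          (T ^ 3 / (k * (k / 2) ^ 2)) := by gcongr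
      _ = _ := by field_simp; ring
  refine ⟨1 / (2 * Real.pi) ^ 3 * (ν * v₀ * (C ^ 2 / (8 * w ^ 3 * k))) * (T ^ 3 * 4 / k ^ 3),
    fun p hp q hq h1 h2 => ?_⟩
  rcases le_total p q with hpq | hpq
  · exact key p hp q hq h1 h2 hpq
  · have hsymm : bogDensity f ν β v₀ k p q = bogDensity f ν β v₀ k q p := by
      have hJ : bogJ f ν k p q = bogJ f ν k q p := by unfold bogJ; ring
      rw [bogDensity, bogDensity, hJ, thermal, thermal, add_right_comm, mul_right_comm (_ - 1)]
    rw [hsymm]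
    exact key q hq p hp (by rwa [abs_sub_comm]) (by linarith) hpq

/-- Away from zero momentum all factors are bounded separately. -/
theorem exists_bogDensity_le_far {β v₀ r₁ : ℝ} (hβ : 0 < β) (hv : 0 < v₀) (hr₁ : 0 < r₁) :
    ∃ M, ∀ k p q, r₁ ≤ k → r₁ ≤ p → r₁ ≤ q → bogDensity f ν β v₀ k p q ≤ M := by
  have hν0 := hν.1
  have hc := hP.c_pos
  have hB := hP.B_pos
  have hpi := Real.pi_pos
  set w := Real.sqrt (ν * c) * r₁ with hw
  have hw0 : 0 < w := mul_pos (Real.sqrt_pos.2 (mul_pos hν0 hc)) hr₁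
  set A := Real.sqrt (1 + ν * B / (2 * w)) with hA
  have hWge : ∀ {x}, r₁ ≤ x → w ≤ bogW f ν x := fun {x} hx => by
    refine le_trans ?_ (hP.bogW_ge_linear hν (hr₁.le.trans hx))
    rw [hw]; gcongr
  have hS0 : ∀ x, 0 ≤ bogS f ν x := fun x => by unfold bogS; positivity
  have hSC : ∀ x, bogS f ν x ≤ bogC f ν x := fun x => by
    unfold bogS bogC
    have := bogW_nonneg f ν x
    gcongr
    linarith
  have hCA : ∀ {x}, r₁ ≤ x → bogC f ν x ≤ A := fun {x} hx => by
    have h1 := hWge hx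
    have hW0 : 0 < bogW f ν x := hw0.trans_le h1
    rw [bogC, ← Real.sqrt_div' _ (by positivity)]
    refine Real.sqrt_le_sqrt ?_
    have h2 : Real.sqrt (bogW f ν x ^ 2 + ν ^ 2 * f x ^ 2) ≤ bogW f ν x + ν * B := by
      refine Real.sqrt_le_iff.2 ⟨by positivity, ?_⟩
      have h3 : f x ^ 2 ≤ B ^ 2 := by
        rw [← sq_abs]; exact pow_le_pow_left₀ (abs_nonneg _) (hP.bound x) 2
      have h4 : ν ^ 2 * f x ^ 2 ≤ ν ^ 2 * B ^ 2 := by gcongr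
      have h5 : 0 ≤ 2 * bogW f ν x * (ν * B) := by positivity
      nlinarith
    calc (Real.sqrt (bogW f ν x ^ 2 + ν ^ 2 * f x ^ 2) + bogW f ν x) / (2 * bogW f ν x)
        ≤ (bogW f ν x + ν * B + bogW f ν x) / (2 * bogW f ν x) := by gcongr
      _ = 1 + ν * B / (2 * bogW f ν x) := by field_simp; ring
      _ ≤ 1 + ν * B / (2 * w) := by gcongr
  have hA0 : 0 ≤ A := Real.sqrt_nonneg _
  have hT : ∀ {x}, r₁ ≤ x → 1 + 1 / (β * bogW f ν x) ≤ 1 + 1 / (β * w) := fun {x} hx => by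
    have := hWge hx
    gcongr
  refine ⟨1 / (2 * Real.pi) ^ 3 * (ν * v₀ * (3 * (B * A * (A * A + A * A))) ^ 2) *
    ((1 + 1 / (β * w)) * (1 + 1 / (β * w)) * (1 + 1 / (β * w))), fun k p q hk hp hq => ?_⟩
  have hterm : ∀ x g d : ℝ, |d| ≤ A → |g| ≤ A * A + A * A →
      |f x * d * g| ≤ B * A * (A * A + A * A) := by
    intro x g d hd hg
    rw [abs_mul, abs_mul]
    have := hP.bound x
    gcongr
  have hcross : ∀ {a b a' b' : ℝ}, 0 ≤ a → 0 ≤ b → 0 ≤ a' → 0 ≤ b' → a ≤ A → b ≤ A → a' ≤ A →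
      b' ≤ A → |a * b + a' * b'| ≤ A * A + A * A := by
    intro a b a' b' h1 h2 h3 h4 h5 h6 h7 h8
    rw [abs_of_nonneg (by positivity)]
    gcongr
  have hC0 : ∀ x, 0 ≤ bogC f ν x := fun x => (hS0 x).trans (hSC x)
  have hd : ∀ {x}, r₁ ≤ x → |bogC f ν x - bogS f ν x| ≤ A := fun {x} hx => by
    rw [abs_of_nonneg (sub_nonneg.2 (hSC x))]
    linarith [hS0 x, hCA hx]
  have hSA : ∀ {x}, r₁ ≤ x → bogS f ν x ≤ A := fun hx => (hSC _).trans (hCA hx)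
  have hJ : |bogJ f ν k p q| ≤ 3 * (B * A * (A * A + A * A)) := by
    unfold bogJ
    refine (abs_add_three _ _ _).trans ?_
    have t1 := hterm k (bogC f ν p * bogS f ν q + bogC f ν q * bogS f ν p)
      (bogS f ν k - bogC f ν k) (by rw [abs_sub_comm]; exact hd hk)
      (hcross (hC0 _) (hS0 _) (hC0 _) (hS0 _) (hCA hp) (hSA hq) (hCA hq) (hSA hp))
    have t2 := hterm p (bogC f ν k * bogC f ν q + bogS f ν k * bogS f ν q)
      (bogC f ν p - bogS f ν p) (hd hp)
      (hcross (hC0 _) (hC0 _) (hS0 _) (hS0 _) (hCA hk) (hCA hq) (hSA hk) (hSA hq))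
    have t3 := hterm q (bogC f ν p * bogC f ν k + bogS f ν p * bogS f ν k)
      (bogC f ν q - bogS f ν q) (hd hq)
      (hcross (hC0 _) (hC0 _) (hS0 _) (hS0 _) (hCA hp) (hCA hk) (hSA hp) (hSA hk))
    linarith
  have hJ2 : bogJ f ν k p q ^ 2 ≤ (3 * (B * A * (A * A + A * A))) ^ 2 := by
    rw [← sq_abs]; exact pow_le_pow_left₀ (abs_nonneg _) hJ 2
  have hth0 := thermal_nonneg hβ (bogW_nonneg f ν k) (bogW_nonneg f ν p) (bogW_nonneg f ν q)
  have hth := thermal_le hβ (hw0.trans_le (hWge hk)) (hw0.trans_le (hWge hp))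
    (hw0.trans_le (hWge hq))
  have hth2 : thermal β (bogW f ν k) (bogW f ν p) (bogW f ν q)
      ≤ (1 + 1 / (β * w)) * (1 + 1 / (β * w)) * (1 + 1 / (β * w)) := by
    refine hth.trans ?_
    have := hT hk
    have := hT hp
    have := hT hq
    have := bogW_nonneg f ν k
    have := bogW_nonneg f ν p
    have := bogW_nonneg f ν q
    gcongr
  unfold bogDensity
  gcongr

/-- The density is bounded in the whole momentum space. -/
theorem exists_bogDensity_le {β v₀ : ℝ} (hβ : 0 < β) (hv : 0 < v₀) {k : R3} (hk0 : k ≠ 0)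
    (hk : ‖k‖ < R / 2) :
    ∃ M, 0 ≤ M ∧ ∀ p q : ℝ, 0 ≤ p → 0 ≤ q → |p - q| ≤ ‖k‖ → ‖k‖ ≤ p + q →
      bogDensity f ν β v₀ ‖k‖ p q ≤ M := by
  have hK : 0 < ‖k‖ := norm_pos_iff.2 hk0
  have hR := hP.R_pos
  obtain ⟨M₁, h1⟩ := hP.exists_bogDensity_le_near hν hβ hv (k := ‖k‖) ⟨hK, by linarith⟩
  obtain ⟨M₂, h2⟩ := hP.exists_bogDensity_le_far hν (r₁ := min ‖k‖ (R / 2 - ‖k‖)) hβ hv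
    (lt_min hK (by linarith))
  refine ⟨max 0 (max M₁ M₂), le_max_left _ _, fun p q hp hq hpq hkpq => ?_⟩
  have hW0 : bogW f ν 0 = 0 := by simp [bogW]
  -- at zero momentum the density is a quotient by zero, hence vanishes by convention
  rcases hp.eq_or_lt with h | hp0
  · rw [← h, bogDensity, thermal, hW0]; simp
  rcases hq.eq_or_lt with h | hq0
  · rw [← h, bogDensity, thermal, hW0]; simp
  have habs := abs_le.1 hpq
  by_cases hpR : p < R / 2
  · refine (h1 p ⟨hp0, by linarith⟩ q ⟨hq0, by linarith [habs.1]⟩ hpq hkpq).trans ?_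
    exact (le_max_left _ _).trans (le_max_right _ _)
  · refine (h2 ‖k‖ p q (min_le_left _ _) ?_ ?_).trans ((le_max_right _ _).trans (le_max_right _ _))
    · exact (min_le_right _ _).trans (by linarith)
    · exact (min_le_right _ _).trans (by linarith [habs.2])

theorem continuousAt_bogDensity {β v₀ k p q : ℝ} (hβ : 0 < β) (hk : 0 < k) (hp : 0 < p)
    (hq : 0 < q) : ContinuousAt (bogDensity f ν β v₀ k p) q := by
  have hf : ContinuousAt f q := hP.cont.continuousAt
  have hW : ContinuousAt (bogW f ν) q := (continuous_bogW hP.cont ν).continuousAt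
  have hW0 := hP.bogW_pos hν hq
  have h2 : Real.sqrt (2 * bogW f ν q) ≠ 0 := (Real.sqrt_pos.2 (by linarith)).ne'
  have hC : ContinuousAt (bogC f ν) q := by
    unfold bogC
    exact ContinuousAt.div (by fun_prop) (by fun_prop) h2
  have hS : ContinuousAt (bogS f ν) q := by
    unfold bogS
    exact ContinuousAt.div (by fun_prop) (by fun_prop) h2
  have hne : ∀ {x}, 0 < x → Real.exp (β * bogW f ν x) - 1 ≠ 0 := fun {x} hx => by
    have := hP.bogW_pos hν hx
    have := Real.add_one_lt_exp (mul_pos hβ this).ne'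
    have := mul_pos hβ (hP.bogW_pos hν hx)
    linarith
  have hT : ContinuousAt (fun q => thermal β (bogW f ν k) (bogW f ν p) (bogW f ν q)) q := by
    unfold thermal
    exact ContinuousAt.div (by fun_prop) (by fun_prop)
      (mul_ne_zero (mul_ne_zero (hne hk) (hne hp)) (hne hq))
  unfold bogDensity bogJ
  fun_prop

end IsProfile

/-! ### Existence of the damping rate -/

theorem integrable_one_add_norm_pow_four :
    Integrable fun p : R3 => ((1 + ‖p‖) ^ 4)⁻¹ := by
  have h := integrable_one_add_norm (E := R3) (μ := volume) (r := 4) (by simp; norm_num)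
  refine h.congr (Eventually.of_forall fun p => ?_)
  simp only
  rw [Real.rpow_neg (by positivity)]
  norm_cast

namespace IsProfile

variable {f : ℝ → ℝ} {V R L B c ν : ℝ} (hP : IsProfile f V R L B c) (hν : ν ∈ Set.Ioc 0 V)
include hP hν

/-- Energy conservation fails by an amount growing quadratically in the outgoing momentum, unless that
momentum is small. -/
theorem exists_phase_lower_bound {K : ℝ} (hsmall : bogW f ν K ≤ Real.sqrt (ν * c) * (R / 4)) :
    ∃ a > 0, ∀ r s : ℝ, R / 2 ≤ r → a * (1 + r) ^ 2 ≤ |bogW f ν K - bogW f ν r - bogW f ν s| := by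
  have hR := hP.R_pos
  set w := Real.sqrt (ν * c) with hw
  have hw0 : 0 < w := Real.sqrt_pos.2 (mul_pos hν.1 hP.c_pos)
  refine ⟨w / 2 * (R / (2 + R)) * (1 / 2), by positivity, fun r s hr => ?_⟩
  have hr0 : 0 < r := by linarith
  have h1 := hP.bogW_ge hν hr0.le
  have h2 := bogW_nonneg f ν s
  have h3 : (1 + r) / 2 ≤ Real.sqrt (1 + r ^ 2) :=
    Real.le_sqrt_of_sq_le (by nlinarith [sq_nonneg (1 - r)])
  have h4 : 1 ≤ Real.sqrt (1 + r ^ 2) := Real.one_le_sqrt.2 (by nlinarith [sq_nonneg r])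
  have h5 : R / (2 + R) * (1 + r) ≤ r := by
    rw [div_mul_eq_mul_div, div_le_iff₀ (by positivity)]
    nlinarith
  have h6 : bogW f ν K ≤ w / 2 * (r * Real.sqrt (1 + r ^ 2)) := by
    refine hsmall.trans ?_
    have : R / 2 ≤ r * Real.sqrt (1 + r ^ 2) := by nlinarith
    nlinarith
  have h7 : R / (2 + R) * (1 + r) * ((1 + r) / 2) ≤ r * Real.sqrt (1 + r ^ 2) := by
    gcongr
  rw [abs_sub_comm, abs_of_nonneg (by nlinarith [h1, h2, h6, mul_pos hw0 hr0])]
  · calc w / 2 * (R / (2 + R)) * (1 / 2) * (1 + r) ^ 2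
        = w / 2 * (R / (2 + R) * (1 + r) * ((1 + r) / 2)) := by ring
      _ ≤ w / 2 * (r * Real.sqrt (1 + r ^ 2)) := by gcongr
      _ ≤ _ := by linarith

/-- The regularized integrals converge to the integral over the energy shell. -/
theorem tendsto_rate {β v₀ : ℝ} (hβ : 0 < β) (hv : 0 < v₀) {k : R3} (hk0 : k ≠ 0)
    (hk : ‖k‖ < R / 2) (hsmall : bogW f ν ‖k‖ ≤ Real.sqrt (ν * c) * (R / 4)) :
    (∀ ε > 0, Integrable fun p : R3 => bogDensity f ν β v₀ ‖k‖ ‖p‖ ‖p - k‖ *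
      lorentzian ε (bogW f ν ‖k‖ - bogW f ν ‖p‖ - bogW f ν ‖p - k‖)) ∧
    Tendsto (fun ε => ∫ p : R3, bogDensity f ν β v₀ ‖k‖ ‖p‖ ‖p - k‖ *
      lorentzian ε (bogW f ν ‖k‖ - bogW f ν ‖p‖ - bogW f ν ‖p - k‖)) (𝓝[>] 0)
      (𝓝 (∫ u in Set.Ioo 0 (bogW f ν ‖k‖),
        2 * Real.pi * momentumOf (bogW f ν) R u * momentumOf (bogW f ν) R (bogW f ν ‖k‖ - u) / ‖k‖
          * bogDensity f ν β v₀ ‖k‖ (momentumOf (bogW f ν) R u)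
            (momentumOf (bogW f ν) R (bogW f ν ‖k‖ - u)) /
        bogW' f ν (momentumOf (bogW f ν) R (bogW f ν ‖k‖ - u)) /
        bogW' f ν (momentumOf (bogW f ν) R u))) ∧
    IntegrableOn (fun u =>
        2 * Real.pi * momentumOf (bogW f ν) R u * momentumOf (bogW f ν) R (bogW f ν ‖k‖ - u) / ‖k‖
          * bogDensity f ν β v₀ ‖k‖ (momentumOf (bogW f ν) R u)
            (momentumOf (bogW f ν) R (bogW f ν ‖k‖ - u)) /
        bogW' f ν (momentumOf (bogW f ν) R (bogW f ν ‖k‖ - u)) /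
        bogW' f ν (momentumOf (bogW f ν) R u)) (Set.Ioo 0 (bogW f ν ‖k‖)) := by
  have hR := hP.R_pos
  have hpi := Real.pi_pos
  have hK : 0 < ‖k‖ := norm_pos_iff.2 hk0
  obtain ⟨M, hM0, hM⟩ := hP.exists_bogDensity_le hν hβ hv hk0 hk
  obtain ⟨a, ha, hphase⟩ := hP.exists_phase_lower_bound hν hsmall
  have hmd := measurable_bogDensity hP.cont ν β v₀ ‖k‖
  have hmW : Measurable (bogW f ν) := (continuous_bogW hP.cont ν).measurable
  have hdisp := hP.isDispersion hν
  set D : R3 → ℝ := fun p => bogDensity f ν β v₀ ‖k‖ ‖p‖ ‖p - k‖ with hD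
  set Φ : R3 → ℝ := fun p => bogW f ν ‖k‖ - bogW f ν ‖p‖ - bogW f ν ‖p - k‖ with hΦ
  have hDm : Measurable D := hmd.comp (f := fun p : R3 => (‖p‖, ‖p - k‖)) (by fun_prop)
  have hΦm : Measurable Φ := by fun_prop
  have hD0 : ∀ p, 0 ≤ D p := fun p => bogDensity_nonneg hν.1 hβ hv _ _ _
  have hDM : ∀ p, D p ≤ M := fun p => by
    refine hM _ _ (norm_nonneg _) (norm_nonneg _) ?_ ?_
    · simpa using abs_norm_sub_norm_le p (p - k)
    · simpa using norm_sub_le p (p - k)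
  have hDLm : ∀ ε, Measurable fun p => D p * lorentzian ε (Φ p) := fun ε => by
    have := measurable_lorentzian ε
    fun_prop
  set A : R3 → ℝ := fun p => ((1 + ‖p‖) ^ 4)⁻¹ with hA
  have hAi : Integrable A := integrable_one_add_norm_pow_four
  have hA0 : ∀ p, 0 ≤ A p := fun p => by simp only [hA]; positivity
  -- the contribution of large momenta
  have hfar : ∀ ε > 0, ∀ p, R / 2 ≤ ‖p‖ →
      D p * lorentzian ε (Φ p) ≤ ε * (M * (1 / Real.pi) / a ^ 2) * A p := by
    intro ε hε p hp
    have h1 := hphase ‖p‖ ‖p - k‖ hp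
    have h2 : a ^ 2 * (1 + ‖p‖) ^ 4 ≤ Φ p ^ 2 := by
      calc a ^ 2 * (1 + ‖p‖) ^ 4 = (a * (1 + ‖p‖) ^ 2) ^ 2 := by ring
        _ ≤ |Φ p| ^ 2 := by gcongr
        _ = Φ p ^ 2 := sq_abs _
    have h3 : lorentzian ε (Φ p) ≤ 1 / Real.pi * (ε / (a ^ 2 * (1 + ‖p‖) ^ 4)) := by
      unfold lorentzian
      have : a ^ 2 * (1 + ‖p‖) ^ 4 ≤ Φ p ^ 2 + ε ^ 2 := by nlinarith [sq_nonneg ε]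
      gcongr
    calc D p * lorentzian ε (Φ p) ≤ M * (1 / Real.pi * (ε / (a ^ 2 * (1 + ‖p‖) ^ 4))) := by
          have := lorentzian_nonneg hε (Φ p)
          have := hDM p
          gcongr
      _ = _ := by simp only [hA]; field_simp
  have hint : ∀ ε > 0, Integrable fun p => D p * lorentzian ε (Φ p) := by
    intro ε hε
    refine Integrable.mono' (g := fun p => (ε * (M * (1 / Real.pi) / a ^ 2)
      + M * (1 / Real.pi * (1 / ε)) * (1 + R) ^ 4) * A p) (hAi.const_mul _)
      (hDLm ε).aestronglyMeasurable (Eventually.of_forall fun p => ?_)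
    have hl := lorentzian_nonneg hε (Φ p)
    rw [Real.norm_of_nonneg (mul_nonneg (hD0 p) hl), add_mul]
    rcases le_or_gt (R / 2) ‖p‖ with hp | hp
    · refine (hfar ε hε p hp).trans (le_add_of_nonneg_right ?_)
      have := hA0 p
      positivity
    · refine le_add_of_nonneg_of_le (by have := hA0 p; positivity) ?_
      have h1 : 1 ≤ (1 + R) ^ 4 * A p := by
        simp only [hA]
        rw [← div_eq_mul_inv, le_div_iff₀ (by positivity), one_mul]
        gcongr
        linarith
      calc D p * lorentzian ε (Φ p) ≤ M * (1 / Real.pi * (1 / ε)) := by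
            have := hDM p
            have := lorentzian_le hε (Φ p)
            gcongr
        _ ≤ M * (1 / Real.pi * (1 / ε)) * ((1 + R) ^ 4 * A p) :=
            le_mul_of_one_le_right (by positivity) h1
        _ = _ := by ring
  set S : Set R3 := {p : R3 | ‖p‖ < R / 2} with hS
  have hSm : MeasurableSet S := measurableSet_lt (by fun_prop) (by fun_prop)
  have hcompl : Tendsto (fun ε => ∫ p in Sᶜ, D p * lorentzian ε (Φ p)) (𝓝[>] 0) (𝓝 0) := by
    have hup : Tendsto (fun ε : ℝ => ε * (M * (1 / Real.pi) / a ^ 2) * ∫ p in Sᶜ, A p) (𝓝[>] 0)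
        (𝓝 0) := by
      have : Continuous fun ε : ℝ => ε * (M * (1 / Real.pi) / a ^ 2) * ∫ p in Sᶜ, A p := by
        fun_prop
      simpa using (this.tendsto 0).mono_left nhdsWithin_le_nhds
    refine squeeze_zero' ?_ ?_ hup
    · filter_upwards [self_mem_nhdsWithin] with ε hε
      exact integral_nonneg fun p => mul_nonneg (hD0 p) (lorentzian_nonneg hε _)
    · filter_upwards [self_mem_nhdsWithin] with ε hε
      rw [← integral_const_mul]
      refine setIntegral_mono_on (hint ε hε).integrableOn (hAi.const_mul _).integrableOn
        hSm.compl fun p hp => ?_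
      exact hfar ε hε p (not_lt.1 hp)
  -- the contribution of small momenta, in bipolar coordinates
  set h : ℝ → ℝ → ℝ := fun r s => 2 * Real.pi * r * s / ‖k‖ * bogDensity f ν β v₀ ‖k‖ r s with hh
  have hhm : Measurable (Function.uncurry h) := by
    simp only [hh, Function.uncurry_def]
    fun_prop
  have hhM : ∀ r ∈ Set.Ioo 0 (R / 2), ∀ s ∈ Set.Ioo |r - ‖k‖| (r + ‖k‖),
      |h r s| ≤ 2 * Real.pi * R * R / ‖k‖ * M := by
    intro r hr s hs
    have hr0 := hr.1
    have hs0 : 0 < s := (abs_nonneg _).trans_lt hs.1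
    have h1 := abs_lt.1 hs.1
    have hd := hM r s hr0.le hs0.le (abs_le.2 ⟨by linarith [hs.2], by linarith⟩)
      (by linarith)
    have hd0 := bogDensity_nonneg (f := f) hν.1 hβ hv ‖k‖ r s
    have hrR : r ≤ R := by linarith [hr.2]
    have hsR : s ≤ R := by linarith [hs.2, hr.2]
    have hnn : 0 ≤ h r s := by simp only [hh]; positivity
    rw [abs_of_nonneg hnn]
    simp only [hh]
    gcongr
  obtain ⟨hlim, hshell⟩ := hdisp.tendsto_shell (K := ‖k‖) (R₀ := R / 2) hK hk (by linarith) hhm hmW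
    (by positivity) hhM (fun r hr s hs => by
      have := hP.continuousAt_bogDensity hν (v₀ := v₀) hβ hK hr.1 hs.1
      simp only [hh]
      fun_prop)
  refine ⟨hint, ?_, hshell⟩
  have hball : ∀ ε > 0, ∫ p in S, D p * lorentzian ε (Φ p)
      = ∫ r in Set.Ioo 0 (R / 2), ∫ s in Set.Ioo |r - ‖k‖| (r + ‖k‖),
        h r s * lorentzian ε (bogW f ν ‖k‖ - bogW f ν r - bogW f ν s) := by
    intro ε hε
    have hle : ∀ x, |lorentzian ε x| ≤ 1 / Real.pi * (1 / ε) := fun x => by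
      rw [abs_of_nonneg (lorentzian_nonneg hε x)]; exact lorentzian_le hε x
    have hgm : Measurable (Function.uncurry fun r s => bogDensity f ν β v₀ ‖k‖ r s *
        lorentzian ε (bogW f ν ‖k‖ - bogW f ν r - bogW f ν s)) := by
      have := measurable_lorentzian ε
      simp only [Function.uncurry_def]
      fun_prop
    have := integral_ball_bipolar hk0 (R := R / 2) (g := fun r s => bogDensity f ν β v₀ ‖k‖ r s *
        lorentzian ε (bogW f ν ‖k‖ - bogW f ν r - bogW f ν s)) hgm
      (fun r s => mul_nonneg (bogDensity_nonneg hν.1 hβ hv _ _ _) (lorentzian_nonneg hε _))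
      (fun r hr => by
        refine IntegrableOn.of_bound
          (C := 2 * Real.pi * R * R / ‖k‖ * M * (1 / Real.pi * (1 / ε))) (by simp)
          (Measurable.aestronglyMeasurable ?_) ?_
        · have h1 : Measurable fun s => bogDensity f ν β v₀ ‖k‖ r s *
              lorentzian ε (bogW f ν ‖k‖ - bogW f ν r - bogW f ν s) :=
            hgm.comp (f := fun s : ℝ => (r, s)) (by fun_prop)
          fun_prop
        · refine (ae_restrict_iff' measurableSet_Ioo).2 (Eventually.of_forall fun s hs => ?_)
          have h1 := hhM r hr s hs
          have h2 := hle (bogW f ν ‖k‖ - bogW f ν r - bogW f ν s)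
          rw [← mul_assoc, norm_mul, Real.norm_eq_abs, Real.norm_eq_abs]
          exact mul_le_mul h1 h2 (abs_nonneg _) (by positivity))
    rw [this]
    simp only [hh, mul_assoc]
  have hsum := (hlim.congr' (by
    filter_upwards [self_mem_nhdsWithin] with ε hε using (hball ε hε).symm)).add hcompl
  rw [add_zero] at hsum
  refine hsum.congr' ?_
  filter_upwards [self_mem_nhdsWithin] with ε hε
  exact integral_add_compl hSm (hint ε hε)

end IsProfile

/-! ### The density on the energy shell at small momenta -/

/-- `x` is `1` up to a relative error `a τ`. -/
def NearOne (a τ x : ℝ) : Prop := |x - 1| ≤ a * τ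

theorem NearOne.mul {a b τ x y : ℝ} (hτ : 0 ≤ τ) (hτ1 : τ ≤ 1) (ha : 0 ≤ a) (hb : 0 ≤ b)
    (hx : NearOne a τ x) (hy : NearOne b τ y) : NearOne (a + b + a * b) τ (x * y) := by
  unfold NearOne at *
  have e : x * y - 1 = (x - 1) + (y - 1) + (x - 1) * (y - 1) := by ring
  have h : |x - 1| * |y - 1| ≤ (a * τ) * (b * τ) := by gcongr
  have h2 : (a * τ) * (b * τ) ≤ a * b * τ := by
    have : a * b * τ * τ ≤ a * b * τ * 1 := by gcongr
    linarith
  rw [e]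
  refine (abs_add_three _ _ _).trans ?_
  rw [abs_mul]
  linarith

theorem NearOne.inv {a τ x : ℝ} (h : a * τ ≤ 1 / 2) (hx : NearOne a τ x) :
    NearOne (2 * a) τ x⁻¹ := by
  unfold NearOne at *
  have h1 := abs_le.1 hx
  have hx0 : 1 / 2 ≤ x := by linarith [h1.1]
  have hxp : 0 < x := by linarith
  have e : x⁻¹ - 1 = -(x - 1) / x := by field_simp; ring
  rw [e, abs_div, abs_neg, abs_of_pos hxp, div_le_iff₀ hxp]
  have := abs_nonneg (x - 1)
  nlinarith

theorem NearOne.sqrt {a τ x : ℝ} (h0 : 0 ≤ x) (hx : NearOne a τ x) :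
    NearOne a τ (Real.sqrt x) := by
  unfold NearOne at *
  refine le_trans ?_ hx
  have e : x - 1 = (Real.sqrt x - 1) * (Real.sqrt x + 1) := by
    have := Real.sq_sqrt h0
    linarith
  have h1 := Real.sqrt_nonneg x
  rw [e, abs_mul, abs_of_nonneg (show 0 ≤ Real.sqrt x + 1 by linarith)]
  have := abs_nonneg (Real.sqrt x - 1)
  nlinarith

/-- Write `ν f = y² - x² / 4` with `y = ω(x) / x`. The contributions of `y²` to the vertex numerator
add up to `yk yp yq (p yp + q yq - k yk) / ν`, which is zero by energy conservation. What remains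
is expressed by increments of `x² / y²`, small enough to compensate the denominator `k p q`. -/
theorem vertex_bracket_on_shell {ν k p q yk yp yq fk fp fq : ℝ} (hν : 0 < ν) (hp : 0 < p)
    (hq : 0 < q) (hyk : 0 < yk) (hyp : 0 < yp) (hyq : 0 < yq)
    (hfk : ν * fk = yk ^ 2 - k ^ 2 / 4) (hfp : ν * fp = yp ^ 2 - p ^ 2 / 4)
    (hfq : ν * fq = yq ^ 2 - q ^ 2 / 4) (hs : k * yk = p * yp + q * yq) :
    4 * (fp * p * (yk * yq) + fq * q * (yp * yk) - fk * k * (yp * yq)) / (k * p * q)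
      = yk * yp * yq / (ν * (k * p * q)) *
        (p * yp * (k ^ 2 / yk ^ 2 - p ^ 2 / yp ^ 2)
          + q * yq * (k ^ 2 / yk ^ 2 - q ^ 2 / yq ^ 2)) := by
  have e1 : fk = (yk ^ 2 - k ^ 2 / 4) / ν := by rw [← hfk]; field_simp
  have e2 : fp = (yp ^ 2 - p ^ 2 / 4) / ν := by rw [← hfp]; field_simp
  have e3 : fq = (yq ^ 2 - q ^ 2 / 4) / ν := by rw [← hfq]; field_simp
  have ek : k = (p * yp + q * yq) / yk := by rw [← hs]; field_simp
  have hne : p * yp + q * yq ≠ 0 := by positivity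
  subst e1 e2 e3 ek
  field_simp
  ring

/-- With `X = k²`, `Y = p²` and `mk`, `mp` the values of `m`: the functions `x² / m(x)` and `x² m(x)`
have the same increments, up to a small relative error, when `m` is close to `1` and Lipschitz in `x²`. -/
theorem increment_comparison {X Y mk mp ν Λ τ : ℝ} (hν : 0 < ν) (hY : 0 ≤ Y)
    (hYX : Y ≤ X) (hτ : τ = Λ * (X / ν)) (hτ4 : τ ≤ 1 / 4) (hmk : |mk - 1| ≤ τ)
    (hmp : |mp - 1| ≤ τ) (hlip : |mk - mp| ≤ Λ * (X - Y) / ν) :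
    |(X / mk - Y / mp) - (X * mk - Y * mp)| ≤ 12 * τ * (X * mk - Y * mp) := by
  have h1 := abs_le.1 hmk
  have h2 := abs_le.1 hmp
  have hk0 : 3 / 4 ≤ mk := by linarith [h1.1]
  have hp0 : 3 / 4 ≤ mp := by linarith [h2.1]
  have hD : 0 ≤ X - Y := by linarith
  have hτ0 : 0 ≤ τ := (abs_nonneg _).trans hmk
  have hX : 0 ≤ X := hY.trans hYX
  have hYl : Y * |mk - mp| ≤ τ * (X - Y) := by
    calc Y * |mk - mp| ≤ X * (Λ * (X - Y) / ν) := by gcongr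
      _ = τ * (X - Y) := by rw [hτ]; field_simp
  have ik : 1 / mk ≤ 4 / 3 := by rw [div_le_iff₀ (by linarith)]; linarith
  have ip : 1 / mp ≤ 4 / 3 := by rw [div_le_iff₀ (by linarith)]; linarith
  have ik0 : 0 < 1 / mk := by have : 0 < mk := by linarith
                              positivity
  have ip0 : 0 < 1 / mp := by have : 0 < mp := by linarith
                              positivity
  have e : (X / mk - Y / mp) - (X * mk - Y * mp)
      = (X - Y) * ((1 - mk) * (1 + 1 / mk)) + -(Y * (mk - mp)) * (1 + 1 / mk * (1 / mp)) := by
    have : mk ≠ 0 := by linarith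
    have : mp ≠ 0 := by linarith
    field_simp
    ring
  have hlow : (X - Y) / 2 ≤ X * mk - Y * mp := by
    have e2 : X * mk - Y * mp = (X - Y) * mk + Y * (mk - mp) := by ring
    have h3 : -(τ * (X - Y)) ≤ Y * (mk - mp) := by
      have : -(Y * |mk - mp|) ≤ Y * (mk - mp) := by
        nlinarith [neg_abs_le (mk - mp)]
      linarith
    rw [e2]
    nlinarith
  have hfirst : |(X - Y) * ((1 - mk) * (1 + 1 / mk))| ≤ (X - Y) * (τ * 3) := by
    rw [abs_mul, abs_mul, abs_of_nonneg hD, abs_sub_comm,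
      abs_of_pos (show 0 < 1 + 1 / mk by linarith)]
    gcongr
    linarith
  have hsecond : |-(Y * (mk - mp)) * (1 + 1 / mk * (1 / mp))| ≤ τ * (X - Y) * 3 := by
    have h5 : 1 / mk * (1 / mp) ≤ 4 / 3 * (4 / 3) := by gcongr
    rw [abs_mul, abs_neg, abs_mul, abs_of_nonneg hY,
      abs_of_pos (show 0 < 1 + 1 / mk * (1 / mp) by positivity)]
    gcongr
    linarith
  rw [e]
  refine (abs_add_le _ _).trans ?_
  nlinarith

namespace IsProfile

variable {f : ℝ → ℝ} {V R L B c ν : ℝ} (hP : IsProfile f V R L B c) (hν : ν ∈ Set.Ioc 0 V)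
include hP hν

theorem abs_velSq_sub_one_le {x : ℝ} (hx : x ∈ Set.Ico 0 R) :
    |velSq f ν x - 1| ≤ (L * V + 1) * (x ^ 2 / ν) := by
  have hν0 := hν.1
  have hL := hP.L_pos
  have h := hP.abs_velSq_sub_le hν (y := 0) hx ⟨le_rfl, hP.R_pos⟩
  have h0 : velSq f ν 0 = 1 := by simp [velSq, hP.zero]
  have e : (L + 1 / (4 * ν)) * x ^ 2 = (L * ν + 1 / 4) * (x ^ 2 / ν) := by field_simp
  rw [h0] at h
  simp only [ne_eq, OfNat.ofNat_ne_zero, not_false_eq_true, zero_pow, sub_zero,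
    abs_of_nonneg (sq_nonneg x)] at h
  rw [e] at h
  refine h.trans (mul_le_mul_of_nonneg_right ?_ (by positivity))
  have : L * ν ≤ L * V := mul_le_mul_of_nonneg_left hν.2 hL.le
  linarith

/-- At small momenta, on the energy shell, the density is `9 v̂(0) / (32 π² ν^{7/2}) (u w)²` times
the thermal factor, with a relative error of order `k² / ν` uniform in the position on the shell;
`u` and `w` are the two outgoing energies. -/
theorem shell_density_estimate {β v₀ k p q : ℝ} (hk : k ∈ Set.Ioo 0 R) (hp : p ∈ Set.Ioo 0 k)
    (hq : q ∈ Set.Ioo 0 k) (hs : bogW f ν k = bogW f ν p + bogW f ν q)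
    (hsmall : (L * V + 1) * (k ^ 2 / ν) ≤ 1 / 4000) :
    ∃ X, NearOne 7000000 ((L * V + 1) * (k ^ 2 / ν)) X ∧
      2 * Real.pi * p * q / k * bogDensity f ν β v₀ k p q / bogW' f ν q / bogW' f ν p
        = 9 * v₀ / (32 * Real.pi ^ 2 * (ν ^ 3 * Real.sqrt ν)) *
          ((bogW f ν p * bogW f ν q) ^ 2 * thermal β (bogW f ν k) (bogW f ν p) (bogW f ν q)) * X := by
  have hν0 := hν.1
  have hL := hP.L_pos
  have hpi := Real.pi_pos
  have hV := hP.V_pos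
  set τ := (L * V + 1) * (k ^ 2 / ν) with hτ
  have hk0 := hk.1
  have hp0 := hp.1
  have hq0 := hq.1
  have hτ0 : 0 ≤ τ := by positivity
  have hτ1 : τ ≤ 1 := by linarith
  have hpR : p ∈ Set.Ioo 0 R := ⟨hp.1, hp.2.trans hk.2⟩
  have hqR : q ∈ Set.Ioo 0 R := ⟨hq.1, hq.2.trans hk.2⟩
  have hLν : L * ν ≤ L * V := by
    have := hν.2
    gcongr
  -- the elementary factors `f`, `m`, `√m` and the group velocity are close to one
  have hτx : ∀ {x}, 0 < x → x ≤ k → ∀ {K : ℝ}, 0 ≤ K → K * ν ≤ L * V + 1 → K * x ^ 2 ≤ τ := by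
    intro x h0 h1 K hK hKν
    calc K * x ^ 2 ≤ K * k ^ 2 := by gcongr
      _ = K * ν * (k ^ 2 / ν) := by field_simp
      _ ≤ τ := by rw [hτ]; gcongr
  have hf1 : ∀ {x}, x ∈ Set.Ioo 0 R → x ≤ k → NearOne 1 τ (f x) := fun {x} hx hxk => by
    have h := hP.abs_sub_le (x := x) (y := 0) ⟨hx.1.le, hx.2⟩ ⟨le_rfl, hP.R_pos⟩
    rw [hP.zero] at h
    have h2 := hτx hx.1 hxk hL.le (by linarith)
    unfold NearOne
    simp only [ne_eq, OfNat.ofNat_ne_zero, not_false_eq_true, zero_pow, sub_zero,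
      abs_of_nonneg (sq_nonneg x)] at h
    linarith
  have hm1 : ∀ {x}, x ∈ Set.Ioo 0 R → x ≤ k → NearOne 1 τ (velSq f ν x) := fun {x} hx hxk => by
    have h := hP.abs_velSq_sub_one_le hν ⟨hx.1.le, hx.2⟩
    have hx0 := hx.1
    unfold NearOne
    rw [one_mul]
    refine h.trans ?_
    rw [hτ]
    gcongr
  have hμ1 : ∀ {x}, x ∈ Set.Ioo 0 R → x ≤ k → NearOne 1 τ (Real.sqrt (velSq f ν x)) :=
    fun {x} hx hxk => (hm1 hx hxk).sqrt (hP.velSq_pos hν x).le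
  set η : ℝ → ℝ := fun x => Real.sqrt (velSq f ν x)
    + x * (deriv f x + x / (2 * ν)) / (2 * Real.sqrt (velSq f ν x)) with hη
  have hη1 : ∀ {x}, x ∈ Set.Ioo 0 R → x ≤ k → NearOne 2 τ (η x) := fun {x} hx hxk => by
    have h1 := hμ1 hx hxk
    have hx0 := hx.1
    have h2 : |x * (deriv f x + x / (2 * ν))| ≤ τ := by
      have hd := hP.deriv_le x ⟨hx.1.le, hx.2⟩
      have h3 := hτx hx.1 hxk (K := L + 1 / (2 * ν)) (by positivity) (by
        have : (L + 1 / (2 * ν)) * ν = L * ν + 1 / 2 := by field_simp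
        linarith)
      refine le_trans ?_ h3
      rw [abs_mul, abs_of_pos hx0]
      have h4 : |deriv f x + x / (2 * ν)| ≤ L * x + x / (2 * ν) := by
        refine (abs_add_le _ _).trans (add_le_add hd ?_)
        rw [abs_of_pos (by positivity)]
      calc x * |deriv f x + x / (2 * ν)| ≤ x * (L * x + x / (2 * ν)) := by gcongr
        _ = _ := by ring
    unfold NearOne at *
    have h5 : 1 / 2 ≤ Real.sqrt (velSq f ν x) := by linarith [(abs_le.1 h1).1]
    have h6 : |x * (deriv f x + x / (2 * ν)) / (2 * Real.sqrt (velSq f ν x))| ≤ τ := by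
      rw [abs_div, abs_of_pos (show 0 < 2 * Real.sqrt (velSq f ν x) by linarith),
        div_le_iff₀ (by linarith)]
      nlinarith
    have e : η x - 1 = (Real.sqrt (velSq f ν x) - 1)
        + x * (deriv f x + x / (2 * ν)) / (2 * Real.sqrt (velSq f ν x)) := by
      simp only [hη]; ring
    rw [e]
    refine (abs_add_le _ _).trans ?_
    linarith
  -- the increments left over in the vertex, compared with those of `ω²`
  set W := bogW f ν with hW
  have hWp := hP.bogW_pos hν hp0
  have hWq := hP.bogW_pos hν hq0
  have hWk := hP.bogW_pos hν hk0
  have hincr : ∀ {x}, x ∈ Set.Ioo 0 R → x < k →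
      |ν * (k ^ 2 / velSq f ν k - x ^ 2 / velSq f ν x) - (W k ^ 2 - W x ^ 2)|
        ≤ 12 * τ * (W k ^ 2 - W x ^ 2) := by
    intro x hx hxk
    have hsq : x ^ 2 ≤ k ^ 2 := pow_le_pow_left₀ hx.1.le hxk.le 2
    have hl := hP.abs_velSq_sub_le hν (x := k) (y := x) ⟨hk0.le, hk.2⟩ ⟨hx.1.le, hx.2⟩
    rw [abs_of_nonneg (sub_nonneg.2 hsq)] at hl
    have h := increment_comparison (X := k ^ 2) (Y := x ^ 2) (mk := velSq f ν k)
      (mp := velSq f ν x) hν0 (Λ := L * V + 1) (τ := τ) (sq_nonneg x) hsq hτ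
      (by linarith) (by simpa [NearOne] using hm1 hk le_rfl) (by simpa [NearOne] using hm1 hx hxk.le)
      (by
        refine hl.trans ?_
        rw [mul_div_right_comm]
        refine mul_le_mul_of_nonneg_right ?_ (sub_nonneg.2 hsq)
        rw [le_div_iff₀ hν0]
        have : (L + 1 / (4 * ν)) * ν = L * ν + 1 / 4 := by field_simp
        linarith)
    rw [hP.bogW_sq hν, hP.bogW_sq hν, ← mul_sub, ← mul_sub, abs_mul, abs_of_pos hν0]
    calc ν * |_| ≤ ν * _ := mul_le_mul_of_nonneg_left h hν0.le
      _ = _ := by ring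
  set ζ := W p * (ν * (k ^ 2 / velSq f ν k - p ^ 2 / velSq f ν p))
    + W q * (ν * (k ^ 2 / velSq f ν k - q ^ 2 / velSq f ν q)) with hζ
  have hζ1 : NearOne 12 τ (ζ / (3 * (W k * W p * W q))) := by
    have hi1 := hincr hpR hp.2
    have hi2 := hincr hqR hq.2
    -- the exact value of the leading part, for `W k = W p + W q`
    have htot : W p * (W k ^ 2 - W p ^ 2) + W q * (W k ^ 2 - W q ^ 2) = 3 * (W k * W p * W q) := by
      rw [hs]; ring
    unfold NearOne
    have hpos : 0 < 3 * (W k * W p * W q) := by positivity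
    rw [div_sub_one hpos.ne', abs_div, abs_of_pos hpos, div_le_iff₀ hpos]
    have e : ζ - 3 * (W k * W p * W q)
        = W p * (ν * (k ^ 2 / velSq f ν k - p ^ 2 / velSq f ν p) - (W k ^ 2 - W p ^ 2))
        + W q * (ν * (k ^ 2 / velSq f ν k - q ^ 2 / velSq f ν q) - (W k ^ 2 - W q ^ 2)) := by
      rw [← htot, hζ]; ring
    rw [e]
    refine (abs_add_le _ _).trans ?_
    rw [abs_mul, abs_mul, abs_of_pos hWp, abs_of_pos hWq]
    calc W p * _ + W q * _ ≤ W p * (12 * τ * (W k ^ 2 - W p ^ 2))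
          + W q * (12 * τ * (W k ^ 2 - W q ^ 2)) := by gcongr
      _ = 12 * τ * (3 * (W k * W p * W q)) := by rw [← htot]; ring
  set S := f k + f p + f q
    + 3 * (velSq f ν k * velSq f ν p * velSq f ν q * (ζ / (3 * (W k * W p * W q)))) with hS
  -- `52 = (3 · 1 + 3 · 103) / 6`, where `103` is the error of the product of the four factors
  have hS1 : NearOne 52 τ (S / 6) := by
    have hM := (((hm1 hk le_rfl).mul hτ0 hτ1 zero_le_one zero_le_one (hm1 hpR hp.2.le)).mul hτ0 hτ1
      (by norm_num) zero_le_one (hm1 hqR hq.2.le)).mul hτ0 hτ1 (by norm_num) (by norm_num) hζ1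
    have h1 := hf1 hk le_rfl
    have h2 := hf1 hpR hp.2.le
    have h3 := hf1 hqR hq.2.le
    unfold NearOne at *
    have e : S / 6 - 1 = ((f k - 1) + (f p - 1) + (f q - 1) + 3 * (velSq f ν k * velSq f ν p
        * velSq f ν q * (ζ / (3 * (W k * W p * W q))) - 1)) / 6 := by
      rw [hS]; ring
    rw [e]
    rw [abs_le] at *
    constructor <;> linarith [h1.1, h1.2, h2.1, h2.2, h3.1, h3.2, hM.1, hM.2]
  -- the numerator of the vertex
  have hy : ∀ {x}, 0 < x → W x / x = Real.sqrt ν * Real.sqrt (velSq f ν x) :=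
    fun hx => bogW_div hν0 hx
  have hσ : 0 < Real.sqrt ν := Real.sqrt_pos.2 hν0
  have hσ2 : Real.sqrt ν ^ 2 = ν := Real.sq_sqrt hν0.le
  have hμ0 : ∀ x, 0 < Real.sqrt (velSq f ν x) := fun x => Real.sqrt_pos.2 (hP.velSq_pos hν x)
  have hμ2 : ∀ x, Real.sqrt (velSq f ν x) ^ 2 = velSq f ν x :=
    fun x => Real.sq_sqrt (hP.velSq_pos hν x).le
  have hyf : ∀ {x}, 0 < x → ν * f x = (W x / x) ^ 2 - x ^ 2 / 4 := fun {x} hx => by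
    rw [hy hx, mul_pow, hσ2, hμ2, velSq]; field_simp; ring
  have hbr := vertex_bracket_on_shell (k := k) hν0 hp0 hq0 (div_pos hWk hk0) (div_pos hWp hp0)
    (div_pos hWq hq0) (hyf hk0) (hyf hp0) (hyf hq0)
    (by
      have h1 : k * (W k / k) = W k := by field_simp
      have h2 : p * (W p / p) = W p := by field_simp
      have h3 : q * (W q / q) = W q := by field_simp
      rw [h1, h2, h3]; exact hs)
  have hnum : vertexNum f ν k p q = k * p * q / 2 * S := by
    have e1 : vertexNum f ν k p q = k * p * q / 2 * (f k + f p + f q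
        + 4 * (f p * p * (W k / k * (W q / q)) + f q * q * (W p / p * (W k / k))
          - f k * k * (W p / p * (W q / q))) / (k * p * q)) := by
      rw [vertexNum]; field_simp
      ring
    rw [e1, hbr, hS]
    congr 2
    have hz : ∀ {x}, 0 < x → x ^ 2 / (W x / x) ^ 2 = x ^ 2 / velSq f ν x / ν := fun {x} hx => by
      rw [hy hx, mul_pow, hσ2, hμ2]
      have := hP.velSq_pos hν x
      field_simp
    have hm : ∀ {x}, 0 < x → velSq f ν x = (W x / x) ^ 2 / ν := fun {x} hx => by
      rw [hy hx, mul_pow, hσ2, hμ2]; field_simp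
    rw [hz hk0, hz hp0, hz hq0, hζ]
    generalize k ^ 2 / velSq f ν k = zk
    generalize p ^ 2 / velSq f ν p = zp
    generalize q ^ 2 / velSq f ν q = zq
    rw [hm hk0, hm hp0, hm hq0]
    simp only [hW]
    field_simp
  refine ⟨S / 6 * (S / 6) * (Real.sqrt (velSq f ν k) *
    (Real.sqrt (velSq f ν p) * Real.sqrt (velSq f ν p) * Real.sqrt (velSq f ν p)) *
    (Real.sqrt (velSq f ν q) * Real.sqrt (velSq f ν q) * Real.sqrt (velSq f ν q)) *
    (η p * η q))⁻¹, ?_, ?_⟩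
  · have h3 : ∀ {x}, x ∈ Set.Ioo 0 R → x ≤ k → NearOne 7 τ
        (Real.sqrt (velSq f ν x) * Real.sqrt (velSq f ν x) * Real.sqrt (velSq f ν x)) := by
      intro x hx hxk
      have := ((hμ1 hx hxk).mul hτ0 hτ1 zero_le_one zero_le_one (hμ1 hx hxk)).mul hτ0 hτ1
        (by norm_num) zero_le_one (hμ1 hx hxk)
      norm_num at this
      exact this
    have hden := (((hμ1 hk le_rfl).mul hτ0 hτ1 (by norm_num) (by norm_num) (h3 hpR hp.2.le)).mul
      hτ0 hτ1 (by norm_num) (by norm_num) (h3 hqR hq.2.le)).mul hτ0 hτ1 (by norm_num) (by norm_num)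
      ((hη1 hpR hp.2.le).mul hτ0 hτ1 (by norm_num) (by norm_num) (hη1 hqR hq.2.le))
    -- the denominator has error `1151`, so `τ ≤ 1 / 4000` makes it invertible with error `2302`;
    -- multiplied with the square of `S / 6` this stays below `7000000`
    norm_num at hden
    have hinv := hden.inv (by linarith)
    have := (hS1.mul hτ0 hτ1 (by norm_num) (by norm_num) hS1).mul hτ0 hτ1 (by norm_num)
      (by norm_num) hinv
    unfold NearOne at *
    refine this.trans ?_
    gcongr
    norm_num
  · have hη0 : ∀ {x}, x ∈ Set.Ioo 0 R → x ≤ k → 0 < η x := fun {x} hx hxk => by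
      have := (abs_le.1 (hη1 hx hxk)).1
      linarith
    have hηp := hη0 hpR hp.2.le
    have hηq := hη0 hqR hq.2.le
    have hW' : ∀ x, bogW' f ν x = Real.sqrt ν * η x := fun x => rfl
    rw [bogDensity, hP.bogJ_sq hν hk hpR hqR, hnum, hW', hW']
    have hWe : ∀ {x}, 0 < x → bogW f ν x = Real.sqrt ν * (x * Real.sqrt (velSq f ν x)) :=
      fun hx => bogW_eq hν0 hx.le
    generalize thermal β (bogW f ν k) (bogW f ν p) (bogW f ν q) = T
    simp only [hW]
    rw [hWe hk0, hWe hp0, hWe hq0]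
    have a1 := hμ0 k
    have a2 := hμ0 p
    have a3 := hμ0 q
    generalize Real.sqrt (velSq f ν k) = x1 at *
    generalize Real.sqrt (velSq f ν p) = x2 at *
    generalize Real.sqrt (velSq f ν q) = x3 at *
    generalize η p = y1 at *
    generalize η q = y2 at *
    clear_value S
    generalize Real.sqrt ν = σ at *
    subst hσ2
    field_simp
    ring

end IsProfile

/-! ### The damping rate at small momenta -/

theorem IsDispersion.momentumOf_mem {W W' : ℝ → ℝ} {R d : ℝ} (hW : IsDispersion W W' R d) {K u : ℝ}
    (hK : K ∈ Set.Icc 0 R) (hu : u ∈ Set.Ioo 0 (W K)) :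
    momentumOf W R u ∈ Set.Ioo 0 K ∧ W (momentumOf W R u) = u := by
  have h := hW.image_Ioo le_rfl hK.1 hK.2
  rw [hW.zero] at h
  rw [← h] at hu
  obtain ⟨x, hx, rfl⟩ := hu
  have := hW.momentumOf_apply (x := x) ⟨hx.1.le, hx.2.le.trans hK.2⟩
  rw [this]
  exact ⟨hx, rfl⟩

theorem integrableOn_leading {β E : ℝ} (hβ : 0 < β) (hE : 0 < E) :
    IntegrableOn (fun u => (u * (E - u)) ^ 2 * thermal β E u (E - u)) (Set.Ioo 0 E) := by
  refine IntegrableOn.of_bound (C := (1 + 1 / (β * E)) * ((E + 1 / β) * (E + 1 / β)) * (E * E))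
    (by simp) (Measurable.aestronglyMeasurable (by unfold thermal; fun_prop)) ?_
  refine (ae_restrict_iff' measurableSet_Ioo).2 (Eventually.of_forall fun u hu => ?_)
  have hu0 := hu.1
  have hw0 : 0 < E - u := by linarith [hu.2]
  have hth := thermal_le hβ hE hu0 hw0
  have hth0 := thermal_nonneg hβ hE.le hu0.le hw0.le
  rw [Real.norm_of_nonneg (by positivity)]
  calc (u * (E - u)) ^ 2 * thermal β E u (E - u)
      ≤ (u * (E - u)) ^ 2 * ((1 + 1 / (β * E)) * (1 + 1 / (β * u)) * (1 + 1 / (β * (E - u)))) := by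
        gcongr
    _ = (1 + 1 / (β * E)) * ((u + 1 / β) * ((E - u) + 1 / β)) * (u * (E - u)) := by
        field_simp
    _ ≤ _ := by
        have h1 : u ≤ E := hu.2.le
        have h2 : E - u ≤ E := by linarith
        gcongr

/-- The integral over the energy shell of the leading density is the function `𝓘`. -/
theorem integral_leading {β E : ℝ} (hβ : 0 < β) (hE : 0 < E) :
    ∫ u in Set.Ioo 0 E, (u * (E - u)) ^ 2 * thermal β E u (E - u)
      = E ^ 4 / (32 * β) * beliaevI (β * E) := by
  have hθ : 0 < β * E := mul_pos hβ hE
  rw [beliaevI, if_neg hθ.ne']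
  have h1 : ∫ u in Set.Ioo 0 E, (u * (E - u)) ^ 2 * thermal β E u (E - u)
      = ∫ u in (0 : ℝ)..E, (u * (E - u)) ^ 2 * ((1 - Real.exp (-(β * E))) /
        ((1 - Real.exp (-(β * u))) * (1 - Real.exp (-(β * (E - u)))))) := by
    rw [intervalIntegral.integral_of_le hE.le, integral_Ioc_eq_integral_Ioo]
    refine setIntegral_congr_fun measurableSet_Ioo fun u hu => ?_
    have := thermal_on_shell hβ hu.1 (sub_pos.2 hu.2)
    rw [add_sub_cancel] at this
    simp only [this]
  rw [h1]
  have h2 := intervalIntegral.integral_comp_mul_add (a := -1) (b := 1) (c := E / 2)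
    (fun u => (u * (E - u)) ^ 2 * ((1 - Real.exp (-(β * E))) /
        ((1 - Real.exp (-(β * u))) * (1 - Real.exp (-(β * (E - u)))))))
    (by positivity) (E / 2)
  have e1 : E / 2 * -1 + E / 2 = 0 := by ring
  have e2 : E / 2 * 1 + E / 2 = E := by ring
  rw [e1, e2, smul_eq_mul] at h2
  have h3 : (∫ u in (0 : ℝ)..E, (u * (E - u)) ^ 2 * ((1 - Real.exp (-(β * E))) /
        ((1 - Real.exp (-(β * u))) * (1 - Real.exp (-(β * (E - u)))))))
      = E / 2 * ∫ t in (-1 : ℝ)..1, (E ^ 4 / 16 * (1 - Real.exp (-(β * E)))) * ((1 - t ^ 2) ^ 2 /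
        ((1 - Real.exp (-(β * E) * ((1 + t) / 2))) *
          (1 - Real.exp (-(β * E) * ((1 - t) / 2))))) := by
    rw [← mul_right_inj' (show (E / 2)⁻¹ ≠ 0 by positivity), ← h2,
      inv_mul_cancel_left₀ (by positivity)]
    refine intervalIntegral.integral_congr fun t _ => ?_
    have q1 : E / 2 * t + E / 2 = E * ((1 + t) / 2) := by ring
    have q2 : E - E * ((1 + t) / 2) = E * ((1 - t) / 2) := by ring
    rw [q1, q2]
    have q3 : -(β * (E * ((1 + t) / 2))) = -(β * E) * ((1 + t) / 2) := by ring
    have q4 : -(β * (E * ((1 - t) / 2))) = -(β * E) * ((1 - t) / 2) := by ring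
    rw [q3, q4]
    ring
  rw [h3, intervalIntegral.integral_const_mul]
  field_simp
  ring

/-- Existence of the rate and its leading behaviour, for a radial profile. -/
theorem IsProfile.rate_estimate {f : ℝ → ℝ} {V R L B c : ℝ} (hP : IsProfile f V R L B c) :
    ∃ δ > 0, ∀ ν ∈ Set.Ioc 0 V, ∀ β > 0, ∀ v₀ > 0, ∀ k : R3, k ≠ 0 → ‖k‖ / Real.sqrt ν < δ →
      |velSq f ν ‖k‖ - 1| ≤ (L * V + 1) * (‖k‖ ^ 2 / ν) ∧
      (L * V + 1) * (‖k‖ ^ 2 / ν) ≤ 1 / 4000 ∧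
      (∀ ε > 0, Integrable fun p : R3 => bogDensity f ν β v₀ ‖k‖ ‖p‖ ‖p - k‖ *
        lorentzian ε (bogW f ν ‖k‖ - bogW f ν ‖p‖ - bogW f ν ‖p - k‖)) ∧
      ∃ Γ, Tendsto (fun ε => ∫ p : R3, bogDensity f ν β v₀ ‖k‖ ‖p‖ ‖p - k‖ *
        lorentzian ε (bogW f ν ‖k‖ - bogW f ν ‖p‖ - bogW f ν ‖p - k‖)) (𝓝[>] 0) (𝓝 Γ) ∧
        |Γ - 9 * v₀ / (32 * Real.pi ^ 2 * (ν ^ 3 * Real.sqrt ν)) *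
            (bogW f ν ‖k‖ ^ 4 / (32 * β) * beliaevI (β * bogW f ν ‖k‖))|
          ≤ 7000000 * ((L * V + 1) * (‖k‖ ^ 2 / ν)) *
            (9 * v₀ / (32 * Real.pi ^ 2 * (ν ^ 3 * Real.sqrt ν)) *
            (bogW f ν ‖k‖ ^ 4 / (32 * β) * beliaevI (β * bogW f ν ‖k‖))) := by
  have hV := hP.V_pos
  have hR := hP.R_pos
  have hL := hP.L_pos
  have hc := hP.c_pos
  have hpi := Real.pi_pos
  have hsV : 0 < Real.sqrt V := Real.sqrt_pos.2 hV
  have hsc : 0 < Real.sqrt c := Real.sqrt_pos.2 hc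
  have hΛ : 0 < L * V + 1 := by positivity
  have hsΛ : 0 < Real.sqrt (L * V + 1) := Real.sqrt_pos.2 hΛ
  -- the three bounds give `‖k‖ < R / 4`, `ω(k) ≤ √(ν c) R / 4` and a relative error at most
  -- `1 / 64² ≤ 1 / 4000`
  refine ⟨min (R / (4 * Real.sqrt V)) (min (Real.sqrt c * R / (8 * Real.sqrt V))
    (1 / (64 * Real.sqrt (L * V + 1)))), by positivity, fun ν hν β hβ v₀ hv k hk0 hkδ => ?_⟩
  have hν0 := hν.1
  have hsν : 0 < Real.sqrt ν := Real.sqrt_pos.2 hν0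
  have hsνV : Real.sqrt ν ≤ Real.sqrt V := Real.sqrt_le_sqrt hν.2
  have hK : 0 < ‖k‖ := norm_pos_iff.2 hk0
  obtain ⟨h1, h23⟩ := lt_min_iff.1 hkδ
  obtain ⟨h2, h3⟩ := lt_min_iff.1 h23
  have hscale : ∀ {a : ℝ}, 0 < a → ‖k‖ / Real.sqrt ν < a / Real.sqrt V → ‖k‖ < a :=
    fun {a} ha h => by
      rw [div_lt_div_iff₀ hsν hsV] at h
      have : a * Real.sqrt ν ≤ a * Real.sqrt V := by gcongr
      exact lt_of_mul_lt_mul_right (h.trans_le this) hsV.le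
  have hkR : ‖k‖ < R / 4 := hscale (by positivity) (by rwa [div_div])
  have hkc : ‖k‖ < Real.sqrt c * R / 8 := hscale (by positivity) (by rwa [div_div])
  have hτ : (L * V + 1) * (‖k‖ ^ 2 / ν) ≤ 1 / 4000 := by
    have e : ‖k‖ ^ 2 / ν = (‖k‖ / Real.sqrt ν) ^ 2 := by
      rw [div_pow, Real.sq_sqrt hν0.le]
    have h4 : (‖k‖ / Real.sqrt ν) ^ 2 ≤ (1 / (64 * Real.sqrt (L * V + 1))) ^ 2 :=
      pow_le_pow_left₀ (by positivity) h3.le 2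
    rw [e]
    calc (L * V + 1) * (‖k‖ / Real.sqrt ν) ^ 2
        ≤ (L * V + 1) * (1 / (64 * Real.sqrt (L * V + 1))) ^ 2 := by gcongr
      _ = 1 / 4096 := by
        rw [div_pow, mul_pow, Real.sq_sqrt hΛ.le]; field_simp; norm_num
      _ ≤ _ := by norm_num
  have hm := hP.abs_velSq_sub_one_le hν (x := ‖k‖) ⟨hK.le, by linarith⟩
  have hsmall : bogW f ν ‖k‖ ≤ Real.sqrt (ν * c) * (R / 4) := by
    rw [bogW_eq hν0 hK.le, Real.sqrt_mul hν0.le, mul_assoc]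
    refine mul_le_mul_of_nonneg_left ?_ hsν.le
    have h5 : Real.sqrt (velSq f ν ‖k‖) ≤ 2 :=
      Real.sqrt_le_iff.2 ⟨by norm_num, by linarith [(abs_le.1 hm).2]⟩
    calc ‖k‖ * Real.sqrt (velSq f ν ‖k‖) ≤ Real.sqrt c * R / 8 * 2 := by gcongr
      _ = _ := by ring
  obtain ⟨hint, hlim, hshell⟩ := hP.tendsto_rate hν hβ hv hk0 (by linarith) hsmall
  refine ⟨hm, hτ, hint, _, hlim, ?_⟩
  have hE := hP.bogW_pos hν hK
  set E := bogW f ν ‖k‖ with hEdef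
  set A := 9 * v₀ / (32 * Real.pi ^ 2 * (ν ^ 3 * Real.sqrt ν)) with hA
  have hA0 : 0 < A := by positivity
  rw [← integral_leading hβ hE, ← integral_const_mul, ← integral_const_mul]
  have hlead := integrableOn_leading hβ hE
  rw [← integral_sub hshell (hlead.const_mul A), ← Real.norm_eq_abs]
  refine norm_integral_le_of_norm_le ((hlead.const_mul A).const_mul _) ?_
  refine (ae_restrict_iff' measurableSet_Ioo).2 (Eventually.of_forall fun u hu => ?_)
  have hdisp := hP.isDispersion hν
  have hKmem : ‖k‖ ∈ Set.Icc 0 R := ⟨hK.le, by linarith⟩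
  have hu' : E - u ∈ Set.Ioo 0 E := ⟨by linarith [hu.2], by linarith [hu.1]⟩
  obtain ⟨hp, hWp⟩ := hdisp.momentumOf_mem hKmem hu
  obtain ⟨hq, hWq⟩ := hdisp.momentumOf_mem hKmem hu'
  obtain ⟨X, hX, heq⟩ := hP.shell_density_estimate hν (β := β) (v₀ := v₀) (k := ‖k‖)
    ⟨hK, by linarith⟩ hp hq (by rw [hWp, hWq]; ring) hτ
  rw [heq, hWp, hWq, ← hA, ← hEdef]
  have hnn : 0 ≤ A * ((u * (E - u)) ^ 2 * thermal β E u (E - u)) := by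
    have := thermal_nonneg hβ hE.le hu.1.le hu'.1.le
    positivity
  rw [← mul_sub_one, Real.norm_eq_abs, abs_mul, abs_of_nonneg hnn, mul_comm]
  exact mul_le_mul_of_nonneg_right hX hnn

theorem rpow_three_halves {ν : ℝ} (hν : 0 < ν) : ν ^ (3 / 2 : ℝ) = ν * Real.sqrt ν := by
  rw [Real.sqrt_eq_rpow, ← Real.rpow_one_add' hν.le (by norm_num)]; norm_num

theorem rpow_five_halves {ν : ℝ} (hν : 0 < ν) : ν ^ (5 / 2 : ℝ) = ν ^ 2 * Real.sqrt ν := by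
  rw [Real.sqrt_eq_rpow, ← Real.rpow_natCast, ← Real.rpow_add hν]; norm_num

/-- Replacing a factor `I` of a main term by an approximation `J`. -/
theorem abs_sub_le_of_factor {γ P I J A t e E₀ : ℝ} (hP : 0 < P) (hA : 0 ≤ A)
    (ht : 0 ≤ t) (h : |γ - P * I| ≤ A * t * (P * I)) (hIJ : |I - J| ≤ e * J) (he : e ≤ E₀)
    (hJ : 0 < J) : |γ - P * J| ≤ (A * (1 + E₀) * t + e) * (P * J) := by
  have h1 : γ - P * J = (γ - P * I) + P * (I - J) := by ring
  have h2 : I ≤ (1 + E₀) * J := by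
    have := (abs_le.1 hIJ).2
    have : e * J ≤ E₀ * J := by gcongr
    linarith
  rw [h1]
  refine (abs_add_le _ _).trans ?_
  rw [abs_mul, abs_of_pos hP]
  calc |γ - P * I| + P * |I - J| ≤ A * t * (P * ((1 + E₀) * J)) + P * (e * J) := by
        gcongr
        exact h.trans (by gcongr)
    _ = _ := by ring

/-! ### The damping rate in the original variables -/

/-- Existence of the rate and its leading behaviour, in the original variables, together with the
linear approximation of the dispersion relation. -/
theorem exists_rate_estimate {v : R3 → ℝ} {V R L B c : ℝ}
    (hP : IsProfile (fun x => vhatRadial v x / vhat v 0) V R L B c) (hpos0 : 0 < vhat v 0)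
    (hr : ∀ p, vhat v p = vhatRadial v ‖p‖) :
    ∃ C > 0, ∃ δ > 0, ∀ ν ∈ Set.Ioc 0 V, ∀ β > 0, ∀ k : R3, k ≠ 0 → ‖k‖ / Real.sqrt ν < δ →
      DeltaIntegrable (beliaevDensity v ν β k) (beliaevPhase v ν k) ∧
      |gammaB v ν β k - 9 * vhat v 0 * ν ^ (3 / 2 : ℝ) / (2048 * Real.pi) * (‖k‖ ^ 4 / ν ^ 2) *
          (1 / (β * ν)) * beliaevI (β * omegaBg v ν k)|
        ≤ C * (‖k‖ ^ 2 / ν) *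
          (9 * vhat v 0 * ν ^ (3 / 2 : ℝ) / (2048 * Real.pi) * (‖k‖ ^ 4 / ν ^ 2) *
            (1 / (β * ν)) * beliaevI (β * omegaBg v ν k)) ∧
      |omegaBg v ν k - Real.sqrt ν * ‖k‖|
        ≤ min (C * (‖k‖ ^ 2 / ν)) (1 / 2) * (Real.sqrt ν * ‖k‖) := by
  have hΛ : 0 < L * V + 1 := by have := hP.L_pos; have := hP.V_pos; positivity
  have hpi := Real.pi_pos
  obtain ⟨δ, hδ, h⟩ := hP.rate_estimate
  -- `28000003 = 4 · 7000000 + 3`: the rate is compared with `m(k)² P`, where `m(k)² ≤ 4`, and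
  -- `m(k)²` differs from `1` by at most three times the relative error
  refine ⟨28000003 * (L * V + 1), by positivity, δ, hδ, fun ν hν β hβ k hk hkδ => ?_⟩
  have hν0 := hν.1
  have hK : 0 < ‖k‖ := norm_pos_iff.2 hk
  have hsν : 0 < Real.sqrt ν := Real.sqrt_pos.2 hν0
  obtain ⟨hm, hτ, hint, Γ, hlim, hΓ⟩ := h ν hν β hβ (vhat v 0) hpos0 k hk hkδ
  set f : ℝ → ℝ := fun x => vhatRadial v x / vhat v 0 with hf
  have hω : omegaBg v ν k = bogW f ν ‖k‖ := by
    rw [omegaBg, bogW, hf]; simp only [hr k, mul_div_assoc]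
  have hint' : ∀ ε p, deltaIntegrand (beliaevDensity v ν β k) (beliaevPhase v ν k) ε p
      = bogDensity f ν β (vhat v 0) ‖k‖ ‖p‖ ‖p - k‖ *
        lorentzian ε (bogW f ν ‖k‖ - bogW f ν ‖p‖ - bogW f ν ‖p - k‖) := fun ε p => by
    rw [deltaIntegrand, beliaevDensity_eq hpos0 hr hν0, beliaevPhase_eq hr, lorentzian]
  have hlim' : Tendsto (fun ε => ∫ p : R3, deltaIntegrand (beliaevDensity v ν β k)
      (beliaevPhase v ν k) ε p) (𝓝[>] (0 : ℝ)) (𝓝 Γ) := by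
    simp only [hint']; exact hlim
  have hγ : gammaB v ν β k = Real.pi / 2 * Γ := by rw [gammaB, deltaIntegral, hlim'.limUnder_eq]
  set τ := (L * V + 1) * (‖k‖ ^ 2 / ν) with hτdef
  have hτ0 : 0 ≤ τ := (abs_nonneg _).trans hm
  set m := velSq f ν ‖k‖ with hmdef
  have hm0 : 0 < m := hP.velSq_pos hν _
  have hmb := abs_le.1 hm
  refine ⟨⟨fun ε hε => (hint ε hε).congr (Eventually.of_forall fun p => (hint' ε p).symm), Γ, hlim'⟩,
    ?_, ?_⟩
  · rw [hω]
    have hI := beliaevI_pos (mul_pos hβ (hP.bogW_pos hν hK))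
    generalize beliaevI (β * bogW f ν ‖k‖) = I at hΓ hI ⊢
    set P := 9 * vhat v 0 * ν ^ (3 / 2 : ℝ) / (2048 * Real.pi) * (‖k‖ ^ 4 / ν ^ 2) *
          (1 / (β * ν)) * I with hPdef
    have hP0 : 0 < P := by positivity
    have hs2 : Real.sqrt ν ^ 2 = ν := Real.sq_sqrt hν0.le
    have hW4 : bogW f ν ‖k‖ ^ 4 = ν ^ 2 * ‖k‖ ^ 4 * m ^ 2 := by
      have := hP.bogW_sq hν ‖k‖
      calc bogW f ν ‖k‖ ^ 4 = (bogW f ν ‖k‖ ^ 2) ^ 2 := by ring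
        _ = _ := by rw [this]; ring
    have hmain : Real.pi / 2 * (9 * vhat v 0 / (32 * Real.pi ^ 2 * (ν ^ 3 * Real.sqrt ν)) *
            (bogW f ν ‖k‖ ^ 4 / (32 * β) * I)) = P * m ^ 2 := by
      rw [hW4, hPdef, rpow_three_halves hν0]
      field_simp
      rw [hs2]
      ring
    have h1 : |gammaB v ν β k - P * m ^ 2| ≤ 7000000 * τ * (P * m ^ 2) := by
      rw [hγ, ← hmain, ← mul_sub, abs_mul, abs_of_pos (by positivity : 0 < Real.pi / 2)]
      calc Real.pi / 2 * |_| ≤ Real.pi / 2 * _ := mul_le_mul_of_nonneg_left hΓ (by positivity)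
        _ = _ := by ring
    have h2 : |m ^ 2 - 1| ≤ 3 * τ := by
      rw [show m ^ 2 - 1 = (m - 1) * (m + 1) by ring, abs_mul,
        abs_of_pos (show 0 < m + 1 by linarith), mul_comm]
      have : m + 1 ≤ 3 := by linarith [hmb.2]
      gcongr
    have h3 : m ^ 2 ≤ 4 := by nlinarith [hmb.2]
    have e : gammaB v ν β k - P = (gammaB v ν β k - P * m ^ 2) + P * (m ^ 2 - 1) := by ring
    rw [e]
    refine (abs_add_le _ _).trans ?_
    rw [abs_mul, abs_of_pos hP0]
    calc |gammaB v ν β k - P * m ^ 2| + P * |m ^ 2 - 1|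
        ≤ 7000000 * τ * (P * 4) + P * (3 * τ) := by
          gcongr
          exact h1.trans (by gcongr)
      _ = 28000003 * (L * V + 1) * (‖k‖ ^ 2 / ν) * P := by rw [hτdef]; ring
  · have h4 : |Real.sqrt m - 1| ≤ τ := by
      have h5 : NearOne 1 τ m := by unfold NearOne; simpa using hm
      have h6 := h5.sqrt hm0.le
      unfold NearOne at h6
      simpa using h6
    have e : omegaBg v ν k - Real.sqrt ν * ‖k‖
        = (Real.sqrt m - 1) * (Real.sqrt ν * ‖k‖) := by
      rw [hω, bogW_eq hν0 hK.le]; ring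
    rw [e, abs_mul, abs_of_pos (mul_pos hsν hK)]
    refine mul_le_mul_of_nonneg_right (le_min ?_ ?_) (by positivity)
    · refine h4.trans ?_
      rw [mul_assoc, ← hτdef]
      linarith
    · linarith

end

theorem mainTheorem1 (v : R3 → ℝ) (V : ℝ) (hV : 0 < V)
    (hL1 : Integrable v)
    (hL2 : MemLp (fourierC v) 2)
    (hpos0 : 0 < vhat v 0)
    (hpos : ∀ ν ∈ Set.Ioc 0 V, ∀ k : R3, -(vhat v 0) * (‖k‖ ^ 2 / (4 * ν)) < vhat v k)
    (hsymm : ∀ᵐ x : R3, v (-x) = v x)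
    (hrot : ∀ R : R3 ≃ₗᵢ[ℝ] R3, LinearMap.det (R.toLinearEquiv : R3 →ₗ[ℝ] R3) = 1 →
      ∀ᵐ x : R3, v (R x) = v x)
    (hC5 : ContDiffAt ℝ 5 (vhat v) 0)
    (hconv : ∀ ν ∈ Set.Ioc 0 V, -(1 / 2) < ν / vhat v 0 * iteratedDeriv 2 (vhatRadial v) 0) :
    -- the defining integral makes sense for small `|k| / √ν`, and full formula for the rate
    (∃ C > 0, ∃ δ > 0, ∀ ν ∈ Set.Ioc 0 V, ∀ β > 0, ∀ k : R3, k ≠ 0 → ‖k‖ / Real.sqrt ν < δ →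
      DeltaIntegrable (beliaevDensity v ν β k) (beliaevPhase v ν k) ∧
      |gammaB v ν β k - 9 * vhat v 0 * ν ^ (3 / 2 : ℝ) / (2048 * Real.pi) * (‖k‖ ^ 4 / ν ^ 2) *
          (1 / (β * ν)) * beliaevI (β * omegaBg v ν k)|
        ≤ C * (‖k‖ ^ 2 / ν) *
          (9 * vhat v 0 * ν ^ (3 / 2 : ℝ) / (2048 * Real.pi) * (‖k‖ ^ 4 / ν ^ 2) *
            (1 / (β * ν)) * beliaevI (β * omegaBg v ν k))) ∧
    -- properties of `𝓘`
    ContinuousOn beliaevI (Set.Ici 0) ∧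
    (∀ θ > 0,
      beliaevI θ = 32 * θ * (1 / 30 + 4 * (zetaR 3 / θ ^ 3 - 6 * (zetaR 4 / θ ^ 4)
        + 12 * (zetaR 5 / θ ^ 5) - polyLi 3 (Real.exp (-θ)) / θ ^ 3
        - 6 * (polyLi 4 (Real.exp (-θ)) / θ ^ 4) - 12 * (polyLi 5 (Real.exp (-θ)) / θ ^ 5)))) ∧
    ((fun θ : ℝ => beliaevI θ - 16 / 3) =O[𝓝[>] (0 : ℝ)] (fun θ : ℝ => θ)) ∧
    ((fun θ : ℝ => beliaevI θ - 16 / 15 * θ) =O[atTop] (fun θ : ℝ => 1 / θ ^ 2)) ∧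
    -- small temperature / momentum ratio
    (∃ C > 0, ∃ δ > 0, ∀ ν ∈ Set.Ioc 0 V, ∀ β > 0, ∀ k : R3, k ≠ 0 → ‖k‖ / Real.sqrt ν < δ →
      1 / (β * Real.sqrt ν * ‖k‖) < δ →
      |gammaB v ν β k -
          3 * vhat v 0 * ν ^ (3 / 2 : ℝ) / (640 * Real.pi) * (‖k‖ ^ 5 / ν ^ (5 / 2 : ℝ))|
        ≤ C * (1 / (β * Real.sqrt ν * ‖k‖) ^ 3 + ‖k‖ ^ 2 / ν) *
          (3 * vhat v 0 * ν ^ (3 / 2 : ℝ) / (640 * Real.pi) * (‖k‖ ^ 5 / ν ^ (5 / 2 : ℝ)))) ∧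
    -- small momentum / temperature ratio
    (∃ C > 0, ∃ δ > 0, ∀ ν ∈ Set.Ioc 0 V, ∀ β > 0, ∀ k : R3, k ≠ 0 → ‖k‖ / Real.sqrt ν < δ →
      β * Real.sqrt ν * ‖k‖ < δ →
      |gammaB v ν β k -
          3 * vhat v 0 * ν ^ (3 / 2 : ℝ) / (128 * Real.pi) * (‖k‖ ^ 4 / ν ^ 2) * (1 / (β * ν))|
        ≤ C * (β * Real.sqrt ν * ‖k‖ + ‖k‖ ^ 2 / ν) *
          (3 * vhat v 0 * ν ^ (3 / 2 : ℝ) / (128 * Real.pi) * (‖k‖ ^ 4 / ν ^ 2) *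
            (1 / (β * ν)))) := by
  obtain ⟨R, L, B, c, hP⟩ := exists_isProfile hV hL1 hpos0 hpos hsymm hrot hC5 hconv
  have hr := vhat_eq_radial hsymm hrot
  obtain ⟨C, hC, δ, hδ, key⟩ := exists_rate_estimate hP hpos0 hr
  obtain ⟨D, hD, hlarge⟩ := exists_abs_beliaevI_sub_le
  have hpi := Real.pi_pos
  refine ⟨⟨C, hC, δ, hδ, fun ν hν β hβ k hk hkδ =>
      ⟨(key ν hν β hβ k hk hkδ).1, (key ν hν β hβ k hk hkδ).2.1⟩⟩,
    continuousOn_beliaevI, fun θ hθ => beliaevI_eq_polyLi hθ, ?_, ?_, ?_, ?_⟩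
  · refine Asymptotics.IsBigO.of_bound 66 ?_
    filter_upwards [self_mem_nhdsWithin] with θ hθ
    have hθ' : (0 : ℝ) < θ := hθ
    rw [Real.norm_eq_abs, Real.norm_of_nonneg hθ'.le]
    exact abs_beliaevI_sub_le hθ'.le
  · refine Asymptotics.IsBigO.of_bound D ?_
    filter_upwards [eventually_ge_atTop 1] with θ hθ
    rw [Real.norm_eq_abs, Real.norm_of_nonneg (by positivity)]
    refine (hlarge θ hθ).trans (le_of_eq ?_)
    ring
  · refine ⟨C * (1 + (4 * D + 1)) + 4 * D + C, by positivity, min δ (1 / 2), by positivity,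
      fun ν hν β hβ k hk hkδ hT => ?_⟩
    have hν0 := hν.1
    have hK : 0 < ‖k‖ := norm_pos_iff.2 hk
    have hsν : 0 < Real.sqrt ν := Real.sqrt_pos.2 hν0
    obtain ⟨-, hγ, hω⟩ := key ν hν β hβ k hk (hkδ.trans_le (min_le_left _ _))
    -- `T` is the argument of `𝓘` for the linear dispersion relation
    set T := β * Real.sqrt ν * ‖k‖ with hTdef
    have hT0 : 0 < T := by positivity
    set t := ‖k‖ ^ 2 / ν with ht
    have ht0 : 0 ≤ t := by positivity
    have hT2 : 2 ≤ T := by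
      have := hT.trans_le (min_le_right _ _)
      rw [div_lt_div_iff₀ hT0 two_pos] at this
      linarith
    set θ := β * omegaBg v ν k with hθ
    have hθT : |θ - T| ≤ min (C * t) (1 / 2) * T := by
      have e : θ - T = β * (omegaBg v ν k - Real.sqrt ν * ‖k‖) := by rw [hθ, hTdef]; ring
      rw [e, abs_mul, abs_of_pos hβ]
      calc β * _ ≤ β * (min (C * t) (1 / 2) * (Real.sqrt ν * ‖k‖)) := by gcongr
        _ = _ := by rw [hTdef]; ring
    have hθ2 : T / 2 ≤ θ := by
      have h1 := (abs_le.1 hθT).1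
      have h2 : min (C * t) (1 / 2) * T ≤ 1 / 2 * T := by gcongr; exact min_le_right _ _
      linarith
    have hI : |beliaevI θ - 16 / 15 * T|
        ≤ (4 * D * (1 / T ^ 3) + min (C * t) (1 / 2)) * (16 / 15 * T) := by
      have h1 := hlarge θ (by linarith)
      have h2 : D / θ ^ 2 ≤ D / (T / 2) ^ 2 := by gcongr
      have h3 : D / (T / 2) ^ 2 = 4 * D * (1 / T ^ 3) * T := by field_simp; norm_num
      have h4 : 0 ≤ 4 * D * (1 / T ^ 3) * T := by positivity
      have e : beliaevI θ - 16 / 15 * T = (beliaevI θ - 16 / 15 * θ) + 16 / 15 * (θ - T) := by ring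
      rw [e]
      refine (abs_add_le _ _).trans ?_
      rw [abs_mul, abs_of_pos (show (0 : ℝ) < 16 / 15 by norm_num)]
      linarith
    have hT3 : 1 / T ^ 3 ≤ 1 := by
      rw [div_le_one (by positivity)]
      exact one_le_pow₀ (by linarith)
    have hfin := abs_sub_le_of_factor (P := 9 * vhat v 0 * ν ^ (3 / 2 : ℝ) / (2048 * Real.pi) *
      (‖k‖ ^ 4 / ν ^ 2) * (1 / (β * ν))) (E₀ := 4 * D + 1) (by positivity) hC.le ht0 hγ hI
      (by
        have : 4 * D * (1 / T ^ 3) ≤ 4 * D * 1 := by gcongr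
        linarith [min_le_right (C * t) (1 / 2)]) (by positivity)
    have hmain : 9 * vhat v 0 * ν ^ (3 / 2 : ℝ) / (2048 * Real.pi) * (‖k‖ ^ 4 / ν ^ 2) *
        (1 / (β * ν)) * (16 / 15 * T)
        = 3 * vhat v 0 * ν ^ (3 / 2 : ℝ) / (640 * Real.pi) * (‖k‖ ^ 5 / ν ^ (5 / 2 : ℝ)) := by
      have hs2 : Real.sqrt ν ^ 2 = ν := Real.sq_sqrt hν0.le
      rw [rpow_five_halves hν0, hTdef]
      generalize ν ^ (3 / 2 : ℝ) = z
      field_simp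
      rw [hs2]
      ring
    rw [hmain] at hfin
    refine hfin.trans (mul_le_mul_of_nonneg_right ?_ (by positivity))
    have h5 : min (C * t) (1 / 2) ≤ C * t := min_le_left _ _
    have h6 : 0 ≤ 1 / T ^ 3 := by positivity
    have h7 : 0 ≤ C * (1 + (4 * D + 1)) * (1 / T ^ 3) := by positivity
    have h8 : 0 ≤ 4 * D * t := by positivity
    have h9 : 0 ≤ C * (1 / T ^ 3) := by positivity
    linarith
  · refine ⟨C * (1 + 25) + 25, by positivity, min δ 1, by positivity,
      fun ν hν β hβ k hk hkδ hT => ?_⟩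
    have hν0 := hν.1
    have hK : 0 < ‖k‖ := norm_pos_iff.2 hk
    have hsν : 0 < Real.sqrt ν := Real.sqrt_pos.2 hν0
    obtain ⟨-, hγ, hω⟩ := key ν hν β hβ k hk (hkδ.trans_le (min_le_left _ _))
    -- `T` is the argument of `𝓘` for the linear dispersion relation
    set T := β * Real.sqrt ν * ‖k‖ with hTdef
    have hT0 : 0 < T := by positivity
    set t := ‖k‖ ^ 2 / ν with ht
    have ht0 : 0 ≤ t := by positivity
    have hT1 : T ≤ 1 := (hT.trans_le (min_le_right _ _)).le
    have hθ0 : 0 ≤ β * omegaBg v ν k := mul_nonneg hβ.le (Real.sqrt_nonneg _)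
    have hθT : β * omegaBg v ν k ≤ 3 / 2 * T := by
      have h1 := (abs_le.1 hω).2
      have h2 : min (C * t) (1 / 2) * (Real.sqrt ν * ‖k‖) ≤ 1 / 2 * (Real.sqrt ν * ‖k‖) := by
        gcongr; exact min_le_right _ _
      calc β * omegaBg v ν k ≤ β * (3 / 2 * (Real.sqrt ν * ‖k‖)) := by gcongr; linarith
        _ = _ := by rw [hTdef]; ring
    have hI : |beliaevI (β * omegaBg v ν k) - 16 / 3| ≤ 25 * T * (16 / 3) :=
      (abs_beliaevI_sub_le hθ0).trans (by linarith)
    have hfin := abs_sub_le_of_factor (P := 9 * vhat v 0 * ν ^ (3 / 2 : ℝ) / (2048 * Real.pi) *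
      (‖k‖ ^ 4 / ν ^ 2) * (1 / (β * ν))) (E₀ := 25) (by positivity) hC.le ht0 hγ hI
      (by linarith) (by positivity)
    have hmain : 9 * vhat v 0 * ν ^ (3 / 2 : ℝ) / (2048 * Real.pi) * (‖k‖ ^ 4 / ν ^ 2) *
        (1 / (β * ν)) * (16 / 3)
        = 3 * vhat v 0 * ν ^ (3 / 2 : ℝ) / (128 * Real.pi) * (‖k‖ ^ 4 / ν ^ 2) *
          (1 / (β * ν)) := by
      ring
    rw [hmain] at hfin
    refine hfin.trans (mul_le_mul_of_nonneg_right ?_ (by positivity))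
    have h7 : 0 ≤ C * (1 + 25) * T := by positivity
    linarith
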